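/- **Setting.** Fix a prime $p$. Let $A\neq 0$ be a $p$-torsion-free perfectoid ring: $A$ is $\pi$-adically complete and separated for some $\pi\in A$ with $\pi^p\mid p$, the Frobenius of $A/pA$ is surjective, and the kernel of Fontaine's map $\theta:W(A^\flat)\to A$ is principal. Let $\zeta_p,\zeta_{p^2},\dots\in A$ be a compatible system of primitive $p$-power roots of unity, i.e. $\zeta_{p^r}$ is a root of the $p^r$-th cyclotomic polynomial and $\zeta_{p^{r+1}}^p=\zeta_{p^r}$. Put $\varepsilon=(1,\zeta_p,\zeta_{p^2},\dots)\in A^\flat$, let $\varphi$ be the Frobenius of $W(A^\flat)$, and put $$\mu=[\varepsilon]-1,\qquad \xi=\sum_{i=0}^{p-1}[\varepsilon^{1/p}]^i,\qquad \tilde\xi_r=\varphi(\xi)\varphi^2(\xi)\cdots\varphi^r(\xi).$$ Let $\theta_r:W(A^\flat)\to W_r(A)$ be the ring homomorphism with ghost components $\theta,\theta\varphi,\dots,\theta\varphi^{r-1}$ obtained by functoriality from $W(A^\flat)\to W(W(A^\flat))$, and $\tilde\theta_r=\theta_r\varphi^{-r}$; it induces an isomorphism $W(A^\flat)/\tilde\xi_r\cong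 W_r(A)$, and $\tilde\theta_r(\mu)=[\zeta_{p^r}]-1$. For $K\in D(W(A^\flat))$ write $K/\tilde\xi_r=K\otimes^{\mathbb L}_{W(A^\flat)}W(A^\flat)/\tilde\xi_r$. For a complex $K$ of $f$-torsion-free modules, $L\eta_fK$ is the complex $\eta_fK$ with terms $\{x\in f^iK^i: dx\in f^{i+1}K^{i+1}\}\subseteq K^i[1/f]$. Let $D$ be a commutative algebra object of the symmetric monoidal category $D(W(A^\flat))$ with $H^n(D)=0$ for $n<0$, together with a $\varphi$-semilinear automorphism $\varphi_D$ of algebra objects, such that * (𝒲1) $H^0(D)$ is $\mu$-torsion-free; * (𝒲2) the groups $H^n((L\eta_\mu D)/\tilde\xi_r)$ are $p$-torsion-free for all $r\ge0$ and $n\in\mathbb Z$; * (𝒲3) the base change map $(L\eta_\mu D)/\tilde\xi_r\to L\eta_{[\zeta_{p^r}]-1}(D/\tilde\xi_r)$ is a quasi-isomorphism for all $r\ge1$. Put $\mathcal W_r^n(D)=H^n((L\eta_\mu D)/\tilde\xi_r)$ for $n\ge0$. By (𝒲1) there is, in degrees $n\ge 0$, a canonical map $\iota:\mathcal W_r^n(D)\to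 H^n(D/\tilde\xi_r)$, induced by $f^iK^i\subseteq K^i$ for $f=\mu$, $i\ge0$. On the groups $H^n(D/\tilde\xi_r)$ let $R':H^n(D/\tilde\xi_{r+1})\to H^n(D/\tilde\xi_r)$ be induced by $\varphi_D^{-1}\otimes\varphi^{-1}$, let $F:H^n(D/\tilde\xi_{r+1})\to H^n(D/\tilde\xi_r)$ be induced by the canonical projection, and $V:H^n(D/\tilde\xi_r)\to H^n(D/\tilde\xi_{r+1})$ by multiplication by $\varphi^{r+1}(\xi)$. Let $B$ be an $A$-algebra with $W_r(A)$-algebra homomorphisms $\lambda_r:W_r(B)\to H^0(D/\tilde\xi_r)$, $r\ge1$, such that $\lambda_rR=R'\lambda_{r+1}$, $\lambda_rF=F\lambda_{r+1}$ and $\lambda_{r+1}V=V\lambda_r$. **Witt complexes.** A Witt complex for $A\to B$ consists of graded-commutative differential graded $W_r(A)$-algebras $\mathcal W_r^\bullet=\bigoplus_{n\ge0}\mathcal W_r^n$ (with $x^2=0$ for $x$ of odd degree), $r\ge1$; morphisms $R:\mathcal W_{r+1}^\bullet\to\mathcal W_r^\bullet$ of differential graded rings, and $F:\mathcal W_{r+1}^\bullet\to\mathcal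 W_r^\bullet$ of graded rings, semilinear over $R,F:W_{r+1}(A)\to W_r(A)$; additive graded maps $V:\mathcal W_r^\bullet\to\mathcal W_{r+1}^\bullet$ with $V(F(a)x)=aV(x)$ for $a\in W_{r+1}(A)$ and $V(F(x)y)=xV(y)$; and $W_r(A)$-algebra homomorphisms $\lambda_r:W_r(B)\to\mathcal W_r^0$ commuting with $R,F,V$; such that $RF=FR$, $RV=VR$, $FV=p$, $FdV=d$, and $Fd\lambda_{r+1}([b])=\lambda_r([b])^{p-1}d\lambda_r([b])$ for $b\in B$. The initial Witt complex for $A\to B$ is the relative de Rham–Witt complex $W_r\Omega^\bullet_{B/A}$. **Theorem.** (1) There is exactly one structure of Witt complex for $A\to B$ on the groups $\mathcal W_r^n(D)$ such that: $W_r(A)$ acts through $\tilde\theta_r$; the differential is the Bockstein $\mathrm{Bock}_{\tilde\xi_r}$ of $L\eta_\mu D$; $\iota$ is multiplicative and unital and commutes with $F$ and $V$; $\iota R=\tilde\theta_r(\xi)^nR'\iota$ in degree $n$; and, for each $b\in W_r(B)$, the structure map $\lambda_r^{0}:W_r(B)\to\mathcal W_r^0(D)$ satisfies $([\zeta_{p^r}]-1)\cdot\big(\iota(\lambda_r^{0}(b))-\lambda_r(b)\big)=0$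 in $H^0(D/\tilde\xi_r)$ (so $\iota\circ\lambda_r^{0}=\lambda_r$ whenever $H^0(D/\tilde\xi_r)$ is $([\zeta_{p^r}]-1)$-torsion-free). (2) Consequently there is a unique morphism of Witt complexes $\lambda_r^\bullet:W_r\Omega_{B/A}^\bullet\to\mathcal W_r^\bullet(D)$. (3) These are functorial: if $(D',\varphi_{D'})$, $B'$, $\lambda'_r$ are further data as above, $f:D\to D'$ is a morphism of algebra objects commuting with $\varphi_D,\varphi_{D'}$, and $g:B\to B'$ is a morphism of $A$-algebras with $H^0(f/\tilde\xi_r)\circ\lambda_r=\lambda'_r\circ W_r(g)$ for all $r$, then the maps $\mathcal W_r^n(D)\to\mathcal W_r^n(D')$ induced by $f$ form a morphism of Witt complexes over $g$, and the square they form with $\lambda_r^\bullet$, $\lambda_r'^\bullet$ and $W_r\Omega^\bullet_{B/A}\to W_r\Omega^\bullet_{B'/A}$ commutes. -/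

import Mathlib

universe u v

open CategoryTheory

noncomputable section

namespace AInf

/-! ### Truncated Witt vectors and their operators -/

section Witt

variable (p : ℕ) [Fact p.Prime]

/-- The ring `W_r(B)` of `p`-typical Witt vectors of length `r`. -/
abbrev W (r : ℕ) (B : Type u) : Type u := TruncatedWittVector p r B

variable {p}

variable {B : Type u} [CommRing B] {B' : Type v} [CommRing B']

theorem mem_ker_truncate_iff (r : ℕ) (x : WittVector p B) :
    WittVector.truncate r x = 0 ↔ ∃ y, x = WittVector.verschiebung^[r] y := by
  rw [← RingHom.mem_ker, WittVector.mem_ker_truncate]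
  constructor
  · intro h
    exact ⟨_, WittVector.eq_iterate_verschiebung h⟩
  · rintro ⟨y, rfl⟩ i hi
    exact WittVector.iterate_verschiebung_coeff_eq_zero y hi

/-- The functoriality `W_r(B) → W_r(B')` in a ring homomorphism `B → B'`. -/
def W.map (r : ℕ) (g : B →+* B') : W p r B →+* W p r B' :=
  RingHom.liftOfSurjective (WittVector.truncate r) (WittVector.truncate_surjective p r B)
    ⟨(WittVector.truncate r).comp (WittVector.map g), by
      intro x hx
      rw [WittVector.mem_ker_truncate] at hx
      rw [RingHom.mem_ker, RingHom.comp_apply, ← RingHom.mem_ker, WittVector.mem_ker_truncate]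
      intro i hi
      rw [WittVector.map_coeff, hx i hi, map_zero]⟩

theorem W.map_truncate (r : ℕ) (g : B →+* B') (x : WittVector p B) :
    W.map r g (WittVector.truncate r x) = WittVector.truncate r (WittVector.map g x) :=
  RingHom.liftOfSurjective_comp_apply ..

/-- The restriction map `R : W_{r+1}(B) → W_r(B)`. -/
def W.R (r : ℕ) : W p (r + 1) B →+* W p r B := TruncatedWittVector.truncate (Nat.le_succ r)

theorem W.R_truncate (r : ℕ) (x : WittVector p B) :
    W.R r (WittVector.truncate (r + 1) x) = WittVector.truncate r x :=
  TruncatedWittVector.truncate_wittVector_truncate _ _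

/-- The Witt vector Frobenius `F : W_{r+1}(B) → W_r(B)`, induced by `F : W(B) → W(B)`. -/
def W.F (r : ℕ) : W p (r + 1) B →+* W p r B :=
  RingHom.liftOfSurjective (WittVector.truncate (r + 1))
    (WittVector.truncate_surjective p (r + 1) B)
    ⟨(WittVector.truncate r).comp WittVector.frobenius, by
      intro x hx
      rw [RingHom.mem_ker, mem_ker_truncate_iff] at hx
      obtain ⟨y, rfl⟩ := hx
      rw [RingHom.mem_ker, RingHom.comp_apply, Function.iterate_succ', Function.comp_apply,
        WittVector.frobenius_verschiebung, map_mul, (mem_ker_truncate_iff r _).2 ⟨y, rfl⟩,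
        zero_mul]⟩

theorem W.F_truncate (r : ℕ) (x : WittVector p B) :
    W.F r (WittVector.truncate (r + 1) x) = WittVector.truncate r (WittVector.frobenius x) :=
  RingHom.liftOfSurjective_comp_apply ..

/-- The Verschiebung `V : W_r(B) → W_{r+1}(B)`, `(b₀, b₁, …) ↦ (0, b₀, b₁, …)`. -/
def W.V (r : ℕ) : W p r B →+ W p (r + 1) B where
  toFun x := WittVector.truncate (r + 1) (WittVector.verschiebung x.out)
  map_zero' := by
    rw [mem_ker_truncate_iff]
    obtain ⟨y, hy⟩ := (mem_ker_truncate_iff r (0 : W p r B).out).1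
      (TruncatedWittVector.truncateFun_out _)
    exact ⟨y, by rw [Function.iterate_succ', Function.comp_apply, ← hy]⟩
  map_add' x y := by
    rw [← sub_eq_zero, ← map_add, ← map_sub, ← map_add, ← map_sub, mem_ker_truncate_iff]
    obtain ⟨z, hz⟩ := (mem_ker_truncate_iff r ((x + y).out - (x.out + y.out))).1 (by
      rw [map_sub, map_add, sub_eq_zero]
      have h (t : W p r B) : WittVector.truncate r t.out = t :=
        TruncatedWittVector.truncateFun_out t
      rw [h, h, h])
    exact ⟨z, by rw [Function.iterate_succ', Function.comp_apply, ← hz]⟩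

theorem W.V_truncate (r : ℕ) (x : WittVector p B) :
    W.V r (WittVector.truncate r x) = WittVector.truncate (r + 1) (WittVector.verschiebung x) := by
  change WittVector.truncate (r + 1) (WittVector.verschiebung _) = _
  rw [← sub_eq_zero, ← map_sub, ← map_sub, mem_ker_truncate_iff]
  obtain ⟨z, hz⟩ := (mem_ker_truncate_iff r ((WittVector.truncate r x).out - x)).1 (by
    rw [map_sub, sub_eq_zero]; exact TruncatedWittVector.truncateFun_out _)
  exact ⟨z, by rw [Function.iterate_succ', Function.comp_apply, ← hz]⟩

/-- The Teichmüller representative `[b] ∈ W_r(B)`. -/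
def W.teich (r : ℕ) (b : B) : W p r B := WittVector.truncate r (WittVector.teichmuller p b)

theorem W.R_map (r : ℕ) (g : B →+* B') (x : W p (r + 1) B) :
    W.R r (W.map (r + 1) g x) = W.map r g (W.R r x) := by
  obtain ⟨x, rfl⟩ := WittVector.truncate_surjective p (r + 1) B x
  rw [map_truncate, R_truncate, R_truncate, map_truncate]

theorem W.F_map {C : Type u} [CommRing C] (r : ℕ) (g : B →+* C) (x : W p (r + 1) B) :
    W.F r (W.map (r + 1) g x) = W.map r g (W.F r x) := by
  obtain ⟨x, rfl⟩ := WittVector.truncate_surjective p (r + 1) B x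
  rw [map_truncate, F_truncate, F_truncate, map_truncate]
  congr 1
  exact ((WittVector.frobenius_isPoly p).map g x).symm

theorem W.V_map (r : ℕ) (g : B →+* B') (x : W p r B) :
    W.V r (W.map r g x) = W.map (r + 1) g (W.V r x) := by
  obtain ⟨x, rfl⟩ := WittVector.truncate_surjective p r B x
  rw [map_truncate, V_truncate, V_truncate, map_truncate, WittVector.map_verschiebung]

theorem W.map_teich (r : ℕ) (g : B →+* B') (b : B) :
    W.map r g (W.teich r b) = (W.teich r (g b) : W p r B') := by
  rw [teich, map_truncate, WittVector.map_teichmuller]; rfl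

theorem W.map_map {B'' : Type*} [CommRing B''] (r : ℕ) (g : B →+* B') (g' : B' →+* B'')
    (x : W p r B) : W.map r g' (W.map r g x) = W.map r (g'.comp g) x := by
  obtain ⟨x, rfl⟩ := WittVector.truncate_surjective p r B x
  rw [map_truncate, map_truncate, map_truncate]
  rfl

end Witt
section Theta

variable {p : ℕ} [Fact p.Prime]

/-! ### The maps `θ_r` and `θ̃_r` -/

section Dwork

variable {k : Type u} [CommRing k] [CharP k p] [PerfectRing k p]

theorem dvd_frobenius_sub_pow (x : WittVector p k) :
    (p : WittVector p k) ∣ WittVector.frobenius x - x ^ p := by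
  rw [← Ideal.mem_span_singleton, WittVector.mem_span_p_iff_coeff_zero_eq_zero]
  have h := map_sub (WittVector.constantCoeff (p := p) (R := k)) (WittVector.frobenius x) (x ^ p)
  rw [map_pow] at h
  change (WittVector.frobenius x - x ^ p).coeff 0 = (WittVector.frobenius x).coeff 0 -
    (x.coeff 0) ^ p at h
  rw [h, WittVector.coeff_frobenius_charP, sub_self]

theorem mul_p_injective {x y : WittVector p k} (n : ℕ)
    (h : (p : WittVector p k) ^ n * x = (p : WittVector p k) ^ n * y) : x = y := by
  induction n with
  | zero => simpa using h
  | succ n ih =>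
    apply ih
    rw [← sub_eq_zero]
    apply WittVector.eq_zero_of_p_mul_eq_zero
    rw [sub_mul, sub_eq_zero]
    calc _ = (p : WittVector p k) ^ (n + 1) * x := by ring
      _ = (p : WittVector p k) ^ (n + 1) * y := h
      _ = _ := by ring

theorem ghost_unique (n : ℕ) {a b : ℕ → WittVector p k}
    (h : ∀ m < n, ∑ i ∈ Finset.range (m + 1), (p : WittVector p k) ^ i * a i ^ p ^ (m - i) =
      ∑ i ∈ Finset.range (m + 1), (p : WittVector p k) ^ i * b i ^ p ^ (m - i)) :
    ∀ m < n, a m = b m := by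
  intro m
  induction m using Nat.strong_induction_on with
  | _ m ih =>
    intro hm
    have hn := h m hm
    rw [Finset.sum_range_succ, Finset.sum_range_succ,
      Finset.sum_congr rfl (fun i hi => by
        rw [ih i (Finset.mem_range.1 hi) ((Finset.mem_range.1 hi).trans hm)])] at hn
    have := add_left_cancel hn
    simp only [Nat.sub_self, pow_zero, pow_one] at this
    exact mul_p_injective m this

/-- Over `W(k)`, with `k` perfect, Witt vectors are determined by their ghost components. -/
theorem ghost_ext {x y : WittVector p (WittVector p k)}
    (h : ∀ n, WittVector.ghostComponent n x = WittVector.ghostComponent n y) : x = y := by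
  ext1 n
  refine ghost_unique (n + 1) (a := x.coeff) (b := y.coeff) (fun m _ => ?_) n (Nat.lt_succ_self n)
  simpa only [WittVector.ghostComponent_apply, aeval_wittPolynomial] using h m

/-- For `k` perfect and `x ∈ W(k)`, the sequence `x, φ(x), φ²(x), …` is the sequence of ghost
components of an element of `W(W(k))`. -/
theorem exists_ghost_eq_frobenius (x : WittVector p k) :
    ∃ w : WittVector p (WittVector p k), ∀ n,
      WittVector.ghostComponent n w = WittVector.frobenius^[n] x := by
  have key : ∀ n, ∃ a : ℕ → WittVector p k, ∀ m < n,
      ∑ i ∈ Finset.range (m + 1), (p : WittVector p k) ^ i * a i ^ p ^ (m - i) =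
        WittVector.frobenius^[m] x := by
    intro n
    induction n with
    | zero => exact ⟨0, by simp⟩
    | succ n ih =>
      obtain ⟨a, ha⟩ := ih
      obtain ⟨c, hc⟩ : ((p : WittVector p k) ^ n) ∣ WittVector.frobenius^[n] x -
          ∑ i ∈ Finset.range n, (p : WittVector p k) ^ i * a i ^ p ^ (n - i) := by
        cases n with
        | zero => simp
        | succ n =>
          rw [Function.iterate_succ', Function.comp_apply, ← ha n (Nat.lt_succ_self n), map_sum,
            ← Finset.sum_sub_distrib]
          refine Finset.dvd_sum fun i hi => ?_
          have hi' : i ≤ n := Nat.lt_succ_iff.1 (Finset.mem_range.1 hi)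
          rw [map_mul, map_pow, map_natCast, map_pow, ← mul_sub]
          have h1 : n + 1 = i + (n - i + 1) := by omega
          have h2 : n + 1 - i = (n - i) + 1 := by omega
          rw [h2]
          conv_lhs => rw [h1]
          rw [pow_add, pow_succ' p, pow_mul]
          exact mul_dvd_mul_left _ (dvd_sub_pow_of_dvd_sub (dvd_frobenius_sub_pow _) _)
      refine ⟨fun i => if i = n then c else a i, fun m hm => ?_⟩
      rcases Nat.lt_succ_iff_lt_or_eq.1 hm with hm | rfl
      · rw [← ha m hm]
        refine Finset.sum_congr rfl fun i hi => ?_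
        have : i ≠ n := by have := Finset.mem_range.1 hi; omega
        simp [this]
      · rw [sub_eq_iff_eq_add'] at hc
        rw [Finset.sum_range_succ, hc]
        congr 1
        · refine Finset.sum_congr rfl fun i hi => ?_
          have : i ≠ m := by have := Finset.mem_range.1 hi; omega
          simp [this]
        · simp
  choose a ha using key
  refine ⟨WittVector.mk p fun i => a (i + 1) i, fun n => ?_⟩
  rw [WittVector.ghostComponent_apply, aeval_wittPolynomial, ← ha (n + 1) n (Nat.lt_succ_self n)]
  refine Finset.sum_congr rfl fun i hi => ?_
  have hi' := Finset.mem_range.1 hi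
  rw [WittVector.coeff_mk, ghost_unique (i + 1) (a := a (i + 1)) (b := a (n + 1))
    (fun m hm => by rw [ha (i + 1) m hm, ha (n + 1) m (by omega)]) i (Nat.lt_succ_self i)]

/-- For `k` perfect, the ring homomorphism `s : W(k) → W(W(k))` attached to the Frobenius lift `φ`
of the `p`-torsion-free ring `W(k)`: the ghost components of `s(x)` are `x, φ(x), φ²(x), …`. -/
def frobeniusSection : WittVector p k →+* WittVector p (WittVector p k) where
  toFun x := (exists_ghost_eq_frobenius x).choose
  map_one' := ghost_ext fun n => by
    rw [(exists_ghost_eq_frobenius _).choose_spec, map_one, ← RingHom.coe_pow, map_one]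
  map_mul' x y := ghost_ext fun n => by
    rw [(exists_ghost_eq_frobenius _).choose_spec, map_mul,
      (exists_ghost_eq_frobenius _).choose_spec, (exists_ghost_eq_frobenius _).choose_spec,
      ← RingHom.coe_pow, map_mul]
  map_zero' := ghost_ext fun n => by
    rw [(exists_ghost_eq_frobenius _).choose_spec, map_zero, ← RingHom.coe_pow, map_zero]
  map_add' x y := ghost_ext fun n => by
    rw [(exists_ghost_eq_frobenius _).choose_spec, map_add,
      (exists_ghost_eq_frobenius _).choose_spec, (exists_ghost_eq_frobenius _).choose_spec,
      ← RingHom.coe_pow, map_add]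

theorem ghostComponent_frobeniusSection (n : ℕ) (x : WittVector p k) :
    WittVector.ghostComponent n (frobeniusSection x) = WittVector.frobenius^[n] x :=
  (exists_ghost_eq_frobenius x).choose_spec n

end Dwork

variable (p) (A : Type u) [CommRing A] [Fact (¬ IsUnit (p : A))]

/-- The ring `W(A^♭)`. -/
abbrev Ainf : Type u := WittVector p (PreTilt A p)

/-- The Witt vector Frobenius `φ` of `W(A^♭)`, an automorphism. -/
abbrev phi : Ainf p A ≃+* Ainf p A := WittVector.frobeniusEquiv p (PreTilt A p)

variable [IsAdicComplete (Ideal.span {(p : A)}) A]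

/-- `θ_r : W(A^♭) → W_r(A)`, the composite
`W(A^♭) --s--> W(W(A^♭)) --W(θ)--> W(A) → W_r(A)` with `θ` Fontaine's map; its ghost
components are `θ, θφ, …, θφ^{r-1}`, and `θ_r([x]) = [x^{(0)}]`. -/
def theta (r : ℕ) : Ainf p A →+* W p r A :=
  (WittVector.truncate r).comp ((WittVector.map (WittVector.fontaineTheta A p)).comp frobeniusSection)

/-- `θ̃_r := θ_r ∘ φ^{-r} : W(A^♭) → W_r(A)`. -/
def thetaTilde (r : ℕ) : Ainf p A →+* W p r A :=
  (theta p A r).comp (((phi p A).symm : Ainf p A →+* Ainf p A) ^ r)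

/-- The explicit description of `θ_r` on Teichmüller elements. -/
theorem theta_teichmuller (r : ℕ) (x : PreTilt A p) :
    theta p A r (WittVector.teichmuller p x) = W.teich r x.untilt := by
  have h : frobeniusSection (WittVector.teichmuller p x) =
      WittVector.teichmuller p (WittVector.teichmuller p x) := ghost_ext fun n => by
    rw [ghostComponent_frobeniusSection, WittVector.ghostComponent_teichmuller, ← map_pow]
    induction n with
    | zero => simp
    | succ n ih =>
      rw [Function.iterate_succ', Function.comp_apply, ih, WittVector.frobenius_eq_map_frobenius,
        WittVector.map_teichmuller, frobenius_def, ← pow_mul, pow_succ]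
  rw [theta, RingHom.comp_apply, RingHom.comp_apply, h, WittVector.map_teichmuller,
    WittVector.fontaineTheta_teichmuller]
  rfl

/-! ### Perfectoid rings and the elements attached to a system of `p`-power roots of unity -/

/-- Perfectoid rings: `A` is `π`-adically complete (and separated) for some `π` such that `π ^ p`
divides `p`, the Frobenius of `A / p` is surjective, and the kernel of `θ : W(A^♭) → A` is
principal. The `p`-adic completeness, which is needed to write down `θ`, follows from the `π`-adic
one, so that the corresponding instance argument is no additional condition. -/
structure IsPerfectoid : Prop where
  exists_pi : ∃ π : A, π ^ p ∣ (p : A) ∧ IsAdicComplete (Ideal.span {π}) A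
  frobenius_surjective : Function.Surjective (frobenius (ModP A p) p)
  ker_theta_principal : (RingHom.ker (WittVector.fontaineTheta A p)).IsPrincipal

end Theta

section Elements

/-- A compatible system of primitive `p`-power roots of unity `ζ_{p^r}` in `A` (for `r = 0` the
condition says `ζ_1 = 1`). -/
structure RootSystem (p : ℕ) (A : Type u) [CommRing A] where
  ζ : ℕ → A
  isRoot : ∀ r, (Polynomial.cyclotomic (p ^ r) A).IsRoot (ζ r)
  pow_eq : ∀ r, ζ (r + 1) ^ p = ζ r

variable {p : ℕ} [Fact p.Prime] {A : Type u} [CommRing A] [Fact (¬ IsUnit (p : A))]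

/-- `ε = (1, ζ_p, ζ_{p²}, …) ∈ A^♭`. -/
def RootSystem.eps (Z : RootSystem p A) : PreTilt A p :=
  (⟨fun n => Ideal.Quotient.mk _ (Z.ζ n), fun n => by rw [← map_pow, Z.pow_eq]⟩ :
    Perfection (ModP A p) p)

/-- `μ = [ε] - 1 ∈ W(A^♭)`. -/
def RootSystem.mu (Z : RootSystem p A) : Ainf p A := WittVector.teichmuller p Z.eps - 1

/-- `ξ = 1 + [ε^{1/p}] + ⋯ + [ε^{1/p}]^{p-1} ∈ W(A^♭)`. -/
def RootSystem.xi (Z : RootSystem p A) : Ainf p A :=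
  ∑ i ∈ Finset.range p,
    WittVector.teichmuller p ((frobeniusEquiv (PreTilt A p) p).symm Z.eps) ^ i

/-- `φ^{i}(ξ)`. -/
def RootSystem.phiXi (Z : RootSystem p A) (i : ℕ) : Ainf p A := (phi p A)^[i] Z.xi

/-- `ξ̃_r = φ(ξ) ⋯ φ^r(ξ)`. -/
def RootSystem.xiTilde (Z : RootSystem p A) (r : ℕ) : Ainf p A :=
  ∏ i ∈ Finset.range r, Z.phiXi (i + 1)

theorem RootSystem.xiTilde_succ (Z : RootSystem p A) (r : ℕ) :
    Z.xiTilde (r + 1) = Z.xiTilde r * Z.phiXi (r + 1) := Finset.prod_range_succ _ _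

theorem RootSystem.phi_symm_xiTilde_succ (Z : RootSystem p A) (r : ℕ) :
    (phi p A).symm (Z.xiTilde (r + 1)) = Z.xiTilde r * Z.xi := by
  have h (i : ℕ) : (phi p A).symm (Z.phiXi (i + 1)) = Z.phiXi i := by
    rw [phiXi, Function.iterate_succ', Function.comp_apply, RingEquiv.symm_apply_apply]; rfl
  rw [xiTilde, map_prod, Finset.prod_congr rfl (fun i _ => h i), Finset.prod_range_succ']
  rfl

end Elements

/-! ### Complexes of modules, the décalage functor, reduction and cohomology -/

section Complexes

/-- Cochain complexes of `R`-modules, indexed by `ℤ`. -/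
structure Cx (R : Type u) [CommRing R] where
  X : ℤ → Type u
  [grp : ∀ i, AddCommGroup (X i)]
  [mod : ∀ i, Module R (X i)]
  d : ∀ i j, i + 1 = j → X i →ₗ[R] X j
  d_d : ∀ i j k (h : i + 1 = j) (h' : j + 1 = k) (x : X i), d j k h' (d i j h x) = 0

attribute [instance] Cx.grp Cx.mod

variable {R : Type u} [CommRing R]

/-- The complex of modules underlying a cochain complex in the category of modules. -/
def Cx.of (C : CochainComplex (ModuleCat.{u} R) ℤ) : Cx R where
  X i := C.X i
  d i j _ := (C.d i j).hom
  d_d i j k _ _ x := by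
    rw [← LinearMap.comp_apply, ← ModuleCat.hom_comp, C.d_comp_d]; rfl

/-- Cocycles. -/
def Cx.cocycles (K : Cx R) (n : ℤ) : Submodule R (K.X n) := LinearMap.ker (K.d n (n + 1) rfl)

/-- Coboundaries. -/
def Cx.coboundaries (K : Cx R) (n : ℤ) : Submodule R (K.X n) :=
  LinearMap.range (K.d (n - 1) n (by omega))

theorem Cx.mem_cocycles {K : Cx R} {n m : ℤ} (h : n + 1 = m) {x : K.X n} :
    x ∈ K.cocycles n ↔ K.d n m h x = 0 := by
  subst h; exact LinearMap.mem_ker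

theorem Cx.mem_coboundaries {K : Cx R} {n m : ℤ} (h : m + 1 = n) {x : K.X n} :
    x ∈ K.coboundaries n ↔ ∃ y, K.d m n h y = x := by
  obtain rfl : m = n - 1 := by omega
  exact LinearMap.mem_range

/-- `H^n(K)`: cocycles modulo coboundaries. -/
abbrev Hn (K : Cx R) (n : ℤ) : Type u :=
  K.cocycles n ⧸ (K.coboundaries n).submoduleOf (K.cocycles n)

/-- The class of a cocycle. -/
def Hn.mk {K : Cx R} {n : ℤ} (x : K.cocycles n) : Hn K n := Submodule.Quotient.mk x

theorem Hn.mk_surjective {K : Cx R} {n : ℤ} : Function.Surjective (Hn.mk (K := K) (n := n)) :=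
  Submodule.mkQ_surjective _

theorem Hn.mk_eq_iff {K : Cx R} {n m : ℤ} (h : m + 1 = n) (x y : K.cocycles n) :
    Hn.mk x = Hn.mk y ↔ ∃ z, K.d m n h z = x.1 - y.1 := by
  rw [← Cx.mem_coboundaries]
  exact Submodule.Quotient.eq _

theorem Hn.mk_eq_zero {K : Cx R} {n m : ℤ} (h : m + 1 = n) (x : K.cocycles n) :
    Hn.mk x = 0 ↔ ∃ z, K.d m n h z = x.1 := by
  rw [← Cx.mem_coboundaries]
  exact Submodule.Quotient.mk_eq_zero _

/-- `K ⊗ R/a = K/aK`. This is the derived tensor product `K ⊗^L R/a` whenever `a` is a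
non-zero-divisor of `R` and `K` consists of `a`-torsion-free modules. -/
def modBy (a : R) (K : Cx R) : Cx R where
  X i := K.X i ⧸ LinearMap.range (LinearMap.lsmul R (K.X i) a)
  d i j h := Submodule.mapQ _ _ (K.d i j h) (by
    rintro _ ⟨x, rfl⟩
    exact ⟨K.d i j h x, (map_smul (K.d i j h) a x).symm⟩)
  d_d i j k h h' x := by
    obtain ⟨x, rfl⟩ := Submodule.mkQ_surjective _ x
    exact congrArg Submodule.Quotient.mk (K.d_d i j k h h' x)

/-- The class in `K/aK` of an element of `K`. -/
def modBy.mk (a : R) (K : Cx R) (i : ℤ) : K.X i →ₗ[R] (modBy a K).X i := Submodule.mkQ _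

theorem modBy.mk_surjective (a : R) (K : Cx R) (i : ℤ) : Function.Surjective (modBy.mk a K i) :=
  Submodule.mkQ_surjective _

theorem modBy.mk_eq_zero {a : R} {K : Cx R} {i : ℤ} {x : K.X i} :
    modBy.mk a K i x = 0 ↔ ∃ y, a • y = x :=
  Submodule.Quotient.mk_eq_zero _

theorem modBy.d_mk {a : R} {K : Cx R} (i j : ℤ) (h : i + 1 = j) (x : K.X i) :
    (modBy a K).d i j h (modBy.mk a K i x) = modBy.mk a K j (K.d i j h x) := rfl

/-- The map `K^i/aK^i → Q` induced by a map `K^i → Q` that kills `aK^i`. -/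
def modBy.lift (a : R) (K : Cx R) (i : ℤ) {σ : R →+* R} {Q : Type u} [AddCommGroup Q] [Module R Q]
    (f : K.X i →ₛₗ[σ] Q) (h : ∀ x, f (a • x) = 0) : (modBy a K).X i →ₛₗ[σ] Q :=
  Submodule.liftQ _ f (by rintro _ ⟨x, rfl⟩; exact h x)

theorem modBy.lift_mk (a : R) (K : Cx R) (i : ℤ) {σ : R →+* R} {Q : Type u} [AddCommGroup Q]
    [Module R Q] (f : K.X i →ₛₗ[σ] Q) (h : ∀ x, f (a • x) = 0) (x : K.X i) :
    modBy.lift a K i f h (modBy.mk a K i x) = f x := rfl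

/-- The degree `i` term of `η_f K`. For `f`-torsion-free `K`, the map `(y, z) ↦ f ^ i y` identifies
it with `{x ∈ f ^ i K^i : d x ∈ f ^ {i+1} K^{i+1}} ⊆ K^i[1/f]`: the element `x = f ^ i y` satisfies
`d x = f ^ i d y ∈ f ^ {i+1} K^{i+1}` if and only if `d y = f z` for some, unique, `z`; then
`d x = f ^ {i+1} z`. (The condition `d z = 0` is automatic in the torsion-free case.) -/
def etaTerm (f : R) (K : Cx R) (i : ℤ) : Submodule R (K.X i × K.X (i + 1)) where
  carrier := {w | K.d i (i + 1) rfl w.1 = f • w.2 ∧ K.d (i + 1) (i + 1 + 1) rfl w.2 = 0}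
  add_mem' := by
    rintro a b ⟨ha, ha'⟩ ⟨hb, hb'⟩
    refine ⟨?_, ?_⟩
    · rw [Prod.fst_add, Prod.snd_add, map_add, ha, hb, smul_add]
    · rw [Prod.snd_add, map_add, ha', hb', add_zero]
  zero_mem' := by simp
  smul_mem' := by
    rintro c a ⟨ha, ha'⟩
    refine ⟨?_, ?_⟩
    · rw [Prod.smul_fst, Prod.smul_snd, map_smul, ha, smul_comm]
    · rw [Prod.smul_snd, map_smul, ha', smul_zero]

/-- The differential of `η_f K`: as `d (f ^ i y) = f ^ {i+1} z`, it is `(y, z) ↦ (z, 0)`. -/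
def etaD (f : R) (K : Cx R) (i : ℤ) : ∀ j, i + 1 = j → etaTerm f K i →ₗ[R] etaTerm f K j
  | _, rfl =>
    { toFun := fun w => ⟨(w.1.2, 0), by
        refine ⟨?_, map_zero _⟩
        rw [w.2.2, smul_zero]⟩
      map_add' := fun _ _ => Subtype.ext (Prod.ext rfl (add_zero _).symm)
      map_smul' := fun _ _ => Subtype.ext (Prod.ext rfl (smul_zero _).symm) }

/-- The décalage `η_f K`; it computes `Lη_f` on every `K` consisting of `f`-torsion-free modules. -/
def eta (f : R) (K : Cx R) : Cx R where
  X i := etaTerm f K i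
  d i j h := etaD f K i j h
  d_d := by rintro i _ _ rfl rfl w; rfl

/-! Semilinear maps of complexes. -/

/-- A `σ`-semilinear map of complexes. -/
structure SemiMap (σ : R →+* R) (K L : Cx R) where
  toFun : ∀ i, K.X i →ₛₗ[σ] L.X i
  comm : ∀ i j h x, L.d i j h (toFun i x) = toFun j (K.d i j h x)

variable {σ : R →+* R} {K L M : Cx R}

/-- The map on cohomology induced by a map that preserves cocycles and coboundaries. -/
def Hn.lift (n m : ℤ) (f : K.X n →ₛₗ[σ] L.X m)
    (h₁ : ∀ x ∈ K.cocycles n, f x ∈ L.cocycles m)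
    (h₂ : ∀ x ∈ K.coboundaries n, f x ∈ L.coboundaries m) : Hn K n →ₛₗ[σ] Hn L m :=
  Submodule.mapQ _ _
    (LinearMap.codRestrict (L.cocycles m) (f.comp (Submodule.subtype _)) (fun x => h₁ _ x.2))
    (by rintro ⟨x, hx⟩ hx'; exact h₂ x hx')

/-- The map induced on cohomology. -/
def SemiMap.H (f : SemiMap σ K L) (n : ℤ) : Hn K n →ₛₗ[σ] Hn L n :=
  Hn.lift n n (f.toFun n)
    (fun x hx => by rw [Cx.mem_cocycles rfl, f.comm, (Cx.mem_cocycles rfl).1 hx, map_zero])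
    (fun x hx => by
      obtain ⟨y, rfl⟩ := (Cx.mem_coboundaries (sub_add_cancel n 1)).1 hx
      rw [← f.comm]
      exact (Cx.mem_coboundaries (sub_add_cancel n 1)).2 ⟨_, rfl⟩)

/-- The map `K/aK → L/bL` induced by `f : K → L` with `f(aK) ⊆ bL`. -/
def SemiMap.modBy (f : SemiMap σ K L) (a b : R) (h : ∀ i x, ∃ y, b • y = f.toFun i (a • x)) :
    SemiMap σ (modBy a K) (modBy b L) where
  toFun i := modBy.lift a K i ((modBy.mk b L i).comp (f.toFun i))
    (fun x => modBy.mk_eq_zero.2 (h i x))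
  comm i j hij x := by
    obtain ⟨x, rfl⟩ := modBy.mk_surjective a K i x
    exact congrArg (modBy.mk b L j) (f.comm i j hij x)

/-- Multiplication by a scalar. -/
def SemiMap.scalar (c : R) (K : Cx R) : SemiMap (RingHom.id R) K K where
  toFun i := LinearMap.lsmul R (K.X i) c
  comm i j h x := map_smul (K.d i j h) c x

/-- The functoriality of `η_f`. -/
def SemiMap.eta (g : SemiMap (RingHom.id R) K L) (f : R) :
    SemiMap (RingHom.id R) (eta f K) (eta f L) where
  toFun i := LinearMap.restrict (LinearMap.prodMap (g.toFun i) (g.toFun (i + 1)))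
    (p := etaTerm f K i) (q := etaTerm f L i) (by
      rintro ⟨y, z⟩ ⟨h, h'⟩
      refine ⟨?_, ?_⟩
      · exact (g.comm _ _ _ _).trans ((congrArg (g.toFun (i + 1)) h).trans (map_smul _ _ _))
      · exact (g.comm _ _ _ _).trans ((congrArg (g.toFun (i + 1 + 1)) h').trans (map_zero _)))
  comm := by
    rintro i _ rfl x
    exact Subtype.ext (Prod.ext rfl (map_zero (g.toFun _)).symm)

/-- The base change map `η_f(K)/a → η_f(K/a)`, i.e. `(y, z) ↦ (y mod a, z mod a)`. -/
def baseChange (f a : R) (K : Cx R) :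
    SemiMap (RingHom.id R) (modBy a (eta f K)) (eta f (modBy a K)) where
  toFun i := modBy.lift a (eta f K) i (Q := etaTerm f (modBy a K) i)
    (LinearMap.restrict (LinearMap.prodMap (modBy.mk a K i) (modBy.mk a K (i + 1)))
      (p := etaTerm f K i) (q := etaTerm f (modBy a K) i) (by
        rintro ⟨y, z⟩ ⟨h, h'⟩
        exact ⟨congrArg (modBy.mk a K (i + 1)) h, congrArg (modBy.mk a K (i + 1 + 1)) h'⟩))
    (fun w => Subtype.ext (Prod.ext (modBy.mk_eq_zero.2 ⟨w.1.1, rfl⟩)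
      (modBy.mk_eq_zero.2 ⟨w.1.2, rfl⟩)))
  comm := by
    rintro i _ rfl x
    obtain ⟨x, rfl⟩ := modBy.mk_surjective a (eta f K) i x
    exact Subtype.ext (Prod.ext rfl (map_zero (modBy.mk a K _)))

/-- The canonical map `H^n(η_f K / a) → H^n(K / a)` for `n ≥ 0`, induced in degree `n` by
`η_f K ∋ f ^ n y ↦ f ^ n y ∈ K`, i.e. by `(y, z) ↦ f ^ n y`. It exists if `H^0(K)` is
`f`-torsion-free (this makes it kill the coboundaries coming from degree `-1`). -/
def canMap (f a : R) (K : Cx R) (hK : ∀ c : Hn K 0, f • c = 0 → c = 0) (n : ℕ) :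
    Hn (modBy a (eta f K)) n →ₗ[R] Hn (modBy a K) n :=
  Hn.lift n n
    (modBy.lift a (eta f K) n
      ((modBy.mk a K n).comp
        (f ^ n • (LinearMap.fst R _ _).comp (Submodule.subtype (etaTerm f K n))))
      (fun w => modBy.mk_eq_zero.2 ⟨f ^ n • w.1.1, smul_comm _ _ _⟩))
    (by
      intro x hx
      obtain ⟨w, rfl⟩ := modBy.mk_surjective a (eta f K) n x
      obtain ⟨v, hv⟩ := modBy.mk_eq_zero.1 ((Cx.mem_cocycles rfl).1 hx)
      have hv1 : a • v.1.1 = w.1.2 :=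
        congrArg (fun t : etaTerm f K (n + 1) => t.1.1) hv
      refine (Cx.mem_cocycles rfl).2 (modBy.mk_eq_zero.2 ⟨f ^ (n + 1) • v.1.1, ?_⟩)
      have h1 : K.d n (n + 1) rfl w.1.1 = f • w.1.2 := w.2.1
      change _ = K.d n (n + 1) rfl (f ^ n • w.1.1)
      rw [map_smul, h1, smul_comm, hv1, pow_succ, mul_smul])
    (by
      intro x hx
      obtain ⟨m, hm⟩ : ∃ m : ℤ, m + 1 = n := ⟨n - 1, by omega⟩
      obtain ⟨v, rfl⟩ := (Cx.mem_coboundaries hm).1 hx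
      obtain ⟨w, rfl⟩ := modBy.mk_surjective a (eta f K) m v
      rw [Cx.mem_coboundaries hm]
      suffices h : ∃ y, K.d m n hm y = f ^ n • (etaD f K m n hm w).1.1 by
        obtain ⟨y, hy⟩ := h
        exact ⟨modBy.mk a K m y, congrArg (modBy.mk a K n) hy⟩
      cases n with
      | zero =>
        obtain rfl : m = -1 := by omega
        have h1 : K.d (-1) 0 rfl w.1.1 = f • w.1.2 := w.2.1
        have h2 : K.d 0 1 rfl w.1.2 = 0 := w.2.2
        have h3 := hK (Hn.mk ⟨w.1.2, (Cx.mem_cocycles rfl).2 h2⟩)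
          ((Hn.mk_eq_zero (by norm_num : (-1 : ℤ) + 1 = 0)
            (f • (⟨w.1.2, (Cx.mem_cocycles rfl).2 h2⟩ : K.cocycles 0))).2 ⟨_, h1⟩)
        obtain ⟨y, hy⟩ := (Hn.mk_eq_zero (by norm_num : (-1 : ℤ) + 1 = 0) _).1 h3
        exact ⟨y, hy.trans (by rw [pow_zero, one_smul]; rfl)⟩
      | succ k =>
        obtain rfl : m = k := by push_cast at hm; omega
        have h1 : K.d k (k + 1) rfl w.1.1 = f • w.1.2 := w.2.1
        refine ⟨f ^ k • w.1.1, ?_⟩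
        rw [map_smul, pow_succ, mul_smul]
        exact congrArg (f ^ k • ·) h1)

end Complexes
/-! ### Products, homotopies, and commutative algebras with Frobenius in `D(W(A^♭))` -/

section Algebras

variable {R : Type u} [CommRing R]

/-- The sign `(-1) ^ n`. -/
abbrev sgn (n : ℤ) : ℤ := (Int.negOnePow n : ℤ)

/-- A family of semi-bilinear maps `K^i × L^j → M^k` of degree `e`, i.e. `k = i + j + e`. -/
abbrev BiFam (σ : R →+* R) (K L M : Cx R) (e : ℤ) :=
  ∀ i j k : ℤ, i + j + e = k → K.X i →ₛₗ[σ] L.X j →ₛₗ[σ] M.X k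

/-- A map of complexes `K ⊗ L → M`, written as a bilinear pairing that satisfies the Leibniz rule.
-/
structure Pairing (K L M : Cx R) where
  toFun : BiFam (RingHom.id R) K L M 0
  leibniz : ∀ i j k i' j' k' (hk : i + j + 0 = k) (hk' : k + 1 = k') (hi : i + 1 = i')
    (hj : j + 1 = j') (x : K.X i) (y : L.X j),
    M.d k k' hk' (toFun i j k hk x y) =
      toFun i' j k' (by omega) (K.d i i' hi x) y +
        sgn i • toFun i j' k' (by omega) x (L.d j j' hj y)

variable {σ : R →+* R} {K L M : Cx R}

/-- The pairing on reductions modulo `a`. -/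
def Pairing.modBy (m : Pairing K L M) (a : R) :
    Pairing (modBy a K) (modBy a L) (modBy a M) where
  toFun i j k h := modBy.lift a K i
    { toFun := fun x => modBy.lift a L j ((modBy.mk a M k).comp (m.toFun i j k h x)) (fun y =>
        modBy.mk_eq_zero.2 ⟨m.toFun i j k h x y, (map_smul (m.toFun i j k h x) a y).symm⟩)
      map_add' := fun x x' => by
        ext y
        obtain ⟨y, rfl⟩ := modBy.mk_surjective a L j y
        simp only [LinearMap.add_apply, modBy.lift_mk, LinearMap.comp_apply, map_add]
      map_smul' := fun c x => by
        ext y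
        obtain ⟨y, rfl⟩ := modBy.mk_surjective a L j y
        simp only [LinearMap.smul_apply, modBy.lift_mk, LinearMap.comp_apply, map_smul,
          RingHom.id_apply] }
    (fun x => by
      ext y
      obtain ⟨y, rfl⟩ := modBy.mk_surjective a L j y
      exact modBy.mk_eq_zero.2 ⟨m.toFun i j k h x y, by rw [map_smul, LinearMap.smul_apply]⟩)
  leibniz i j k i' j' k' hk hk' hi hj x y := by
    obtain ⟨x, rfl⟩ := modBy.mk_surjective a K i x
    obtain ⟨y, rfl⟩ := modBy.mk_surjective a L j y
    have h := congrArg (modBy.mk a M k') (m.leibniz i j k i' j' k' hk hk' hi hj x y)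
    rw [map_add, map_zsmul] at h
    exact h

/-- The product of two cocycles. -/
def Pairing.cocycle (m : Pairing K L M) {i j k : ℤ} (h : i + j = k) (x : K.cocycles i)
    (y : L.cocycles j) : M.cocycles k :=
  ⟨m.toFun i j k (by omega) x.1 y.1, by
    rw [Cx.mem_cocycles rfl, m.leibniz i j k (i + 1) (j + 1) (k + 1) _ rfl rfl rfl,
      (Cx.mem_cocycles rfl).1 x.2, (Cx.mem_cocycles rfl).1 y.2]
    simp⟩

theorem Pairing.cocycle_congr (m : Pairing K L M) {i j k : ℤ} (h : i + j = k)
    {x x' : K.cocycles i} {y y' : L.cocycles j} (hx : Hn.mk x = Hn.mk x')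
    (hy : Hn.mk y = Hn.mk y') : Hn.mk (m.cocycle h x y) = Hn.mk (m.cocycle h x' y') := by
  obtain ⟨z, hz⟩ := (Hn.mk_eq_iff (sub_add_cancel i 1) _ _).1 hx
  obtain ⟨w, hw⟩ := (Hn.mk_eq_iff (sub_add_cancel j 1) _ _).1 hy
  refine (Hn.mk_eq_iff (sub_add_cancel k 1) _ _).2 ⟨m.toFun (i - 1) j (k - 1) (by omega) z y.1 +
    sgn i • m.toFun i (j - 1) (k - 1) (by omega) x'.1 w, ?_⟩
  rw [map_add, map_zsmul, m.leibniz (i - 1) j (k - 1) i (j + 1) k _ _ (by omega) rfl,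
    m.leibniz i (j - 1) (k - 1) (i + 1) j k _ _ rfl (by omega),
    (Cx.mem_cocycles rfl).1 x'.2, (Cx.mem_cocycles rfl).1 y.2, hz, hw]
  have hs : sgn i * sgn i = 1 := by
    rw [← Units.val_mul, Int.units_mul_self, Units.val_one]
  simp only [map_zero, smul_zero, add_zero, LinearMap.zero_apply, zero_add, map_sub,
    LinearMap.sub_apply, smul_smul, hs, one_smul, Pairing.cocycle]
  abel

/-- The product induced on cohomology. -/
def Pairing.H (m : Pairing K L M) (i j k : ℤ) (h : i + j = k) (c : Hn K i) (c' : Hn L j) :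
    Hn M k :=
  Quotient.map₂ (m.cocycle h) (fun _ _ hx _ _ hy =>
    Quotient.exact (m.cocycle_congr h (Quotient.sound hx) (Quotient.sound hy))) c c'

theorem Pairing.H_mk (m : Pairing K L M) (i j k : ℤ) (h : i + j = k) (x : K.cocycles i)
    (y : L.cocycles j) : m.H i j k h (Hn.mk x) (Hn.mk y) = Hn.mk (m.cocycle h x y) := rfl

/-- Homotopy of `σ`-semilinear maps of complexes. -/
def Homotopic (σ : R →+* R) (f g : ∀ i, K.X i → L.X i) : Prop :=
  ∃ h : ∀ i j, j + 1 = i → K.X i →ₛₗ[σ] L.X j, ∀ i j k (hj : j + 1 = i) (hk : i + 1 = k) (x : K.X i),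
    f i x - g i x = L.d j i hj (h i j hj x) + h k i hk (K.d i k hk x)

/-- Homotopy of (semilinear) maps of complexes `K ⊗ L → M`, written as families of pairings. -/
def BiHomotopic (σ : R →+* R) (f g : ∀ i j k, i + j + 0 = k → K.X i → L.X j → M.X k) : Prop :=
  ∃ h : BiFam σ K L M (-1), ∀ i j k i' j' k' (hk : i + j + 0 = k) (hk' : k' + 1 = k)
    (hi : i + 1 = i') (hj : j + 1 = j') (x : K.X i) (y : L.X j),
    f i j k hk x y - g i j k hk x y =
      M.d k' k hk' (h i j k' (by omega) x y) + h i' j k (by omega) (K.d i i' hi x) y +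
        sgn i • h i j' k (by omega) x (L.d j j' hj y)

/-- Homotopy of maps of complexes `K ⊗ K ⊗ K → K`, written as families of trilinear maps. -/
def TriHomotopic (f g : ∀ i j k l, i + j + k = l → K.X i → K.X j → K.X k → K.X l) : Prop :=
  ∃ h : ∀ i j k l, i + j + k - 1 = l → K.X i →ₗ[R] K.X j →ₗ[R] K.X k →ₗ[R] K.X l,
    ∀ i j k l i' j' k' l' (hl : i + j + k = l) (hl' : l' + 1 = l) (hi : i + 1 = i')
      (hj : j + 1 = j') (hk : k + 1 = k') (x : K.X i) (y : K.X j) (z : K.X k),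
      f i j k l hl x y z - g i j k l hl x y z =
        K.d l' l hl' (h i j k l' (by omega) x y z) +
          h i' j k l (by omega) (K.d i i' hi x) y z +
          sgn i • h i j' k l (by omega) x (K.d j j' hj y) z +
          sgn (i + j) • h i j k' l (by omega) x y (K.d k k' hk z)

variable (R) in
/-- A commutative algebra object of the derived category `D(R)`, with its symmetric monoidal
structure `⊗^L`. The category `D(R)` is modelled by the homotopy category of K-projective complexes
of projective modules, on which `⊗^L` is the tensor product of complexes: the algebra is a complex
`C` with a product `C ⊗ C → C` and a unit `R → C` that satisfy the axioms up to homotopy. -/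
structure DAlg where
  C : CochainComplex (ModuleCat.{u} R) ℤ
  projective : ∀ i, Module.Projective R (C.X i)
  kProjective : C.IsKProjective
  mul : Pairing (Cx.of C) (Cx.of C) (Cx.of C)
  one : (Cx.of C).cocycles 0
  one_mul : Homotopic (RingHom.id R) (K := Cx.of C) (L := Cx.of C)
    (fun i x => mul.toFun 0 i i (by omega) one.1 x) (fun _ x => x)
  mul_comm : BiHomotopic (RingHom.id R) (K := Cx.of C) (L := Cx.of C) (M := Cx.of C)
    (fun i j k h x y => mul.toFun i j k h x y)
    (fun i j k h x y => sgn (i * j) • mul.toFun j i k (by omega) y x)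
  mul_assoc : TriHomotopic (K := Cx.of C)
    (fun i j k l h x y z => mul.toFun (i + j) k l (by omega)
      (mul.toFun i j (i + j) (by omega) x y) z)
    (fun i j k l h x y z => mul.toFun i (j + k) l (by omega) x
      (mul.toFun j k (j + k) (by omega) y z))

/-- The underlying complex of modules. -/
abbrev DAlg.cx (D : DAlg R) : Cx R := Cx.of D.C

/-- The condition that a semilinear map of complexes represents a morphism of algebra objects. -/
structure SemiMap.IsAlgMap {D D' : DAlg R} (f : SemiMap σ D.cx D'.cx) : Prop where
  mul : BiHomotopic σ (K := D.cx) (L := D.cx) (M := D'.cx)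
    (fun i j k h x y => f.toFun k (D.mul.toFun i j k h x y))
    (fun i j k h x y => D'.mul.toFun i j k h (f.toFun i x) (f.toFun j y))
  one : f.toFun 0 D.one.1 - D'.one.1 ∈ D'.cx.coboundaries 0

/-- The class of `1` in `H^0(D/a)`. -/
def DAlg.oneMod (D : DAlg R) (a : R) : Hn (AInf.modBy a D.cx) 0 :=
  Hn.mk ⟨modBy.mk a D.cx 0 D.one.1, (Cx.mem_cocycles rfl).2 (by
    rw [modBy.d_mk, (Cx.mem_cocycles rfl).1 D.one.2, map_zero])⟩

/-- The product `H^i(D/a) × H^j(D/a) → H^k(D/a)`, `k = i + j`. -/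
def DAlg.mulMod (D : DAlg R) (a : R) (i j k : ℤ) (h : i + j = k) :
    Hn (AInf.modBy a D.cx) i → Hn (AInf.modBy a D.cx) j → Hn (AInf.modBy a D.cx) k :=
  (D.mul.modBy a).H i j k h

/-- `δ : H^n(K/a) → H^m(K/a)`, `m = n + 1`, is the Bockstein `Bock_a`, i.e. the boundary map
attached to `0 → K/a → K/a² → K/a → 0`: the class of `x ∈ K^n` with `d x = a z` goes to the class
of `z`. -/
def IsBockstein (a : R) (K : Cx R) (n m : ℤ) (h : n + 1 = m)
    (δ : Hn (modBy a K) n → Hn (modBy a K) m) : Prop :=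
  ∀ (x : K.X n) (z : K.X m) (c : (modBy a K).cocycles n) (c' : (modBy a K).cocycles m),
    c.1 = modBy.mk a K n x → c'.1 = modBy.mk a K m z → K.d n m h x = a • z →
      δ (Hn.mk c) = Hn.mk c'

end Algebras

section Frobenius

variable (p : ℕ) [Fact p.Prime] (A : Type u) [CommRing A] [Fact (¬ IsUnit (p : A))]

/-- A commutative algebra object `D` of `D(W(A^♭))` with a `φ`-semilinear automorphism `φ_D` of
algebra objects. -/
structure FrobAlg extends DAlg (Ainf p A) where
  frob : SemiMap (phi p A : Ainf p A →+* Ainf p A) toDAlg.cx toDAlg.cx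
  frobInv : SemiMap ((phi p A).symm : Ainf p A →+* Ainf p A) toDAlg.cx toDAlg.cx
  frob_frobInv : Homotopic (RingHom.id _) (K := toDAlg.cx) (L := toDAlg.cx)
    (fun i x => frob.toFun i (frobInv.toFun i x)) (fun _ x => x)
  frobInv_frob : Homotopic (RingHom.id _) (K := toDAlg.cx) (L := toDAlg.cx)
    (fun i x => frobInv.toFun i (frob.toFun i x)) (fun _ x => x)
  frob_isAlgMap : SemiMap.IsAlgMap (D := toDAlg) (D' := toDAlg) frob

variable {p A}

/-- Morphisms of commutative algebra objects with Frobenius. -/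
structure FrobAlg.Hom (D D' : FrobAlg p A) where
  map : SemiMap (RingHom.id (Ainf p A)) D.cx D'.cx
  isAlgMap : SemiMap.IsAlgMap (D := D.toDAlg) (D' := D'.toDAlg) map
  frob_comm : Homotopic (phi p A : Ainf p A →+* Ainf p A) (K := D.cx) (L := D'.cx)
    (fun i x => map.toFun i (D.frob.toFun i x)) (fun i x => D'.frob.toFun i (map.toFun i x))

variable (Z : RootSystem p A)

/-- `D` is coconnective and satisfies the three hypotheses: `H^0(D)` is `μ`-torsion-free, the groups
`H^n(Lη_μ D ⊗^L W(A^♭)/ξ̃_r)` are `p`-torsion-free, and the base change maps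
`Lη_μ D ⊗^L W(A^♭)/ξ̃_r → Lη_μ (D ⊗^L W(A^♭)/ξ̃_r)` are quasi-isomorphisms. -/
structure FrobAlg.Admissible (D : FrobAlg p A) : Prop where
  coconnective : ∀ n < 0, Subsingleton (Hn D.cx n)
  w1 : ∀ c : Hn D.cx 0, Z.mu • c = 0 → c = 0
  w2 : ∀ (r : ℕ) (n : ℤ) (c : Hn (modBy (Z.xiTilde r) (eta Z.mu D.cx)) n), p • c = 0 → c = 0
  w3 : ∀ r : ℕ, 1 ≤ r → ∀ n : ℤ,
    Function.Bijective ((baseChange Z.mu (Z.xiTilde r) D.cx).H n)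

/-- `W_r^n(D)_pre = H^n(D ⊗^L W(A^♭)/ξ̃_r)`. -/
abbrev FrobAlg.Pre (D : FrobAlg p A) (r : ℕ) (n : ℤ) : Type u := Hn (modBy (Z.xiTilde r) D.cx) n

/-- `W_r^n(D) = H^n(Lη_μ D ⊗^L W(A^♭)/ξ̃_r)`. -/
abbrev FrobAlg.Witt (D : FrobAlg p A) (r : ℕ) (n : ℕ) : Type u :=
  Hn (modBy (Z.xiTilde r) (eta Z.mu D.cx)) n

/-- `R'`, induced by `φ_D^{-1} ⊗ φ^{-1} : D/ξ̃_{r+1} → D/ξ̃_r`. -/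
def FrobAlg.preR (D : FrobAlg p A) (r : ℕ) (n : ℤ) :
    D.Pre Z (r + 1) n →ₛₗ[((phi p A).symm : Ainf p A →+* Ainf p A)] D.Pre Z r n :=
  (D.frobInv.modBy (Z.xiTilde (r + 1)) (Z.xiTilde r) (fun i x => ⟨Z.xi • D.frobInv.toFun i x, by
    rw [LinearMap.map_smulₛₗ, smul_smul, ← Z.phi_symm_xiTilde_succ]; rfl⟩)).H n

/-- `F`, induced by the canonical projection `D/ξ̃_{r+1} → D/ξ̃_r`. -/
def FrobAlg.preF (D : FrobAlg p A) (r : ℕ) (n : ℤ) : D.Pre Z (r + 1) n →ₗ[Ainf p A] D.Pre Z r n :=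
  ((SemiMap.scalar 1 D.cx).modBy (Z.xiTilde (r + 1)) (Z.xiTilde r) (fun i x =>
    ⟨Z.phiXi (r + 1) • x, by
      rw [smul_smul, ← Z.xiTilde_succ]; exact (one_smul _ _).symm⟩)).H n

/-- `V`, induced by multiplication by `φ^{r+1}(ξ)`, as a map `D/ξ̃_r → D/ξ̃_{r+1}`. -/
def FrobAlg.preV (D : FrobAlg p A) (r : ℕ) (n : ℤ) : D.Pre Z r n →ₗ[Ainf p A] D.Pre Z (r + 1) n :=
  ((SemiMap.scalar (Z.phiXi (r + 1)) D.cx).modBy (Z.xiTilde r) (Z.xiTilde (r + 1)) (fun i x =>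
    ⟨x, by
      rw [Z.xiTilde_succ, mul_comm, mul_smul]; rfl⟩)).H n

variable [IsAdicComplete (Ideal.span {(p : A)}) A]

/-- Homomorphisms of `W_r(A)`-algebras `λ_r : W_r(B) → H^0(D/ξ̃_r)` that are compatible with `R`,
`F`, `V` on the left and `φ_D^{-1}`, the projection, multiplication by `φ^{r+1}(ξ)` on the right.
Here `W(A^♭)/ξ̃_r` is identified with `W_r(A)` through `θ̃_r`. (For `r = 0` both sides vanish.) -/
structure StructureMaps (D : FrobAlg p A) (B : Type u) [CommRing B] [Algebra A B] where
  lam : ∀ r, W p r B →+ D.Pre Z r 0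
  lam_mul : ∀ r x y, lam r (x * y) = D.mulMod (Z.xiTilde r) 0 0 0 rfl (lam r x) (lam r y)
  lam_algebraMap : ∀ r (w : Ainf p A),
    lam r (W.map r (algebraMap A B) (thetaTilde p A r w)) = w • D.oneMod (Z.xiTilde r)
  lam_R : ∀ r x, lam r (W.R r x) = D.preR Z r 0 (lam (r + 1) x)
  lam_F : ∀ r x, lam r (W.F r x) = D.preF Z r 0 (lam (r + 1) x)
  lam_V : ∀ r x, lam (r + 1) (W.V r x) = D.preV Z r 0 (lam r x)

end Frobenius

/-! ### Witt complexes and the relative de Rham–Witt complex -/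

section WittComplexes

/-- The structure of a Witt complex (`F`-`V`-procomplex) for `A → B` on the groups `X r n = W_r^n`.
The index `r = 0` is harmless: as `W_0(A)` is the zero ring, the groups `X 0 n` are trivial. -/
structure WittStr (p : ℕ) [Fact p.Prime] (A B : Type u) [CommRing A] [CommRing B] [Algebra A B]
    (X : ℕ → ℕ → Type u) [∀ r n, AddCommGroup (X r n)] where
  -- the data
  smul : ∀ r n, W p r A →+* AddMonoid.End (X r n)
  one : ∀ r, X r 0
  mul : ∀ r i j k, i + j = k → X r i →+ X r j →+ X r k
  d : ∀ r n, X r n →+ X r (n + 1)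
  R : ∀ r n, X (r + 1) n →+ X r n
  F : ∀ r n, X (r + 1) n →+ X r n
  V : ∀ r n, X r n →+ X (r + 1) n
  lam : ∀ r, W p r B →+ X r 0
  -- commutative differential graded `W_r(A)`-algebras
  one_mul : ∀ r n x, mul r 0 n n (zero_add n) (one r) x = x
  mul_comm : ∀ r i j k (h : i + j = k) x y,
    mul r i j k h x y = (-1 : ℤ) ^ (i * j) • mul r j i k (by omega) y x
  mul_self : ∀ r i k (h : i + i = k) x, Odd i → mul r i i k h x x = 0
  mul_assoc : ∀ r i j k ij jk l (h : i + j = ij) (h' : j + k = jk) (hl : ij + k = l) x y z,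
    mul r ij k l hl (mul r i j ij h x y) z = mul r i jk l (by omega) x (mul r j k jk h' y z)
  smul_mul : ∀ r i j k h a x y, mul r i j k h (smul r i a x) y = smul r k a (mul r i j k h x y)
  d_d : ∀ r n x, d r (n + 1) (d r n x) = 0
  leibniz : ∀ r i j k (h : i + j = k) x y,
    d r k (mul r i j k h x y) = mul r (i + 1) j (k + 1) (by omega) (d r i x) y +
      (-1 : ℤ) ^ i • mul r i (j + 1) (k + 1) (by omega) x (d r j y)
  d_smul : ∀ r n a x, d r n (smul r n a x) = smul r (n + 1) a (d r n x)
  -- `R` is a morphism of differential graded algebras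
  R_one : ∀ r, R r 0 (one (r + 1)) = one r
  R_mul : ∀ r i j k h x y,
    R r k (mul (r + 1) i j k h x y) = mul r i j k h (R r i x) (R r j y)
  R_smul : ∀ r n a x, R r n (smul (r + 1) n a x) = smul r n (W.R r a) (R r n x)
  R_d : ∀ r n x, R r (n + 1) (d (r + 1) n x) = d r n (R r n x)
  -- `F` is a morphism of graded algebras
  F_one : ∀ r, F r 0 (one (r + 1)) = one r
  F_mul : ∀ r i j k h x y,
    F r k (mul (r + 1) i j k h x y) = mul r i j k h (F r i x) (F r j y)
  F_smul : ∀ r n a x, F r n (smul (r + 1) n a x) = smul r n (W.F r a) (F r n x)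
  -- `V` is a morphism of graded modules
  V_smul : ∀ r n a x, V r n (smul r n (W.F r a) x) = smul (r + 1) n a (V r n x)
  V_mul : ∀ r i j k h x y,
    V r k (mul r i j k h (F r i x) y) = mul (r + 1) i j k h x (V r j y)
  -- the identities between the operators
  R_F : ∀ r n x, R r n (F (r + 1) n x) = F r n (R (r + 1) n x)
  R_V : ∀ r n x, R (r + 1) n (V (r + 1) n x) = V r n (R r n x)
  F_V : ∀ r n x, F r n (V r n x) = p • x
  F_d_V : ∀ r n x, F r (n + 1) (d (r + 1) n (V r n x)) = d r n x
  -- the structure maps are morphisms of `W_r(A)`-algebras that commute with `R`, `F`, `V`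
  lam_mul : ∀ r b b', lam r (b * b') = mul r 0 0 0 rfl (lam r b) (lam r b')
  lam_algebraMap : ∀ r a, lam r (W.map r (algebraMap A B) a) = smul r 0 a (one r)
  lam_R : ∀ r b, lam r (W.R r b) = R r 0 (lam (r + 1) b)
  lam_F : ∀ r b, lam r (W.F r b) = F r 0 (lam (r + 1) b)
  lam_V : ∀ r b, lam (r + 1) (W.V r b) = V r 0 (lam r b)
  -- the Teichmüller identity
  teich : ∀ r (b : B), F r 1 (d (r + 1) 0 (lam (r + 1) (W.teich (r + 1) b))) =
    mul r 0 1 1 rfl (lam r (W.teich r b ^ (p - 1))) (d r 0 (lam r (W.teich r b)))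

variable {p : ℕ} [Fact p.Prime] {A B B' : Type u} [CommRing A] [CommRing B] [Algebra A B]
  [CommRing B'] [Algebra A B']

/-- Morphisms of Witt complexes over a morphism `g : B → B'` of `A`-algebras. -/
structure WittStr.Hom (g : B →ₐ[A] B') {X Y : ℕ → ℕ → Type u} [∀ r n, AddCommGroup (X r n)]
    [∀ r n, AddCommGroup (Y r n)] (S : WittStr p A B X) (T : WittStr p A B' Y) where
  toFun : ∀ r n, X r n →+ Y r n
  map_smul : ∀ r n a x, toFun r n (S.smul r n a x) = T.smul r n a (toFun r n x)
  map_one : ∀ r, toFun r 0 (S.one r) = T.one r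
  map_mul : ∀ r i j k h x y,
    toFun r k (S.mul r i j k h x y) = T.mul r i j k h (toFun r i x) (toFun r j y)
  map_d : ∀ r n x, toFun r (n + 1) (S.d r n x) = T.d r n (toFun r n x)
  map_R : ∀ r n x, toFun r n (S.R r n x) = T.R r n (toFun (r + 1) n x)
  map_F : ∀ r n x, toFun r n (S.F r n x) = T.F r n (toFun (r + 1) n x)
  map_V : ∀ r n x, toFun (r + 1) n (S.V r n x) = T.V r n (toFun r n x)
  map_lam : ∀ r b, toFun r 0 (S.lam r b) = T.lam r (W.map r (g : B →+* B') b)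

theorem WittStr.lam_one {X : ℕ → ℕ → Type u} [∀ r n, AddCommGroup (X r n)]
    (S : WittStr p A B X) (r : ℕ) : S.lam r 1 = S.one r := by
  have := S.lam_algebraMap r 1
  rw [(W.map r (algebraMap A B)).map_one, (S.smul r 0).map_one] at this
  exact this

theorem WittStr.lam_natCast_mul {X : ℕ → ℕ → Type u} [∀ r n, AddCommGroup (X r n)]
    (S : WittStr p A B X) (r n m : ℕ) (x : X r n) :
    S.mul r 0 n n (zero_add n) (S.lam r (m : W p r B)) x = m • x := by
  induction m with
  | zero => simp
  | succ m ih =>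
    rw [Nat.cast_succ, map_add, map_add, AddMonoidHom.add_apply, ih, S.lam_one, S.one_mul,
      succ_nsmul]

namespace deRhamWitt

variable (p A B)

/-- Formal expressions for the elements of a Witt complex for `A → B`. -/
inductive Term : ℕ → ℕ → Type u
  | zero (r n : ℕ) : Term r n
  | neg {r n : ℕ} (x : Term r n) : Term r n
  | add {r n : ℕ} (x y : Term r n) : Term r n
  | lam {r : ℕ} (b : W p r B) : Term r 0
  | mul {r i j k : ℕ} (h : i + j = k) (x : Term r i) (y : Term r j) : Term r k
  | d {r n : ℕ} (x : Term r n) : Term r (n + 1)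
  | R {r n : ℕ} (x : Term (r + 1) n) : Term r n
  | F {r n : ℕ} (x : Term (r + 1) n) : Term r n
  | V {r n : ℕ} (x : Term r n) : Term (r + 1) n

variable {p B}

/-- Multiplication by an element of `W_r(A)`. -/
def Term.smul {r n : ℕ} (a : W p r A) (x : Term p B r n) : Term p B r n :=
  .mul (zero_add n) (.lam (W.map r (algebraMap A B) a)) x

/-- The sign `(-1) ^ e`. -/
def Term.sign {r n : ℕ} (e : ℕ) (x : Term p B r n) : Term p B r n :=
  if Even e then x else .neg x

variable (p B)

/-- The congruence generated by the axioms of a Witt complex. -/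
inductive Rel : ∀ r n : ℕ, Term p B r n → Term p B r n → Prop
  -- congruence
  | refl {r n} (x : Term p B r n) : Rel r n x x
  | symm {r n x y} : Rel r n x y → Rel r n y x
  | trans {r n x y z} : Rel r n x y → Rel r n y z → Rel r n x z
  | congr_neg {r n x y} : Rel r n x y → Rel r n (.neg x) (.neg y)
  | congr_add {r n x x' y y'} : Rel r n x x' → Rel r n y y' → Rel r n (.add x y) (.add x' y')
  | congr_mul {r i j k} (h : i + j = k) {x x' y y'} : Rel r i x x' → Rel r j y y' →
      Rel r k (.mul h x y) (.mul h x' y')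
  | congr_d {r n x y} : Rel r n x y → Rel r (n + 1) (.d x) (.d y)
  | congr_R {r n x y} : Rel (r + 1) n x y → Rel r n (.R x) (.R y)
  | congr_F {r n x y} : Rel (r + 1) n x y → Rel r n (.F x) (.F y)
  | congr_V {r n x y} : Rel r n x y → Rel (r + 1) n (.V x) (.V y)
  -- abelian groups
  | add_assoc {r n} (x y z) : Rel r n (.add (.add x y) z) (.add x (.add y z))
  | add_comm {r n} (x y) : Rel r n (.add x y) (.add y x)
  | zero_add {r n} (x) : Rel r n (.add (.zero r n) x) x
  | neg_add {r n} (x) : Rel r n (.add (.neg x) x) (.zero r n)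
  -- additivity
  | lam_add {r} (b b') : Rel r 0 (.lam (b + b')) (.add (.lam b) (.lam b'))
  | mul_add {r i j k} (h : i + j = k) (x y z) :
      Rel r k (.mul h x (.add y z)) (.add (.mul h x y) (.mul h x z))
  | add_mul {r i j k} (h : i + j = k) (x y z) :
      Rel r k (.mul h (.add x y) z) (.add (.mul h x z) (.mul h y z))
  | d_add {r n} (x y) : Rel r (n + 1) (.d (.add x y)) (.add (.d x) (.d y))
  | R_add {r n} (x y) : Rel r n (.R (.add x y)) (.add (.R x) (.R y))
  | F_add {r n} (x y) : Rel r n (.F (.add x y)) (.add (.F x) (.F y))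
  | V_add {r n} (x y) : Rel (r + 1) n (.V (.add x y)) (.add (.V x) (.V y))
  -- differential graded algebras
  | one_mul {r n} (x) : Rel r n (.mul (Nat.zero_add n) (.lam 1) x) x
  | mul_comm {r i j k} (h : i + j = k) (h' : j + i = k) (x y) :
      Rel r k (.mul h x y) (.sign (i * j) (.mul h' y x))
  | mul_self {r i k} (h : i + i = k) (x) (hi : Odd i) : Rel r k (.mul h x x) (.zero r k)
  | mul_assoc {r i j k ij jk l} (h : i + j = ij) (h' : j + k = jk) (hl : ij + k = l)
      (hl' : i + jk = l) (x y z) :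
      Rel r l (.mul hl (.mul h x y) z) (.mul hl' x (.mul h' y z))
  | d_d {r n} (x) : Rel r (n + 1 + 1) (.d (.d x)) (.zero r (n + 1 + 1))
  | leibniz {r i j k} (h : i + j = k) (h₁ : i + 1 + j = k + 1) (h₂ : i + (j + 1) = k + 1) (x y) :
      Rel r (k + 1) (.d (.mul h x y)) (.add (.mul h₁ (.d x) y) (.sign i (.mul h₂ x (.d y))))
  | d_smul {r n} (a : W p r A) (x) : Rel r (n + 1) (.d (.smul A a x)) (.smul A a (.d x))
  -- `R`, `F`, `V`
  | R_mul {r i j k} (h : i + j = k) (x y) : Rel r k (.R (.mul h x y)) (.mul h (.R x) (.R y))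
  | R_d {r n} (x) : Rel r (n + 1) (.R (.d x)) (.d (.R x))
  | F_mul {r i j k} (h : i + j = k) (x y) : Rel r k (.F (.mul h x y)) (.mul h (.F x) (.F y))
  | V_mul {r i j k} (h : i + j = k) (x y) :
      Rel (r + 1) k (.V (.mul h (.F x) y)) (.mul h x (.V y))
  | R_F {r n} (x) : Rel r n (.R (.F x)) (.F (.R x))
  | R_V {r n} (x) : Rel (r + 1) n (.R (.V x)) (.V (.R x))
  | F_V {r n} (x) : Rel r n (.F (.V x)) (.mul (Nat.zero_add n) (.lam (p : W p r B)) x)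
  | F_d_V {r n} (x) : Rel r (n + 1) (.F (.d (.V x))) (.d x)
  -- structure maps
  | lam_mul {r} (b b') : Rel r 0 (.lam (b * b')) (.mul rfl (.lam b) (.lam b'))
  | lam_R {r} (b) : Rel r 0 (.lam (W.R r b)) (.R (.lam b))
  | lam_F {r} (b) : Rel r 0 (.lam (W.F r b)) (.F (.lam b))
  | lam_V {r} (b) : Rel (r + 1) 0 (.lam (W.V r b)) (.V (.lam b))
  | teich {r} (b : B) : Rel r 1 (.F (.d (.lam (W.teich (r + 1) b))))
      (.mul (Nat.zero_add 1) (.lam (W.teich r b ^ (p - 1))) (.d (.lam (W.teich r b))))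

/-- The setoid of the congruence. -/
def setoid (r n : ℕ) : Setoid (Term p B r n) where
  r := Rel p A B r n
  iseqv := ⟨.refl, .symm, .trans⟩

/-- `W_rΩ^n_{B/A}`. -/
def Omega (r n : ℕ) : Type u := Quotient (setoid p A B r n)

instance (r n : ℕ) : Zero (Omega p A B r n) := ⟨Quotient.mk _ (.zero r n)⟩

instance (r n : ℕ) : Neg (Omega p A B r n) := ⟨Quotient.map .neg fun _ _ h => .congr_neg h⟩

instance (r n : ℕ) : Add (Omega p A B r n) :=
  ⟨Quotient.map₂ .add fun _ _ h _ _ h' => .congr_add h h'⟩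

instance (r n : ℕ) : AddCommGroup (Omega p A B r n) where
  add_assoc := by rintro ⟨x⟩ ⟨y⟩ ⟨z⟩; exact Quotient.sound (.add_assoc x y z)
  add_comm := by rintro ⟨x⟩ ⟨y⟩; exact Quotient.sound (.add_comm x y)
  zero_add := by rintro ⟨x⟩; exact Quotient.sound (.zero_add x)
  add_zero := by
    rintro ⟨x⟩; exact Quotient.sound (.trans (.add_comm _ _) (.zero_add x))
  neg_add_cancel := by rintro ⟨x⟩; exact Quotient.sound (.neg_add x)
  nsmul := nsmulRec
  zsmul := zsmulRec

variable {p A B}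

/-- The class of an expression. -/
def Omega.mk {r n : ℕ} (x : Term p B r n) : Omega p A B r n := Quotient.mk _ x

theorem Omega.sound {r n : ℕ} {x y : Term p B r n} (h : Rel p A B r n x y) :
    (mk x : Omega p A B r n) = mk y := Quotient.sound h

theorem Omega.mk_sign {r n : ℕ} (e : ℕ) (x : Term p B r n) :
    (mk (.sign e x) : Omega p A B r n) = (-1 : ℤ) ^ e • mk x := by
  rw [Term.sign]
  split_ifs with h
  · rw [h.neg_one_pow, one_smul]
  · rw [(Nat.not_even_iff_odd.1 h).neg_one_pow, neg_smul, one_smul]; rfl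

/-- The product. -/
def Omega.mul {r i j k : ℕ} (h : i + j = k) :
    Omega p A B r i →+ Omega p A B r j →+ Omega p A B r k :=
  AddMonoidHom.mk' (fun x => AddMonoidHom.mk'
      (Quotient.map₂ (.mul h) (fun _ _ h₁ _ _ h₂ => .congr_mul h h₁ h₂) x)
      (by obtain ⟨x⟩ := x; rintro ⟨y⟩ ⟨z⟩; exact sound (.mul_add h x y z)))
    (by rintro ⟨x⟩ ⟨y⟩; ext ⟨z⟩; exact sound (.add_mul h x y z))

variable (p A B)

theorem Omega.lam_nat_mul {r n : ℕ} (m : ℕ) (x : Omega p A B r n) :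
    Omega.mul (Nat.zero_add n) (mk (.lam (m : W p r B))) x = m • x := by
  have h0 (b b' : W p r B) : (mk (.lam (b + b')) : Omega p A B r 0) =
    mk (.lam b) + mk (.lam b') := sound (.lam_add b b')
  induction m with
  | zero =>
    have : (mk (.lam 0) : Omega p A B r 0) = 0 := by simpa using h0 0 0
    rw [Nat.cast_zero, this, map_zero, zero_smul]; rfl
  | succ m ih =>
    rw [Nat.cast_succ, h0, map_add, AddMonoidHom.add_apply, ih, succ_nsmul]
    obtain ⟨x⟩ := x
    exact congrArg (m • Omega.mk x + ·) (sound (.one_mul x))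

/-- The Witt complex structure of the relative de Rham–Witt complex. -/
def str : WittStr p A B (Omega p A B) where
  smul r n :=
    { toFun := fun a => Omega.mul (Nat.zero_add n) (.mk (.lam (W.map r (algebraMap A B) a)))
      map_one' := by
        ext ⟨x⟩
        rw [map_one]
        exact Omega.sound (.one_mul x)
      map_mul' := fun a b => by
        ext ⟨x⟩
        rw [map_mul]
        exact Omega.sound (.trans (.congr_mul _ (.lam_mul _ _) (.refl _)) (.mul_assoc _ _ _ _ _ _ _))
      map_zero' := by
        ext x
        rw [map_zero]
        have := Omega.lam_nat_mul p A B 0 x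
        rw [Nat.cast_zero, zero_smul] at this
        exact this
      map_add' := fun a b => by
        ext ⟨x⟩
        rw [map_add]
        exact Omega.sound (.trans (.congr_mul _ (.lam_add _ _) (.refl _)) (.add_mul _ _ _ _)) }
  one r := .mk (.lam 1)
  mul r i j k h := Omega.mul h
  d r n := AddMonoidHom.mk' (Quotient.map .d fun _ _ h => .congr_d h)
    (by rintro ⟨x⟩ ⟨y⟩; exact Omega.sound (.d_add x y))
  R r n := AddMonoidHom.mk' (Quotient.map .R fun _ _ h => .congr_R h)
    (by rintro ⟨x⟩ ⟨y⟩; exact Omega.sound (.R_add x y))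
  F r n := AddMonoidHom.mk' (Quotient.map .F fun _ _ h => .congr_F h)
    (by rintro ⟨x⟩ ⟨y⟩; exact Omega.sound (.F_add x y))
  V r n := AddMonoidHom.mk' (Quotient.map .V fun _ _ h => .congr_V h)
    (by rintro ⟨x⟩ ⟨y⟩; exact Omega.sound (.V_add x y))
  lam r := AddMonoidHom.mk' (fun b => .mk (.lam b)) (fun b b' => Omega.sound (.lam_add b b'))
  one_mul := by rintro r n ⟨x⟩; exact Omega.sound (.one_mul x)
  mul_comm := by
    rintro r i j k h ⟨x⟩ ⟨y⟩
    exact (Omega.sound (.mul_comm h (by omega) x y)).trans (Omega.mk_sign _ _)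
  mul_self := by rintro r i k h ⟨x⟩ hi; exact Omega.sound (.mul_self h x hi)
  mul_assoc := by
    rintro r i j k ij jk l h h' hl ⟨x⟩ ⟨y⟩ ⟨z⟩; exact Omega.sound (.mul_assoc h h' hl _ x y z)
  smul_mul := by
    rintro r i j k h a ⟨x⟩ ⟨y⟩; exact Omega.sound (.mul_assoc _ _ _ _ _ _ _)
  d_d := by rintro r n ⟨x⟩; exact Omega.sound (.d_d x)
  leibniz := by
    rintro r i j k h ⟨x⟩ ⟨y⟩
    refine (Omega.sound (.leibniz h (by omega) (by omega) x y)).trans ?_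
    exact congrArg (Omega.mk (.mul _ (.d x) y) + ·) (Omega.mk_sign _ _)
  d_smul := by rintro r n a ⟨x⟩; exact Omega.sound (.d_smul a x)
  R_one r := Omega.sound (.symm (by simpa using Rel.lam_R (A := A) (r := r) (1 : W p (r + 1) B)))
  R_mul := by rintro r i j k h ⟨x⟩ ⟨y⟩; exact Omega.sound (.R_mul h x y)
  R_smul := by
    rintro r n a ⟨x⟩
    refine Omega.sound (.trans (.R_mul _ _ _) (.congr_mul _ (.symm ?_) (.refl _)))
    have := Rel.lam_R (A := A) (r := r) (W.map (r + 1) (algebraMap A B) a)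
    rwa [W.R_map] at this
  R_d := by rintro r n ⟨x⟩; exact Omega.sound (.R_d x)
  F_one r := Omega.sound (.symm (by simpa using Rel.lam_F (A := A) (r := r) (1 : W p (r + 1) B)))
  F_mul := by rintro r i j k h ⟨x⟩ ⟨y⟩; exact Omega.sound (.F_mul h x y)
  F_smul := by
    rintro r n a ⟨x⟩
    refine Omega.sound (.trans (.F_mul _ _ _) (.congr_mul _ (.symm ?_) (.refl _)))
    have := Rel.lam_F (A := A) (r := r) (W.map (r + 1) (algebraMap A B) a)
    rwa [W.F_map] at this
  V_smul := by
    rintro r n a ⟨x⟩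
    refine Omega.sound (.trans (.congr_V (.congr_mul _ ?_ (.refl _))) (.V_mul _ _ _))
    have := Rel.lam_F (A := A) (r := r) (W.map (r + 1) (algebraMap A B) a)
    rwa [W.F_map] at this
  V_mul := by rintro r i j k h ⟨x⟩ ⟨y⟩; exact Omega.sound (.V_mul h x y)
  R_F := by rintro r n ⟨x⟩; exact Omega.sound (.R_F x)
  R_V := by rintro r n ⟨x⟩; exact Omega.sound (.R_V x)
  F_V := by
    rintro r n ⟨x⟩
    exact (Omega.sound (.F_V x)).trans (Omega.lam_nat_mul p A B p (.mk x))
  F_d_V := by rintro r n ⟨x⟩; exact Omega.sound (.F_d_V x)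
  lam_mul r b b' := Omega.sound (.lam_mul b b')
  lam_algebraMap r a := by
    refine Omega.sound (.symm (.trans (.symm (.lam_mul _ _)) ?_))
    rw [mul_one]
    exact .refl _
  lam_R r b := Omega.sound (.lam_R b)
  lam_F r b := Omega.sound (.lam_F b)
  lam_V r b := Omega.sound (.lam_V b)
  teich r b := Omega.sound (.teich b)

section Lift

variable {p A B}
variable {Y : ℕ → ℕ → Type u} [∀ r n, AddCommGroup (Y r n)] (g : B →ₐ[A] B')
  (T : WittStr p A B' Y)

/-- The value of an expression in a Witt complex for `A → B'`. -/
def eval : ∀ {r n : ℕ}, Term p B r n → Y r n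
  | _, _, .zero _ _ => 0
  | _, _, .neg x => -eval x
  | _, _, .add x y => eval x + eval y
  | _, _, .lam b => T.lam _ (W.map _ (g : B →+* B') b)
  | _, _, .mul h x y => T.mul _ _ _ _ h (eval x) (eval y)
  | _, _, .d x => T.d _ _ (eval x)
  | _, _, .R x => T.R _ _ (eval x)
  | _, _, .F x => T.F _ _ (eval x)
  | _, _, .V x => T.V _ _ (eval x)

theorem eval_sign {r n : ℕ} (e : ℕ) (x : Term p B r n) :
    eval g T (.sign e x) = (-1 : ℤ) ^ e • eval g T x := by
  rw [Term.sign]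
  split_ifs with h
  · rw [h.neg_one_pow, one_smul]
  · rw [(Nat.not_even_iff_odd.1 h).neg_one_pow, neg_smul, one_smul, eval]

theorem eval_smul {r n : ℕ} (a : W p r A) (x : Term p B r n) :
    eval g T (.smul A a x) = T.smul r n a (eval g T x) := by
  rw [Term.smul, eval, eval, W.map_map, AlgHom.comp_algebraMap, T.lam_algebraMap, T.smul_mul,
    T.one_mul]

theorem eval_rel {r n : ℕ} {x y : Term p B r n} (h : Rel p A B r n x y) :
    eval g T x = eval g T y := by
  induction h with
  | refl x => rfl
  | symm _ h => exact h.symm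
  | trans _ _ h h' => exact h.trans h'
  | d_smul a x => rw [eval, eval_smul, eval_smul, eval, T.d_smul]
  | mul_comm h h' x y => rw [eval_sign]; exact T.mul_comm _ _ _ _ h _ _
  | leibniz h h₁ h₂ x y =>
    simp only [eval, eval_sign]
    exact T.leibniz _ _ _ _ h _ _
  | mul_assoc h h' hl hl' x y z => exact T.mul_assoc _ _ _ _ _ _ _ h h' hl _ _ _
  | mul_self h x hi => exact T.mul_self _ _ _ h _ hi
  | F_V x =>
    simp only [eval, T.F_V, map_natCast]
    exact (T.lam_natCast_mul _ _ _ _).symm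
  | lam_R b => exact (congrArg _ (W.R_map _ _ _).symm).trans (T.lam_R _ _)
  | lam_F b => exact (congrArg _ (W.F_map _ _ _).symm).trans (T.lam_F _ _)
  | lam_V b => exact (congrArg _ (W.V_map _ _ _).symm).trans (T.lam_V _ _)
  | teich b =>
    simp only [eval, map_pow, W.map_teich]
    exact T.teich _ _
  | _ =>
    simp_all [eval, add_assoc, add_comm, T.one_mul, T.lam_one, T.d_d, T.R_mul, T.R_d, T.F_mul,
      T.V_mul, T.R_F, T.R_V, T.F_d_V, T.lam_mul]

/-- The universal property of the relative de Rham–Witt complex: existence. -/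
def lift : WittStr.Hom g (str p A B) T where
  toFun r n := AddMonoidHom.mk' (Quotient.lift (eval g T) fun _ _ h => eval_rel g T h)
    (by rintro ⟨x⟩ ⟨y⟩; rfl)
  map_smul := by rintro r n a ⟨x⟩; exact eval_smul g T a x
  map_one r := by
    refine Eq.trans ?_ (T.lam_one r)
    exact congrArg (T.lam r) (map_one _)
  map_mul := by rintro r i j k h ⟨x⟩ ⟨y⟩; rfl
  map_d := by rintro r n ⟨x⟩; rfl
  map_R := by rintro r n ⟨x⟩; rfl
  map_F := by rintro r n ⟨x⟩; rfl
  map_V := by rintro r n ⟨x⟩; rfl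
  map_lam r b := rfl

/-- The universal property of the relative de Rham–Witt complex: uniqueness. -/
theorem hom_unique (u : WittStr.Hom g (str p A B) T) : u = lift g T := by
  have key : ∀ {r n : ℕ} (x : Term p B r n), u.toFun r n (.mk x) = eval g T x := by
    intro r n x
    induction x with
    | zero r n => exact map_zero _
    | neg x h => exact (map_neg (u.toFun _ _) (.mk x)).trans (congrArg _ h)
    | add x y h h' =>
      exact (map_add (u.toFun _ _) (.mk x) (.mk y)).trans (congrArg₂ _ h h')
    | lam b => exact u.map_lam _ b
    | mul h x y h₁ h₂ =>
      exact (u.map_mul _ _ _ _ h (.mk x) (.mk y)).trans (by rw [h₁, h₂]; rfl)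
    | d x h => exact (u.map_d _ _ (.mk x)).trans (by rw [h]; rfl)
    | R x h => exact (u.map_R _ _ (.mk x)).trans (by rw [h]; rfl)
    | F x h => exact (u.map_F _ _ (.mk x)).trans (by rw [h]; rfl)
    | V x h => exact (u.map_V _ _ (.mk x)).trans (by rw [h]; rfl)
  cases u
  congr
  ext r n ⟨x⟩
  exact key x

end Lift

variable {p A B}

/-- Functoriality of the relative de Rham–Witt complex in `B`. -/
def map (g : B →ₐ[A] B') : WittStr.Hom g (str p A B) (str p A B') := lift g (str p A B')

end deRhamWitt

end WittComplexes

/-! ### The Witt complex attached to an algebra with Frobenius -/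

section Canonical

variable {p : ℕ} [Fact p.Prime] {A : Type u} [CommRing A] [Fact (¬ IsUnit (p : A))]
  (Z : RootSystem p A) {D D' : FrobAlg p A}

/-- The map `H^n(Lη_μ D ⊗^L W(A^♭)/ξ̃_r) → H^n(D ⊗^L W(A^♭)/ξ̃_r)` induced by `Lη_μ D → D`. -/
def FrobAlg.incl (hD : D.Admissible Z) (r n : ℕ) : D.Witt Z r n →ₗ[Ainf p A] D.Pre Z r n :=
  canMap Z.mu (Z.xiTilde r) D.cx hD.w1 n

/-- The map `W_r^n(D) → W_r^n(D')` induced by a morphism `D → D'`. -/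
def FrobAlg.Hom.witt (f : FrobAlg.Hom D D') (r n : ℕ) : D.Witt Z r n →ₗ[Ainf p A] D'.Witt Z r n :=
  ((f.map.eta Z.mu).modBy (Z.xiTilde r) (Z.xiTilde r) (fun i x =>
    ⟨(f.map.eta Z.mu).toFun i x, (map_smul _ _ _).symm⟩)).H n

/-- The map `H^n(D/ξ̃_r) → H^n(D'/ξ̃_r)` induced by a morphism `D → D'`. -/
def FrobAlg.Hom.pre (f : FrobAlg.Hom D D') (r : ℕ) (n : ℤ) :
    D.Pre Z r n →ₗ[Ainf p A] D'.Pre Z r n :=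
  (f.map.modBy (Z.xiTilde r) (Z.xiTilde r) (fun i x =>
    ⟨f.map.toFun i x, (map_smul _ _ _).symm⟩)).H n

variable [IsAdicComplete (Ideal.span {(p : A)}) A] {B : Type u} [CommRing B] [Algebra A B]

/-- `S` is the Witt complex structure attached to `D` and `λ`: on the groups
`W_r^n(D) = H^n(Lη_μ D ⊗^L W(A^♭)/ξ̃_r)`, the `W_r(A)`-module structure is the one through `θ̃_r`, the
differential is the Bockstein of `ξ̃_r`, and the product, `R = θ̃_r(ξ)^n R'`, `F`, `V` are those of
`W_r^n(D)_pre`. The structure maps are the `λ_r`, up to `[ζ_{p^r}] - 1`-torsion in `H^0(D/ξ̃_r)`. -/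
structure IsCanonical (hD : D.Admissible Z) (L : StructureMaps Z D B)
    (S : WittStr p A B (D.Witt Z)) : Prop where
  smul : ∀ r n w x, S.smul r n (thetaTilde p A r w) x = w • x
  one : ∀ r, FrobAlg.incl Z hD r 0 (S.one r) = D.oneMod (Z.xiTilde r)
  mul : ∀ r i j k (h : i + j = k) x y, FrobAlg.incl Z hD r k (S.mul r i j k h x y) =
    D.mulMod (Z.xiTilde r) i j k (by omega) (FrobAlg.incl Z hD r i x) (FrobAlg.incl Z hD r j y)
  d : ∀ r n : ℕ, IsBockstein (Z.xiTilde r) (eta Z.mu D.cx) n ((n + 1 : ℕ) : ℤ)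
    (Nat.cast_succ n).symm (S.d r n)
  R : ∀ r n x, FrobAlg.incl Z hD r n (S.R r n x) =
    Z.xi ^ n • D.preR Z r n (FrobAlg.incl Z hD (r + 1) n x)
  F : ∀ r n x, FrobAlg.incl Z hD r n (S.F r n x) = D.preF Z r n (FrobAlg.incl Z hD (r + 1) n x)
  V : ∀ r n x, FrobAlg.incl Z hD (r + 1) n (S.V r n x) = D.preV Z r n (FrobAlg.incl Z hD r n x)
  lam : ∀ r b, Z.mu • (FrobAlg.incl Z hD r 0 (S.lam r b) - L.lam r b) = 0

end Canonical

end AInf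

end

/-!
For an admissible `D` the map `ι : W_r^n(D) → H^n(D/ξ̃_r)` is injective: its kernel is killed by
`μ^n`, and `ξ̃_r ≡ p^r` modulo `μ` turns the `p`-torsion-freeness (𝒲2) of `W_r^n(D)` into
`μ`-torsion-freeness. The image of `ι` consists of the classes `μ^n [y]` with `dy` divisible by
`μ ξ̃_r`; it contains the unit and is stable under products, `ξ^n R'`, `F` and `V`, and `ι` commutes
with the Bocksteins. So the operators exist, are unique, and every identity between them and their
functoriality can be checked in `H^n(D/ξ̃_r)`. By (𝒲3) in degree `0`, each `λ_r(b)` agrees with an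
element of the image up to `μ`-torsion, and `W_r^0(D)` has none, so that element is unique. The
action of `W_r(A)` is the one of `W(A^♭)`, since `θ̃_r` is surjective with kernel `(ξ̃_r)`. Finally,
`p F d λ([b]) = d F λ([b]) = d λ([b])^p = p λ([b])^{p-1} d λ([b])`, and `p` may be cancelled. The
maps out of the initial Witt complex are then governed by its universal property.
-/

noncomputable section

namespace AInf

/-! ### Witt vectors -/

section WittVectors

variable {p : ℕ} [Fact p.Prime] {A : Type u} [CommRing A]

theorem ghostMap_injective (hp : (p : A) ∈ nonZeroDivisors A) :
    Function.Injective (WittVector.ghostMap : WittVector p A →+* ℕ → A) := by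
  intro x y hxy
  ext n
  induction n using Nat.strong_induction_on with
  | _ n ih =>
    have hn := congrFun hxy n
    rw [WittVector.ghostMap_apply, WittVector.ghostMap_apply, WittVector.ghostComponent_apply,
      WittVector.ghostComponent_apply, aeval_wittPolynomial, aeval_wittPolynomial,
      Finset.sum_range_succ, Finset.sum_range_succ,
      Finset.sum_congr rfl (fun i hi => by rw [ih i (Finset.mem_range.1 hi)])] at hn
    have hpn : (p : A) ^ n * x.coeff n = (p : A) ^ n * y.coeff n := by
      simpa only [Nat.sub_self, pow_zero, pow_one] using add_left_cancel hn
    exact (mul_cancel_left_mem_nonZeroDivisors (pow_mem hp n)).1 hpn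

theorem sum_teichmuller_pow_eq_verschiebung_one (hp : (p : A) ∈ nonZeroDivisors A) {z : A}
    (hz : ∑ i ∈ Finset.range p, z ^ i = 0) :
    ∑ i ∈ Finset.range p, WittVector.teichmuller p z ^ i = WittVector.verschiebung 1 := by
  have hzp : z ^ p = 1 := by
    rw [← sub_eq_zero, ← geom_sum_mul, hz, zero_mul]
  refine ghostMap_injective hp (funext fun n => ?_)
  simp only [WittVector.ghostMap_apply, map_sum, map_pow, WittVector.ghostComponent_teichmuller]
  cases n with
  | zero => simpa only [pow_zero, pow_one, WittVector.ghostComponent_zero_verschiebung] using hz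
  | succ n =>
    simp only [pow_succ' p, pow_mul z, hzp, one_pow, WittVector.ghostComponent_verschiebung,
      map_one, Finset.sum_const, Finset.card_range, nsmul_one, mul_one]

theorem exists_verschiebung_eq {x : WittVector p A} (hx : x.coeff 0 = 0) :
    ∃ y, WittVector.verschiebung y = x :=
  ⟨_, (WittVector.eq_iterate_verschiebung (n := 1) fun i hi => by rwa [Nat.lt_one_iff.1 hi]).symm⟩

theorem W.exists_eq_add_V {r : ℕ} {x y : W p (r + 1) A} (h : x.coeff 0 = y.coeff 0) :
    ∃ z, x = y + W.V r z := by
  obtain ⟨x, rfl⟩ := WittVector.truncate_surjective p (r + 1) A x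
  obtain ⟨y, rfl⟩ := WittVector.truncate_surjective p (r + 1) A y
  have hxy : (x - y).coeff 0 = 0 :=
    (map_sub WittVector.constantCoeff x y).trans (sub_eq_zero.2 h)
  obtain ⟨z, hz⟩ := exists_verschiebung_eq hxy
  exact ⟨WittVector.truncate r z, by rw [W.V_truncate, hz, map_sub, add_sub_cancel]⟩

theorem W.V_injective (r : ℕ) : Function.Injective (W.V r : W p r A → W p (r + 1) A) := by
  refine (injective_iff_map_eq_zero _).2 fun x hx => ?_
  obtain ⟨x, rfl⟩ := WittVector.truncate_surjective p r A x
  rw [W.V_truncate, ← RingHom.mem_ker, WittVector.mem_ker_truncate] at hx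
  rw [← RingHom.mem_ker, WittVector.mem_ker_truncate]
  exact fun i hi => (WittVector.verschiebung_coeff_succ x i).symm.trans (hx _ (Nat.succ_lt_succ hi))

theorem W.V_F_mul {r : ℕ} (x : W p (r + 1) A) (y : W p r A) :
    W.V r (W.F r x * y) = x * W.V r y := by
  obtain ⟨x, rfl⟩ := WittVector.truncate_surjective p (r + 1) A x
  obtain ⟨y, rfl⟩ := WittVector.truncate_surjective p r A y
  rw [W.F_truncate, ← map_mul, W.V_truncate, W.V_truncate, ← map_mul, mul_comm,
    WittVector.verschiebung_mul_frobenius, mul_comm]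

-- Both sides agree in ghost components, which suffices in the torsion-free ring `ℤ[A]` over `A`.
theorem frobenius_teichmuller (b : A) :
    WittVector.frobenius (WittVector.teichmuller p b) = WittVector.teichmuller p b ^ p := by
  have universal_case : WittVector.frobenius (WittVector.teichmuller p (MvPolynomial.X b)) =
      WittVector.teichmuller p (MvPolynomial.X b : MvPolynomial A ℤ) ^ p := by
    refine ghostMap_injective (mem_nonZeroDivisors_of_ne_zero (Nat.cast_ne_zero.2
      (Fact.out : p.Prime).ne_zero)) (funext fun n => ?_)
    rw [WittVector.ghostMap_apply, WittVector.ghostMap_apply, WittVector.ghostComponent_frobenius,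
      map_pow, WittVector.ghostComponent_teichmuller, WittVector.ghostComponent_teichmuller,
      ← pow_mul, pow_succ]
  have h := congrArg (WittVector.map (MvPolynomial.aeval (R := ℤ) (id : A → A)).toRingHom)
    universal_case
  rw [(WittVector.frobenius_isPoly p).map, map_pow, WittVector.map_teichmuller] at h
  simpa only [AlgHom.toRingHom_eq_coe, RingHom.coe_coe, MvPolynomial.aeval_X, id_eq] using h

theorem W.F_teich (r : ℕ) (b : A) : W.F r (W.teich (r + 1) b) = (W.teich r b ^ p : W p r A) := by
  rw [W.teich, W.F_truncate, frobenius_teichmuller, map_pow, W.teich]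

variable {k : Type u} [CommRing k] [CharP k p] [PerfectRing k p]

theorem mem_nonZeroDivisors_of_coeff_zero {x : WittVector p k}
    (hx : x.coeff 0 ∈ nonZeroDivisors k) : x ∈ nonZeroDivisors (WittVector p k) := by
  have coeff_zero {y : WittVector p k} (hy : y * x = 0) : y.coeff 0 = 0 :=
    (mul_right_mem_nonZeroDivisors_eq_zero_iff hx).1 (by
      rw [← WittVector.mul_coeff_zero, hy, WittVector.zero_coeff])
  have coeff_eq (n : ℕ) : ∀ y, y * x = 0 → y.coeff n = 0 := by
    induction n with
    | zero => exact fun y => coeff_zero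
    | succ n ih =>
      intro y hy
      obtain ⟨z, rfl⟩ : (p : WittVector p k) ∣ y := by
        rw [← Ideal.mem_span_singleton, WittVector.mem_span_p_iff_coeff_zero_eq_zero]
        exact coeff_zero hy
      have hz : z * x = 0 := WittVector.eq_zero_of_p_mul_eq_zero _ (by
        rw [← hy, mul_comm _ (p : WittVector p k), ← mul_assoc])
      rw [mul_comm, WittVector.mul_charP_coeff_succ, ih z hz, zero_pow (Fact.out : p.Prime).ne_zero]
  refine mem_nonZeroDivisors_iff_right.2 fun y hy => ?_
  ext n
  rw [coeff_eq n y hy, WittVector.zero_coeff]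

theorem frobenius_frobeniusSection (x : WittVector p k) :
    WittVector.frobenius (frobeniusSection x) = frobeniusSection (WittVector.frobenius x) :=
  ghost_ext fun n => by
    rw [WittVector.ghostComponent_frobenius, ghostComponent_frobeniusSection,
      ghostComponent_frobeniusSection, Function.iterate_succ_apply]

theorem coeff_zero_frobeniusSection (x : WittVector p k) : (frobeniusSection x).coeff 0 = x := by
  have h := ghostComponent_frobeniusSection 0 x
  rwa [WittVector.ghostComponent_apply, aeval_wittPolynomial, Finset.sum_range_one, pow_zero,
    one_mul, Nat.sub_self, pow_zero, pow_one] at h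

end WittVectors

/-! ### Roots of unity in the tilt -/

section Tilt

theorem isUnit_perfection_of_isUnit_coeff_zero {M : Type*} [CommMonoid M] {n : ℕ} (hn : n ≠ 0)
    {t : Perfection M n} (ht : IsUnit (Perfection.coeffMonoidHom M n 0 t)) : IsUnit t := by
  have isUnit_coeff (i : ℕ) : IsUnit (Perfection.coeffMonoidHom M n i t) := by
    induction i with
    | zero => exact ht
    | succ i ih => rwa [← Perfection.coeffMonoidHom_pow_p', isUnit_pow_iff hn] at ih
  choose c hc using fun i => (isUnit_coeff i).exists_right_inv
  have c_pow (i : ℕ) : c (i + 1) ^ n = c i := by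
    calc c (i + 1) ^ n
        = c (i + 1) ^ n * (Perfection.coeffMonoidHom M n i t * c i) := by rw [hc, mul_one]
      _ = (Perfection.coeffMonoidHom M n (i + 1) t * c (i + 1)) ^ n * c i := by
        rw [mul_pow, Perfection.coeffMonoidHom_pow_p', ← mul_assoc, mul_comm (c (i + 1) ^ n)]
      _ = c i := by rw [hc, one_pow, one_mul]
  exact IsUnit.of_mul_eq_one (⟨c, c_pow⟩ : Perfection M n) (Perfection.extMonoid hc)

variable {p : ℕ} {A : Type u} [CommRing A] (Z : RootSystem p A)

theorem RootSystem.zeta_add_pow (k n : ℕ) : Z.ζ (n + k) ^ p ^ n = Z.ζ k := by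
  induction n with
  | zero => rw [pow_zero, pow_one, zero_add]
  | succ n ih => rw [pow_succ', pow_mul, Nat.add_right_comm, Z.pow_eq, ih]

variable [Fact p.Prime]

theorem RootSystem.sum_zeta_one_pow : ∑ i ∈ Finset.range p, Z.ζ 1 ^ i = 0 := by
  have h := Z.isRoot 1
  rwa [pow_one, Polynomial.cyclotomic_prime, Polynomial.IsRoot, Polynomial.eval_geom_sum] at h

variable [Fact (¬ IsUnit (p : A))]

-- The `p`-power roots of an annihilator of `x` in the perfect ring `A^♭` again annihilate `x`.
theorem mem_nonZeroDivisors_preTilt {x : PreTilt A p}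
    (hx : ∀ t, t * x = 0 → PreTilt.coeff 0 t = 0) : x ∈ nonZeroDivisors (PreTilt A p) := by
  refine mem_nonZeroDivisors_iff_right.2 fun t ht => Perfection.ext fun n => ?_
  have root_mul (n : ℕ) : (frobeniusEquiv (PreTilt A p) p).symm^[n] t * x = 0 := by
    induction n with
    | zero => exact ht
    | succ n ih =>
      refine (frobeniusEquiv (PreTilt A p) p).injective ?_
      rw [Function.iterate_succ_apply', map_mul, RingEquiv.apply_symm_apply, frobeniusEquiv_def,
        ← mul_pow_sub_one (Fact.out : p.Prime).ne_zero, ← mul_assoc, ih, zero_mul, map_zero]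
  have coeff_root := hx _ (root_mul n)
  rw [PreTilt.coeff_iterate_frobeniusEquiv_symm, zero_add] at coeff_root
  exact coeff_root.trans (map_zero (PreTilt.coeff n)).symm

/-- The element `ε^{1/p}`. -/
abbrev RootSystem.epsRoot : PreTilt A p := (frobeniusEquiv (PreTilt A p) p).symm Z.eps

theorem RootSystem.epsRoot_pow : Z.epsRoot ^ p = Z.eps :=
  frobeniusEquiv_symm_pow_p _ _ Z.eps

variable [IsAdicComplete (Ideal.span {(p : A)}) A]

theorem RootSystem.untilt_epsRoot : Z.epsRoot.untilt = Z.ζ 1 :=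
  Perfection.teichmuller_spec fun n => ⟨Z.ζ (n + 1),
    (PreTilt.coeff_frobeniusEquiv_symm n Z.eps).symm, by rw [Z.zeta_add_pow]⟩

theorem RootSystem.epsRoot_sub_one_mem_nonZeroDivisors (hp : (p : A) ∈ nonZeroDivisors A) :
    Z.epsRoot - 1 ∈ nonZeroDivisors (PreTilt A p) := by
  refine mem_nonZeroDivisors_preTilt fun t ht => ?_
  have zeta_mul : t.untilt * Z.ζ 1 = t.untilt := by
    rw [← Z.untilt_epsRoot, ← map_mul, ← sub_add_cancel Z.epsRoot 1, mul_add, ht, mul_one, zero_add]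
  have zeta_pow_mul (i : ℕ) : t.untilt * Z.ζ 1 ^ i = t.untilt := by
    induction i with
    | zero => rw [pow_zero, mul_one]
    | succ i ih => rw [pow_succ, ← mul_assoc, ih, zeta_mul]
  have untilt_mul_p : t.untilt * (p : A) = 0 := by
    calc t.untilt * (p : A)
        = ∑ i ∈ Finset.range p, t.untilt * Z.ζ 1 ^ i := by
          rw [Finset.sum_congr rfl fun i _ => zeta_pow_mul i, Finset.sum_const, Finset.card_range,
            nsmul_eq_mul, mul_comm]
      _ = 0 := by rw [← Finset.mul_sum, Z.sum_zeta_one_pow, mul_zero]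
  rw [← PreTilt.mk_untilt_eq_coeff_zero,
    (mul_right_mem_nonZeroDivisors_eq_zero_iff hp).1 untilt_mul_p, map_zero]

end Tilt

/-! ### The elements `μ`, `ξ` and `ξ̃_r` -/

section MuXi

variable {p : ℕ} [Fact p.Prime] {A : Type u} [CommRing A] [Fact (¬ IsUnit (p : A))]
  (Z : RootSystem p A)

theorem phi_teichmuller (x : PreTilt A p) :
    phi p A (WittVector.teichmuller p x) = WittVector.teichmuller p x ^ p :=
  frobenius_teichmuller x

theorem RootSystem.phi_symm_mu :
    (phi p A).symm Z.mu = WittVector.teichmuller p Z.epsRoot - 1 := by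
  rw [RingEquiv.symm_apply_eq, map_sub, map_one, phi_teichmuller, ← map_pow, Z.epsRoot_pow, mu]

theorem RootSystem.xi_mul_phi_symm_mu : Z.xi * (phi p A).symm Z.mu = Z.mu := by
  rw [Z.phi_symm_mu, xi, geom_sum_mul, ← map_pow, Z.epsRoot_pow, mu]

theorem RootSystem.phi_mu : phi p A Z.mu = phi p A Z.xi * Z.mu := by
  conv_lhs => rw [← Z.xi_mul_phi_symm_mu, map_mul, RingEquiv.apply_symm_apply]

theorem RootSystem.phi_iterate_mu (r : ℕ) : (phi p A)^[r] Z.mu = Z.mu * Z.xiTilde r := by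
  induction r with
  | zero => rw [xiTilde, Finset.range_zero, Finset.prod_empty, mul_one, Function.iterate_zero_apply]
  | succ r ih =>
    rw [Function.iterate_succ_apply, Z.phi_mu, iterate_map_mul, ih, Z.xiTilde_succ, phiXi,
      Function.iterate_succ_apply, mul_comm, mul_assoc]

theorem RootSystem.mu_dvd_phi_xi_sub : Z.mu ∣ phi p A Z.xi - p := by
  have phi_xi : phi p A Z.xi = ∑ i ∈ Finset.range p, WittVector.teichmuller p Z.eps ^ i := by
    rw [xi, map_sum]
    refine Finset.sum_congr rfl fun i _ => ?_
    rw [map_pow, phi_teichmuller, ← map_pow _ _ p, Z.epsRoot_pow]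
  have hp : (p : Ainf p A) = ∑ i ∈ Finset.range p, 1 ^ i := by
    simp only [one_pow, Finset.sum_const, Finset.card_range, nsmul_one]
  rw [phi_xi, hp, ← Finset.sum_sub_distrib]
  exact Finset.dvd_sum fun i _ => sub_dvd_pow_sub_pow _ _ i

theorem RootSystem.mu_mul_xiTilde_dvd_phiXi_sub (r : ℕ) :
    Z.mu * Z.xiTilde r ∣ Z.phiXi (r + 1) - p := by
  rw [← Z.phi_iterate_mu, phiXi]
  induction r with
  | zero => exact Z.mu_dvd_phi_xi_sub
  | succ r ih =>
    rw [Function.iterate_succ_apply', Function.iterate_succ_apply' _ (r + 1),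
      ← map_natCast (phi p A) p, ← map_sub]
    exact map_dvd (phi p A) ih

theorem RootSystem.mu_dvd_xiTilde_sub (r : ℕ) : Z.mu ∣ Z.xiTilde r - (p : Ainf p A) ^ r := by
  induction r with
  | zero => rw [xiTilde, Finset.range_zero, Finset.prod_empty, pow_zero, sub_self]; exact dvd_zero _
  | succ r ih =>
    rw [Z.xiTilde_succ, pow_succ]
    exact dvd_mul_sub_mul ih ((dvd_mul_right _ _).trans (Z.mu_mul_xiTilde_dvd_phiXi_sub r))

section Regular

variable [IsAdicComplete (Ideal.span {(p : A)}) A]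

theorem RootSystem.mu_mem_nonZeroDivisors (hp : (p : A) ∈ nonZeroDivisors A) :
    Z.mu ∈ nonZeroDivisors (Ainf p A) := by
  have coeff_zero_mu : Z.mu.coeff 0 = (Z.epsRoot - 1) ^ p := by
    rw [sub_pow_char, one_pow, Z.epsRoot_pow]
    change WittVector.constantCoeff (WittVector.teichmuller p Z.eps - 1) = _
    rw [map_sub, map_one]
    rfl
  exact mem_nonZeroDivisors_of_coeff_zero
    (coeff_zero_mu ▸ pow_mem (Z.epsRoot_sub_one_mem_nonZeroDivisors hp) p)

theorem RootSystem.xiTilde_mem_nonZeroDivisors (hp : (p : A) ∈ nonZeroDivisors A) (r : ℕ) :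
    Z.xiTilde r ∈ nonZeroDivisors (Ainf p A) := by
  have phi_mapsTo : Set.MapsTo (phi p A) (nonZeroDivisors (Ainf p A))
      (nonZeroDivisors (Ainf p A)) := fun _ hx =>
    MulEquivClass.map_nonZeroDivisors (phi p A) ▸ Submonoid.mem_map_of_mem (phi p A) hx
  have phi_iterate_mu_mem := phi_mapsTo.iterate r (Z.mu_mem_nonZeroDivisors hp)
  rw [Z.phi_iterate_mu] at phi_iterate_mu_mem
  exact (mul_mem_nonZeroDivisors.1 phi_iterate_mu_mem).2

end Regular

end MuXi

/-! ### The maps `θ_r` and `θ̃_r` -/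

section Theta

variable {p : ℕ} [Fact p.Prime] {A : Type u} [CommRing A] [Fact (¬ IsUnit (p : A))]

theorem isUnit_preTilt_of_isUnit_coeff_zero {t : PreTilt A p} (ht : IsUnit (PreTilt.coeff 0 t)) :
    IsUnit t :=
  isUnit_perfection_of_isUnit_coeff_zero (Fact.out : p.Prime).ne_zero ht

variable [IsAdicComplete (Ideal.span {(p : A)}) A]

theorem F_theta (r : ℕ) (w : Ainf p A) :
    W.F r (theta p A (r + 1) w) = theta p A r (phi p A w) := by
  rw [theta, RingHom.comp_apply, W.F_truncate, RingHom.comp_apply,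
    ← (WittVector.frobenius_isPoly p).map, frobenius_frobeniusSection]
  rfl

theorem R_theta (r : ℕ) (w : Ainf p A) : W.R r (theta p A (r + 1) w) = theta p A r w := by
  rw [theta, RingHom.comp_apply, W.R_truncate]
  rfl

theorem coeff_zero_theta (r : ℕ) (w : Ainf p A) :
    (theta p A (r + 1) w).coeff 0 = WittVector.fontaineTheta A p w :=
  congrArg (WittVector.fontaineTheta A p) (coeff_zero_frobeniusSection w)

theorem thetaTilde_apply (r : ℕ) (w : Ainf p A) :
    thetaTilde p A r w = theta p A r ((phi p A).symm^[r] w) := by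
  rw [thetaTilde, RingHom.comp_apply, RingHom.coe_pow]
  rfl

theorem F_thetaTilde (r : ℕ) (w : Ainf p A) :
    W.F r (thetaTilde p A (r + 1) w) = thetaTilde p A r w := by
  rw [thetaTilde_apply, F_theta, Function.iterate_succ_apply', RingEquiv.apply_symm_apply,
    thetaTilde_apply]

theorem R_thetaTilde (r : ℕ) (w : Ainf p A) :
    W.R r (thetaTilde p A (r + 1) w) = thetaTilde p A r ((phi p A).symm w) := by
  rw [thetaTilde_apply, R_theta, thetaTilde_apply, Function.iterate_succ_apply]

variable (Z : RootSystem p A)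

theorem RootSystem.fontaineTheta_xi : WittVector.fontaineTheta A p Z.xi = 0 := by
  rw [xi, map_sum, ← Z.sum_zeta_one_pow]
  refine Finset.sum_congr rfl fun i _ => ?_
  rw [map_pow, WittVector.fontaineTheta_teichmuller, Z.untilt_epsRoot]

theorem RootSystem.theta_xi (hp : (p : A) ∈ nonZeroDivisors A) (r : ℕ) :
    theta p A (r + 1) Z.xi = W.V r 1 := by
  rw [xi, map_sum, ← map_one (WittVector.truncate r), W.V_truncate,
    ← sum_teichmuller_pow_eq_verschiebung_one hp Z.sum_zeta_one_pow, map_sum]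
  refine Finset.sum_congr rfl fun i _ => ?_
  rw [map_pow, theta_teichmuller, map_pow, Z.untilt_epsRoot]
  rfl

omit [IsAdicComplete (Ideal.span {(p : A)}) A] in
theorem RootSystem.map_coeff_zero_xi (hp : (p : A) ∈ nonZeroDivisors A) :
    WittVector.map (PreTilt.coeff (p := p) (O := A) 0) Z.xi = WittVector.verschiebung 1 := by
  rw [← map_one (WittVector.map (Ideal.Quotient.mk (Ideal.span {(p : A)}))),
    ← WittVector.map_verschiebung,
    ← sum_teichmuller_pow_eq_verschiebung_one hp Z.sum_zeta_one_pow, xi, map_sum, map_sum]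
  refine Finset.sum_congr rfl fun i _ => ?_
  rw [map_pow, map_pow, WittVector.map_teichmuller, WittVector.map_teichmuller]
  exact congrArg (fun x => WittVector.teichmuller p x ^ i)
    (PreTilt.coeff_frobeniusEquiv_symm 0 Z.eps)

-- The image of `ξ` in `W(A/p)` is `V(1)`, and that of `g` is some `V(g')`, so that `V(1)` is
-- `V(g' F(h))` and the reduction of `h` is a unit.
theorem RootSystem.isUnit_of_xi_eq_mul (hp : (p : A) ∈ nonZeroDivisors A) {g h : Ainf p A}
    (hg : WittVector.fontaineTheta A p g = 0) (hgh : Z.xi = g * h) : IsUnit h := by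
  have coeff_zero_g : (WittVector.map (PreTilt.coeff (p := p) (O := A) 0) g).coeff 0 = 0 := by
    rw [WittVector.map_coeff, ← WittVector.mk_fontaineTheta, hg, map_zero]
  obtain ⟨g', hg'⟩ := exists_verschiebung_eq coeff_zero_g
  have map_gh := Z.map_coeff_zero_xi hp
  rw [hgh, map_mul, ← hg', ← WittVector.verschiebung_mul_frobenius] at map_gh
  have coeff_one_gh := congrArg (fun x => WittVector.coeff x 1) map_gh
  simp only [WittVector.verschiebung_coeff_succ, WittVector.mul_coeff_zero,
    WittVector.coeff_frobenius_charP, WittVector.map_coeff,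
    WittVector.one_coeff_zero] at coeff_one_gh
  have isUnit_coeff_zero_h : IsUnit (h.coeff 0) :=
    isUnit_preTilt_of_isUnit_coeff_zero ((isUnit_pow_iff (Fact.out : p.Prime).ne_zero).1
      (IsUnit.of_mul_eq_one_right _ coeff_one_gh))
  exact (WittVector.mkUnit (a := isUnit_coeff_zero_h.unit) rfl).isUnit

theorem RootSystem.xi_dvd_of_fontaineTheta_eq_zero (hA : IsPerfectoid p A)
    (hp : (p : A) ∈ nonZeroDivisors A) {w : Ainf p A} (hw : WittVector.fontaineTheta A p w = 0) :
    Z.xi ∣ w := by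
  obtain ⟨g, ker_eq⟩ := hA.ker_theta_principal
  have theta_eq_zero_iff (x : Ainf p A) : WittVector.fontaineTheta A p x = 0 ↔ g ∣ x := by
    rw [← RingHom.mem_ker, ker_eq, ← Ideal.mem_span_singleton]
  obtain ⟨h, xi_eq⟩ := (theta_eq_zero_iff _).1 Z.fontaineTheta_xi
  rw [xi_eq, (Z.isUnit_of_xi_eq_mul hp ((theta_eq_zero_iff g).2 dvd_rfl) xi_eq).mul_right_dvd]
  exact (theta_eq_zero_iff w).1 hw

theorem RootSystem.V_thetaTilde (hp : (p : A) ∈ nonZeroDivisors A) (r : ℕ) (w : Ainf p A) :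
    W.V r (thetaTilde p A r w) = thetaTilde p A (r + 1) (w * Z.phiXi (r + 1)) := by
  have thetaTilde_phiXi : thetaTilde p A (r + 1) (Z.phiXi (r + 1)) = W.V r 1 := by
    rw [thetaTilde_apply, phiXi, Function.LeftInverse.iterate (phi p A).symm_apply_apply,
      Z.theta_xi hp]
  rw [map_mul, thetaTilde_phiXi, ← W.V_F_mul, F_thetaTilde, mul_one]

theorem RootSystem.thetaTilde_surjective (Z : RootSystem p A) (hA : IsPerfectoid p A)
    (hp : (p : A) ∈ nonZeroDivisors A) (r : ℕ) :
    Function.Surjective (thetaTilde p A r) := by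
  induction r with
  | zero => exact fun x => ⟨0, TruncatedWittVector.ext fun i => i.elim0⟩
  | succ r ih =>
    intro x
    obtain ⟨w, theta_w⟩ := surjective_fontaineTheta hA.frobenius_surjective (x.coeff 0)
    have coeff_zero_eq : x.coeff 0 =
        (thetaTilde p A (r + 1) ((phi p A)^[r + 1] w)).coeff 0 := by
      rw [thetaTilde_apply, Function.LeftInverse.iterate (phi p A).symm_apply_apply,
        coeff_zero_theta, theta_w]
    obtain ⟨y, rfl⟩ := W.exists_eq_add_V coeff_zero_eq
    obtain ⟨v, rfl⟩ := ih y
    exact ⟨(phi p A)^[r + 1] w + v * Z.phiXi (r + 1), by rw [Z.V_thetaTilde hp, ← map_add]⟩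

theorem RootSystem.xiTilde_dvd_of_thetaTilde_eq_zero (hA : IsPerfectoid p A)
    (hp : (p : A) ∈ nonZeroDivisors A) (r : ℕ) {w : Ainf p A} (hw : thetaTilde p A r w = 0) :
    Z.xiTilde r ∣ w := by
  induction r generalizing w with
  | zero => exact ⟨w, by rw [xiTilde, Finset.range_zero, Finset.prod_empty, one_mul]⟩
  | succ r ih =>
    have fontaineTheta_eq_zero :
        WittVector.fontaineTheta A p ((phi p A).symm^[r + 1] w) = 0 := by
      rw [← coeff_zero_theta r, ← thetaTilde_apply, hw]
      exact TruncatedWittVector.coeff_zero p (r + 1) A 0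
    obtain ⟨v, hv⟩ := Z.xi_dvd_of_fontaineTheta_eq_zero hA hp fontaineTheta_eq_zero
    have w_eq : w = (phi p A)^[r + 1] v * Z.phiXi (r + 1) := by
      rw [phiXi, ← iterate_map_mul, mul_comm v, ← hv,
        Function.RightInverse.iterate (phi p A).apply_symm_apply]
    rw [w_eq, ← Z.V_thetaTilde hp, ← map_zero (W.V r)] at hw
    rw [w_eq, Z.xiTilde_succ]
    exact mul_dvd_mul_right (ih (W.V_injective r hw)) _

end Theta

/-! ### Classes in the cohomology of `K/a` -/

section Classes

variable {R : Type u} [CommRing R]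

/-- The elements of `K^n` whose image in `K^n/aK^n` is a cocycle, i.e. the representatives of the
classes in `H^n(K/a)`. -/
def cocyclesMod (a : R) (K : Cx R) (n : ℤ) : Submodule R (K.X n) :=
  ((modBy a K).cocycles n).comap (modBy.mk a K n)

/-- The map that sends a representative to its class in `H^n(K/a)`. -/
def classMod (a : R) (K : Cx R) (n : ℤ) : cocyclesMod a K n →ₗ[R] Hn (modBy a K) n :=
  (Submodule.mkQ _).comp ((modBy.mk a K n).restrict fun _ hx => hx)

variable {K L M : Cx R} {σ : R →+* R} {a b : R}

theorem mem_cocyclesMod {n m : ℤ} (h : n + 1 = m) {x : K.X n} :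
    x ∈ cocyclesMod a K n ↔ ∃ v, K.d n m h x = a • v := by
  rw [cocyclesMod, Submodule.mem_comap, Cx.mem_cocycles h, modBy.d_mk, modBy.mk_eq_zero]
  exact exists_congr fun v => eq_comm

theorem mem_cocyclesMod_of_d_eq_zero {n m : ℤ} (h : n + 1 = m) {x : K.X n}
    (hx : K.d n m h x = 0) : x ∈ cocyclesMod a K n :=
  (mem_cocyclesMod h).2 ⟨0, by rw [hx, smul_zero]⟩

theorem cocyclesMod_mono (h : a ∣ b) (n : ℤ) : cocyclesMod b K n ≤ cocyclesMod a K n := by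
  obtain ⟨c, rfl⟩ := h
  intro x hx
  obtain ⟨v, hv⟩ := (mem_cocyclesMod rfl).1 hx
  exact (mem_cocyclesMod rfl).2 ⟨c • v, by rw [hv, mul_smul]⟩

theorem classMod_surjective (a : R) (K : Cx R) (n : ℤ) : Function.Surjective (classMod a K n) := by
  intro c
  obtain ⟨⟨c, hc⟩, rfl⟩ := Hn.mk_surjective c
  obtain ⟨x, rfl⟩ := modBy.mk_surjective a K n c
  exact ⟨⟨x, hc⟩, rfl⟩

theorem classMod_eq_zero_iff {n m : ℤ} (h : m + 1 = n) {x : cocyclesMod a K n} :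
    classMod a K n x = 0 ↔ ∃ u w, (x : K.X n) = K.d m n h u + a • w := by
  refine (Hn.mk_eq_zero h _).trans ⟨?_, ?_⟩
  · rintro ⟨z, hz⟩
    obtain ⟨u, rfl⟩ := modBy.mk_surjective a K m z
    obtain ⟨w, hw⟩ := modBy.mk_eq_zero.1 ((map_sub (modBy.mk a K n) x.1 (K.d m n h u)).trans
      (sub_eq_zero.2 hz.symm))
    exact ⟨u, w, by rw [hw, add_sub_cancel]⟩
  · rintro ⟨u, w, hx⟩
    refine ⟨modBy.mk a K m u, (sub_eq_zero.1 ?_).symm⟩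
    exact (map_sub (modBy.mk a K n) x.1 (K.d m n h u)).symm.trans
      (modBy.mk_eq_zero.2 ⟨w, by rw [hx, add_sub_cancel_left]⟩)

theorem classMod_eq_iff {n m : ℤ} (h : m + 1 = n) {x y : cocyclesMod a K n} :
    classMod a K n x = classMod a K n y ↔ ∃ u w, (x - y : K.X n) = K.d m n h u + a • w := by
  rw [← sub_eq_zero, ← map_sub, classMod_eq_zero_iff h]
  rfl

theorem smul_Hn_modBy {n : ℤ} (c : Hn (modBy a K) n) : a • c = 0 := by
  obtain ⟨x, rfl⟩ := classMod_surjective a K n c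
  rw [← map_smul]
  exact (classMod_eq_zero_iff (sub_add_cancel n 1)).2 ⟨0, x, by rw [map_zero, zero_add]; rfl⟩

theorem SemiMap.mem_cocyclesMod (g : SemiMap σ K L) (h : ∀ i x, ∃ y, b • y = g.toFun i (a • x))
    {n : ℤ} {x : K.X n} (hx : x ∈ cocyclesMod a K n) : g.toFun n x ∈ cocyclesMod b L n := by
  obtain ⟨v, hv⟩ := (AInf.mem_cocyclesMod rfl).1 hx
  obtain ⟨w, hw⟩ := h (n + 1) v
  exact (AInf.mem_cocyclesMod rfl).2 ⟨w, by rw [g.comm, hv, hw]⟩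

theorem SemiMap.H_modBy_classMod (g : SemiMap σ K L)
    (h : ∀ i x, ∃ y, b • y = g.toFun i (a • x)) {n : ℤ} (x : cocyclesMod a K n) :
    (g.modBy a b h).H n (classMod a K n x) =
      classMod b L n ⟨g.toFun n x, g.mem_cocyclesMod h x.2⟩ := rfl

theorem Pairing.mem_cocyclesMod (m : Pairing K L M) {i j k : ℤ} (hk : i + j + 0 = k) {x : K.X i}
    {y : L.X j} (hx : x ∈ cocyclesMod a K i) (hy : y ∈ cocyclesMod a L j) :
    m.toFun i j k hk x y ∈ cocyclesMod a M k :=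
  ((m.modBy a).cocycle ((add_zero _).symm.trans hk) ⟨_, hx⟩ ⟨_, hy⟩).2

theorem classMod_eq_of_homotopic {g g' : ∀ i, K.X i → L.X i} (hg : Homotopic σ g g')
    (hab : b ∣ σ a) {n : ℤ} {x : K.X n} (hx : x ∈ cocyclesMod a K n)
    (hgx : g n x ∈ cocyclesMod b L n) (hgx' : g' n x ∈ cocyclesMod b L n) :
    classMod b L n ⟨g n x, hgx⟩ = classMod b L n ⟨g' n x, hgx'⟩ := by
  obtain ⟨s, hs⟩ := hg
  obtain ⟨v, hv⟩ := (mem_cocyclesMod rfl).1 hx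
  obtain ⟨c, hc⟩ := hab
  refine (classMod_eq_iff (sub_add_cancel n 1)).2
    ⟨s n (n - 1) (by omega) x, c • s (n + 1) n rfl v, ?_⟩
  rw [hs n (n - 1) (n + 1) (by omega) rfl, hv, LinearMap.map_smulₛₗ, hc, mul_smul]

theorem classMod_eq_of_biHomotopic {g g' : ∀ i j k, i + j + 0 = k → K.X i → L.X j → M.X k}
    (hg : BiHomotopic σ g g') (hab : b ∣ σ a) {i j k : ℤ} (hk : i + j + 0 = k)
    {x : K.X i} {y : L.X j} (hx : x ∈ cocyclesMod a K i) (hy : y ∈ cocyclesMod a L j)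
    (hgxy : g i j k hk x y ∈ cocyclesMod b M k) (hgxy' : g' i j k hk x y ∈ cocyclesMod b M k) :
    classMod b M k ⟨g i j k hk x y, hgxy⟩ = classMod b M k ⟨g' i j k hk x y, hgxy'⟩ := by
  obtain ⟨s, hs⟩ := hg
  obtain ⟨v, hv⟩ := (mem_cocyclesMod rfl).1 hx
  obtain ⟨w, hw⟩ := (mem_cocyclesMod rfl).1 hy
  obtain ⟨c, hc⟩ := hab
  refine (classMod_eq_iff (sub_add_cancel k 1)).2 ⟨s i j (k - 1) (by omega) x y,
    c • (s (i + 1) j k (by omega) v y + sgn i • s i (j + 1) k (by omega) x w), ?_⟩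
  rw [hs i j k (i + 1) (j + 1) (k - 1) hk (by omega) rfl rfl, hv, hw, LinearMap.map_smulₛₗ,
    LinearMap.map_smulₛₗ, hc, LinearMap.smul_apply]
  simp only [mul_smul, smul_add, smul_comm (sgn i) b, smul_comm (sgn i) c, add_assoc]

theorem classMod_eq_of_triHomotopic
    {g g' : ∀ i j k l, i + j + k = l → K.X i → K.X j → K.X k → K.X l}
    (hg : TriHomotopic g g') {i j k l : ℤ} (hl : i + j + k = l)
    {x : K.X i} {y : K.X j} {z : K.X k} (hx : x ∈ cocyclesMod a K i)
    (hy : y ∈ cocyclesMod a K j) (hz : z ∈ cocyclesMod a K k)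
    (hgxyz : g i j k l hl x y z ∈ cocyclesMod a K l)
    (hgxyz' : g' i j k l hl x y z ∈ cocyclesMod a K l) :
    classMod a K l ⟨g i j k l hl x y z, hgxyz⟩ = classMod a K l ⟨g' i j k l hl x y z, hgxyz'⟩ := by
  obtain ⟨s, hs⟩ := hg
  obtain ⟨v, hv⟩ := (mem_cocyclesMod rfl).1 hx
  obtain ⟨w, hw⟩ := (mem_cocyclesMod rfl).1 hy
  obtain ⟨t, ht⟩ := (mem_cocyclesMod rfl).1 hz
  refine (classMod_eq_iff (sub_add_cancel l 1)).2 ⟨s i j k (l - 1) (by omega) x y z,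
    s (i + 1) j k l (by omega) v y z + sgn i • s i (j + 1) k l (by omega) x w z +
      sgn (i + j) • s i j (k + 1) l (by omega) x y t, ?_⟩
  rw [hs i j k l (i + 1) (j + 1) (k + 1) (l - 1) hl (by omega) rfl rfl rfl, hv, hw, ht]
  simp only [map_smul, LinearMap.smul_apply, smul_add, smul_comm (sgn _) a, add_assoc]

/-! ### The Bockstein -/

section Bockstein

variable {n m : ℤ}

theorem exists_cocyclesMod_smul_eq_d (ha : ∀ i, IsSMulRegular (K.X i) a) (h : n + 1 = m)
    (x : cocyclesMod a K n) : ∃ v : cocyclesMod a K m, a • (v : K.X m) = K.d n m h x := by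
  obtain ⟨v, hv⟩ := (mem_cocyclesMod h).1 x.2
  refine ⟨⟨v, mem_cocyclesMod_of_d_eq_zero rfl (ha _ ?_)⟩, hv.symm⟩
  change a • _ = a • (0 : K.X (m + 1))
  rw [← map_smul, ← hv, K.d_d, smul_zero]

/-- The map `x ↦ dx/a` on representatives of classes in `H^n(K/a)`. -/
def divD (ha : ∀ i, IsSMulRegular (K.X i) a) (h : n + 1 = m) :
    cocyclesMod a K n →ₗ[R] cocyclesMod a K m where
  toFun x := (exists_cocyclesMod_smul_eq_d ha h x).choose
  map_add' x y := Subtype.ext (ha m (by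
    change a • _ = a • (_ + _)
    rw [smul_add, (exists_cocyclesMod_smul_eq_d ha h _).choose_spec,
      (exists_cocyclesMod_smul_eq_d ha h x).choose_spec,
      (exists_cocyclesMod_smul_eq_d ha h y).choose_spec, Submodule.coe_add, map_add]))
  map_smul' c x := Subtype.ext (ha m (by
    change a • _ = a • c • _
    rw [smul_comm a c, (exists_cocyclesMod_smul_eq_d ha h _).choose_spec,
      (exists_cocyclesMod_smul_eq_d ha h x).choose_spec, Submodule.coe_smul, map_smul]))

variable (ha : ∀ i, IsSMulRegular (K.X i) a) (h : n + 1 = m)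

theorem smul_divD (x : cocyclesMod a K n) : a • (divD ha h x : K.X m) = K.d n m h x :=
  (exists_cocyclesMod_smul_eq_d ha h x).choose_spec

theorem divD_eq {x : cocyclesMod a K n} {v : cocyclesMod a K m} (hv : K.d n m h x = a • v.1) :
    divD ha h x = v :=
  Subtype.ext (ha m ((smul_divD ha h x).trans hv))

theorem d_divD {k : ℤ} (hk : m + 1 = k) (x : cocyclesMod a K n) :
    K.d m k hk (divD ha h x) = 0 := by
  refine ha k ?_
  change a • _ = a • (0 : K.X k)
  rw [← map_smul, smul_divD, K.d_d, smul_zero]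

theorem classMod_divD_eq_zero {x : cocyclesMod a K n} (hx : classMod a K n x = 0) :
    classMod a K m (divD ha h x) = 0 := by
  obtain ⟨u, w, hx⟩ := (classMod_eq_zero_iff (sub_add_cancel n 1)).1 hx
  refine (classMod_eq_zero_iff h).2 ⟨w, 0, ha m ?_⟩
  change a • _ = a • (K.d n m h w + a • 0)
  rw [smul_divD, hx, map_add, K.d_d, zero_add, map_smul, smul_zero, add_zero]

/-- The Bockstein `H^n(K/a) → H^{n+1}(K/a)` of a complex `K` of `a`-torsion-free modules. -/
def bock : Hn (modBy a K) n →ₗ[R] Hn (modBy a K) m :=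
  ((LinearMap.ker (classMod a K n)).liftQ ((classMod a K m).comp (divD ha h))
    fun _ hx => classMod_divD_eq_zero ha h hx).comp
    ((classMod a K n).quotKerEquivOfSurjective (classMod_surjective a K n)).symm.toLinearMap

theorem bock_classMod (x : cocyclesMod a K n) :
    bock ha h (classMod a K n x) = classMod a K m (divD ha h x) := by
  have symm_classMod : ((classMod a K n).quotKerEquivOfSurjective
      (classMod_surjective a K n)).symm (classMod a K n x) = Submodule.Quotient.mk x :=
    (LinearEquiv.symm_apply_eq _).2 rfl
  rw [bock, LinearMap.comp_apply, LinearEquiv.coe_coe, symm_classMod]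
  rfl

theorem isBockstein_bock : IsBockstein a K n m h (bock ha h) := by
  rintro x z ⟨c, hc⟩ ⟨c', hc'⟩ rfl rfl hxz
  refine (bock_classMod ha h ⟨x, hc⟩).trans ?_
  rw [divD_eq ha h (x := ⟨x, hc⟩) (v := ⟨z, hc'⟩) hxz]
  rfl

theorem IsBockstein.eq_bock {δ : Hn (modBy a K) n → Hn (modBy a K) m}
    (hδ : IsBockstein a K n m h δ) (c : Hn (modBy a K) n) : δ c = bock ha h c := by
  obtain ⟨x, rfl⟩ := classMod_surjective a K n c
  rw [bock_classMod]
  exact hδ x (divD ha h x) ⟨_, x.2⟩ ⟨_, (divD ha h x).2⟩ rfl rfl (smul_divD ha h x).symm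

end Bockstein

/-! ### The map `H^n(η_f K/a) → H^n(K/a)` -/

section Eta

variable {f : R}

/-- The map `η_f K → K[1/f]`, divided by `f ^ i` in degree `i`. -/
def etaFst (f : R) (K : Cx R) (i : ℤ) : (eta f K).X i →ₗ[R] K.X i :=
  (LinearMap.fst R _ _).comp (Submodule.subtype (etaTerm f K i))

theorem d_etaFst {i j : ℤ} (h : i + 1 = j) (w : (eta f K).X i) :
    K.d i j h (etaFst f K i w) = f • etaFst f K j ((eta f K).d i j h w) := by
  subst h
  exact (show etaTerm f K i from w).2.1

theorem etaFst_injective (hf : ∀ i, IsSMulRegular (K.X i) f) (i : ℤ) :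
    Function.Injective (etaFst f K i) := by
  rintro ⟨⟨y, z⟩, hyz, _⟩ ⟨⟨y', z'⟩, hyz', _⟩ rfl
  exact Subtype.ext (Prod.ext rfl (hf _ (hyz.symm.trans hyz')))

theorem exists_etaFst_eq (hf : ∀ i, IsSMulRegular (K.X i) f) {i j : ℤ} (h : i + 1 = j)
    {y : K.X i} {z : K.X j} (hz : K.d i j h y = f • z) : ∃ w, etaFst f K i w = y := by
  subst h
  refine ⟨⟨(y, z), hz, hf _ ?_⟩, rfl⟩
  change f • _ = f • (0 : K.X _)
  rw [← map_smul, ← hz, K.d_d, smul_zero]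

theorem eta_isSMulRegular (ha : ∀ i, IsSMulRegular (K.X i) a) (i : ℤ) :
    IsSMulRegular ((eta f K).X i) a :=
  fun _ _ h => Subtype.ext (Prod.ext (ha i (congrArg (fun w => w.1.1) h))
    (ha (i + 1) (congrArg (fun w => w.1.2) h)))

theorem etaFst_mem_cocyclesMod {i : ℤ} {w : (eta f K).X i} (hw : w ∈ cocyclesMod a (eta f K) i) :
    etaFst f K i w ∈ cocyclesMod (f * a) K i := by
  obtain ⟨v, hv⟩ := (mem_cocyclesMod rfl).1 hw
  exact (mem_cocyclesMod rfl).2 ⟨etaFst f K (i + 1) v, by rw [d_etaFst, hv, map_smul, mul_smul]⟩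

theorem exists_etaFst_eq_of_mem_cocyclesMod (hf : ∀ i, IsSMulRegular (K.X i) f)
    (ha : ∀ i, IsSMulRegular (K.X i) a) {i : ℤ} {y : K.X i}
    (hy : y ∈ cocyclesMod (f * a) K i) : ∃ w ∈ cocyclesMod a (eta f K) i, etaFst f K i w = y := by
  obtain ⟨v, hv⟩ := (mem_cocyclesMod rfl).1 hy
  obtain ⟨w, rfl⟩ := exists_etaFst_eq hf rfl (hv.trans (mul_smul _ _ _))
  have d_v : K.d (i + 1) (i + 1 + 1) rfl v = 0 := by
    refine (hf _).mul (ha _) ?_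
    change (f * a) • _ = (f * a) • (0 : K.X _)
    rw [← map_smul, ← hv, K.d_d, smul_zero]
  obtain ⟨v, rfl⟩ := exists_etaFst_eq hf rfl (d_v.trans (smul_zero f).symm)
  refine ⟨w, (mem_cocyclesMod rfl).2 ⟨v, etaFst_injective hf _ (hf _ ?_)⟩, rfl⟩
  change f • _ = f • _
  rw [← d_etaFst, hv, map_smul, mul_smul]

theorem exists_d_eq_smul_etaFst_sub {n m : ℤ} (h : m + 1 = n) {x y : (eta f K).cocycles n}
    (hxy : Hn.mk x = Hn.mk y) :
    ∃ u, K.d m n h u = f • (etaFst f K n x - etaFst f K n y) := by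
  obtain ⟨z, hz⟩ := (Hn.mk_eq_iff h x y).1 hxy
  exact ⟨etaFst f K m z, by rw [d_etaFst, hz, map_sub]⟩

variable (hK : ∀ c : Hn K 0, f • c = 0 → c = 0)

theorem canMap_classMod (n : ℕ) (w : cocyclesMod a (eta f K) n) :
    canMap f a K hK n (classMod a (eta f K) n w) = f ^ n • classMod a K n
      ⟨etaFst f K n w, cocyclesMod_mono (dvd_mul_left a f) n (etaFst_mem_cocyclesMod w.2)⟩ := rfl

theorem mem_range_canMap_iff (hf : ∀ i, IsSMulRegular (K.X i) f)
    (ha : ∀ i, IsSMulRegular (K.X i) a) (n : ℕ) {c : Hn (modBy a K) n} :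
    c ∈ LinearMap.range (canMap f a K hK n) ↔ ∃ y : cocyclesMod (f * a) K n,
      c = f ^ n • classMod a K n ⟨y, cocyclesMod_mono (dvd_mul_left a f) n y.2⟩ := by
  constructor
  · rintro ⟨x, rfl⟩
    obtain ⟨w, rfl⟩ := classMod_surjective a (eta f K) n x
    exact ⟨⟨_, etaFst_mem_cocyclesMod w.2⟩, canMap_classMod hK n w⟩
  · rintro ⟨⟨y, hy⟩, rfl⟩
    obtain ⟨w, hw, rfl⟩ := exists_etaFst_eq_of_mem_cocyclesMod hf ha hy
    exact ⟨classMod a (eta f K) n ⟨w, hw⟩, canMap_classMod hK n ⟨w, hw⟩⟩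

theorem canMap_bock (ha : ∀ i, IsSMulRegular (K.X i) a) {n m : ℕ} (h : (n : ℤ) + 1 = m)
    (x : Hn (modBy a (eta f K)) n) :
    canMap f a K hK m (bock (eta_isSMulRegular ha) h x) = bock ha h (canMap f a K hK n x) := by
  obtain ⟨w, rfl⟩ := classMod_surjective a (eta f K) n x
  let v := divD (eta_isSMulRegular ha) h w
  have etaFst_mem {i : ℤ} (w : cocyclesMod a (eta f K) i) : etaFst f K i w ∈ cocyclesMod a K i :=
    cocyclesMod_mono (dvd_mul_left a f) i (etaFst_mem_cocyclesMod w.2)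
  have divD_etaFst :
      divD ha h ⟨etaFst f K n w, etaFst_mem w⟩ = f • ⟨etaFst f K m v, etaFst_mem v⟩ := by
    refine divD_eq ha h ?_
    change K.d n m h (etaFst f K n w) = a • f • _
    rw [d_etaFst, ← smul_divD (eta_isSMulRegular ha), map_smul, smul_comm]
  have pow_eq : f ^ m = f ^ n * f := by rw [← pow_succ, show m = n + 1 by omega]
  rw [bock_classMod, canMap_classMod, canMap_classMod, map_smul, bock_classMod, divD_etaFst,
    map_smul, smul_smul, ← pow_eq]

theorem pow_smul_eq_zero_of_canMap_eq_zero (hf : ∀ i, IsSMulRegular (K.X i) f)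
    (ha : ∀ i, IsSMulRegular (K.X i) a) {n : ℕ} {x : Hn (modBy a (eta f K)) n}
    (hx : canMap f a K hK n x = 0) : f ^ n • x = 0 := by
  obtain ⟨w, rfl⟩ := classMod_surjective a (eta f K) n x
  rw [canMap_classMod, ← map_smul] at hx
  obtain ⟨u, t, hut⟩ := (classMod_eq_zero_iff (sub_add_cancel (n : ℤ) 1)).1 hx
  have w_eq : f ^ n • etaFst f K n w = K.d _ n (sub_add_cancel (n : ℤ) 1) u + a • t := hut
  obtain ⟨v, hv⟩ := (mem_cocyclesMod rfl).1 w.2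
  have d_t : K.d n (n + 1) rfl t = f • f ^ n • etaFst f K (n + 1) v := by
    refine ha _ ?_
    change a • _ = a • _
    calc a • K.d n (n + 1) rfl t
        = K.d n (n + 1) rfl (f ^ n • etaFst f K n w) := by
          rw [w_eq, map_add, K.d_d, zero_add, map_smul]
      _ = a • f • f ^ n • etaFst f K (n + 1) v := by
          rw [map_smul, d_etaFst, hv, map_smul, smul_comm a f, smul_comm a, smul_comm (f ^ n) f]
  obtain ⟨t, rfl⟩ := exists_etaFst_eq hf rfl d_t
  obtain ⟨u', hu'⟩ := exists_etaFst_eq hf (sub_add_cancel (n : ℤ) 1) (map_smul (K.d _ n _) f u)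
  rw [← map_smul]
  refine (classMod_eq_zero_iff (sub_add_cancel (n : ℤ) 1)).2
    ⟨u', t, etaFst_injective hf _ (hf _ ?_)⟩
  change f • etaFst f K n (f ^ n • w.1) = f • etaFst f K n _
  rw [map_smul, w_eq, map_add, map_smul, smul_add, smul_add, ← d_etaFst, hu', map_smul]

theorem canMap_injective (hf : ∀ i, IsSMulRegular (K.X i) f) (ha : ∀ i, IsSMulRegular (K.X i) a)
    {n : ℕ} (hreg : IsSMulRegular (Hn (modBy a (eta f K)) n) f) :
    Function.Injective (canMap f a K hK n) :=
  (injective_iff_map_eq_zero _).2 fun _ hx =>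
    (hreg.pow n).right_eq_zero_of_smul (pow_smul_eq_zero_of_canMap_eq_zero hK hf ha hx)

theorem exists_smul_canMap_eq_smul (hs : Function.Surjective ((baseChange f a K).H 0))
    (c : Hn (modBy a K) 0) : ∃ x, f • canMap f a K hK 0 x = f • c := by
  obtain ⟨x, rfl⟩ := classMod_surjective a K 0 c
  have d_x : (modBy a K).d 0 (0 + 1) rfl (modBy.mk a K 0 x) = 0 := (Cx.mem_cocycles rfl).1 x.2
  let e : (eta f (modBy a K)).cocycles 0 :=
    ⟨⟨(modBy.mk a K 0 x, 0), d_x.trans (smul_zero f).symm, map_zero _⟩, (Cx.mem_cocycles rfl).2 rfl⟩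
  obtain ⟨t, ht⟩ := hs (Hn.mk e)
  obtain ⟨w, rfl⟩ := classMod_surjective a (eta f K) 0 t
  obtain ⟨u, hu⟩ := exists_d_eq_smul_etaFst_sub (sub_add_cancel (0 : ℤ) 1) ht
  obtain ⟨u, rfl⟩ := modBy.mk_surjective a K _ u
  obtain ⟨y, hy⟩ : ∃ y, a • y = f • (etaFst f K 0 w - x) - K.d _ 0 (sub_add_cancel 0 1) u :=
    modBy.mk_eq_zero.1 ((map_sub (modBy.mk a K 0) _ _).trans (sub_eq_zero.2 hu.symm))
  refine ⟨classMod a (eta f K) 0 w, ?_⟩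
  refine (congrArg (f • ·) ((canMap_classMod hK 0 w).trans (by rw [pow_zero, one_smul]))).trans ?_
  rw [← map_smul, ← map_smul]
  refine (classMod_eq_iff (sub_add_cancel 0 1)).2 ⟨u, y, ?_⟩
  rw [hy, add_sub_cancel, smul_sub]
  rfl

end Eta

end Classes

/-! ### The algebra `H^*(D/a)` -/

section Algebra

variable {R : Type u} [CommRing R] {K L : Cx R} {D D' : DAlg R} {σ : R →+* R} {a b c : R}
  {i j k : ℤ}

theorem sgn_natCast (n : ℕ) : sgn (n : ℤ) = (-1) ^ n := by
  rw [sgn, Int.negOnePow_def, zpow_natCast, Units.val_pow_eq_pow_val, Units.val_neg, Units.val_one]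

/-- The projection `H^n(K/a) → H^n(K/b)` for `b ∣ a`. -/
def projMod (h : b ∣ a) (K : Cx R) (n : ℤ) : Hn (modBy a K) n →ₗ[R] Hn (modBy b K) n :=
  ((SemiMap.scalar 1 K).modBy a b fun i x => by
    obtain ⟨c, rfl⟩ := h
    exact ⟨c • x, (mul_smul b c x).symm.trans (one_smul R _).symm⟩).H n

theorem projMod_classMod (h : b ∣ a) {n : ℤ} (x : cocyclesMod a K n) :
    projMod h K n (classMod a K n x) = classMod b K n ⟨x, cocyclesMod_mono h n x.2⟩ :=
  ((SemiMap.scalar 1 K).H_modBy_classMod _ x).trans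
    (congrArg (classMod b K n) (Subtype.ext (one_smul R x.1)))

theorem bock_H_modBy (ha : ∀ i, IsSMulRegular (K.X i) a) (hb : ∀ i, IsSMulRegular (L.X i) b)
    (g : SemiMap σ K L) (hg : ∀ i x, ∃ y, b • y = g.toFun i (a • x)) (hσ : σ a = b * c) {n m : ℤ}
    (h : n + 1 = m) (x : Hn (modBy a K) n) :
    bock hb h ((g.modBy a b hg).H n x) = c • (g.modBy a b hg).H m (bock ha h x) := by
  obtain ⟨x, rfl⟩ := classMod_surjective a K n x
  rw [bock_classMod, g.H_modBy_classMod, g.H_modBy_classMod, bock_classMod, ← map_smul]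
  refine congrArg _ (divD_eq hb h ?_)
  change L.d n m h (g.toFun n x) = b • c • g.toFun m _
  rw [g.comm, ← smul_divD ha, LinearMap.map_smulₛₗ, hσ, mul_smul]

theorem bock_bock (ha : ∀ i, IsSMulRegular (K.X i) a) {n m l : ℤ} (h : n + 1 = m) (h' : m + 1 = l)
    (x : Hn (modBy a K) n) : bock ha h' (bock ha h x) = 0 := by
  obtain ⟨x, rfl⟩ := classMod_surjective a K n x
  rw [bock_classMod, bock_classMod, divD_eq ha h' (v := 0) ?_, map_zero]
  exact (d_divD ha h h' x).trans (smul_zero a).symm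

theorem DAlg.oneMod_eq_classMod (D : DAlg R) (a : R) : D.oneMod a = classMod a D.cx 0
    ⟨D.one.1, mem_cocyclesMod_of_d_eq_zero rfl ((Cx.mem_cocycles rfl).1 D.one.2)⟩ := rfl

theorem DAlg.mulMod_classMod (D : DAlg R) (h : i + j = k) (x : cocyclesMod a D.cx i)
    (y : cocyclesMod a D.cx j) :
    D.mulMod a i j k h (classMod a D.cx i x) (classMod a D.cx j y) = classMod a D.cx k
      ⟨D.mul.toFun i j k ((add_zero _).trans h) x y, D.mul.mem_cocyclesMod _ x.2 y.2⟩ := rfl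

/-- The product of `H^*(D/a)` as a bilinear map. -/
def DAlg.mulModHom (D : DAlg R) (a : R) (h : i + j = k) :
    Hn (AInf.modBy a D.cx) i →ₗ[R] Hn (AInf.modBy a D.cx) j →ₗ[R] Hn (AInf.modBy a D.cx) k :=
  LinearMap.mk₂ R (D.mulMod a i j k h)
    (fun c c' e => by
      obtain ⟨x, rfl⟩ := classMod_surjective a D.cx i c
      obtain ⟨x', rfl⟩ := classMod_surjective a D.cx i c'
      obtain ⟨y, rfl⟩ := classMod_surjective a D.cx j e
      rw [← map_add, D.mulMod_classMod, D.mulMod_classMod, D.mulMod_classMod, ← map_add]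
      exact congrArg _ (Subtype.ext (LinearMap.map_add₂ _ x.1 x'.1 y.1)))
    (fun r c e => by
      obtain ⟨x, rfl⟩ := classMod_surjective a D.cx i c
      obtain ⟨y, rfl⟩ := classMod_surjective a D.cx j e
      rw [← map_smul, D.mulMod_classMod, D.mulMod_classMod, ← map_smul]
      exact congrArg _ (Subtype.ext (LinearMap.map_smul₂ _ r x.1 y.1)))
    (fun c e e' => by
      obtain ⟨x, rfl⟩ := classMod_surjective a D.cx i c
      obtain ⟨y, rfl⟩ := classMod_surjective a D.cx j e
      obtain ⟨y', rfl⟩ := classMod_surjective a D.cx j e'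
      rw [← map_add, D.mulMod_classMod, D.mulMod_classMod, D.mulMod_classMod, ← map_add]
      exact congrArg _ (Subtype.ext (map_add _ y.1 y'.1)))
    (fun r c e => by
      obtain ⟨x, rfl⟩ := classMod_surjective a D.cx i c
      obtain ⟨y, rfl⟩ := classMod_surjective a D.cx j e
      rw [← map_smul, D.mulMod_classMod, D.mulMod_classMod, ← map_smul]
      exact congrArg _ (Subtype.ext (map_smul _ r y.1)))

theorem DAlg.mulModHom_apply (D : DAlg R) (h : i + j = k) (c : Hn (AInf.modBy a D.cx) i)
    (e : Hn (AInf.modBy a D.cx) j) : D.mulModHom a h c e = D.mulMod a i j k h c e := rfl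

theorem DAlg.mulMod_smul_smul (D : DAlg R) (h : i + j = k) (r s : R)
    (c : Hn (AInf.modBy a D.cx) i) (e : Hn (AInf.modBy a D.cx) j) :
    D.mulMod a i j k h (r • c) (s • e) = (r * s) • D.mulMod a i j k h c e :=
  (LinearMap.map_smul₂ (D.mulModHom a h) r c (s • e)).trans
    ((congrArg (r • ·) (map_smul (D.mulModHom a h c) s e)).trans (mul_smul r s _).symm)

theorem DAlg.oneMod_mulMod {n : ℤ} (h : 0 + n = n) (c : Hn (AInf.modBy a D.cx) n) :
    D.mulMod a 0 n n h (D.oneMod a) c = c := by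
  obtain ⟨x, rfl⟩ := classMod_surjective a D.cx n c
  rw [D.oneMod_eq_classMod, D.mulMod_classMod]
  exact classMod_eq_of_homotopic D.one_mul dvd_rfl x.2 _ x.2

theorem DAlg.mulMod_comm (h : i + j = k) (h' : j + i = k) (c : Hn (AInf.modBy a D.cx) i)
    (e : Hn (AInf.modBy a D.cx) j) :
    D.mulMod a i j k h c e = sgn (i * j) • D.mulMod a j i k h' e c := by
  obtain ⟨x, rfl⟩ := classMod_surjective a D.cx i c
  obtain ⟨y, rfl⟩ := classMod_surjective a D.cx j e
  rw [D.mulMod_classMod, D.mulMod_classMod, ← map_zsmul]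
  exact classMod_eq_of_biHomotopic D.mul_comm dvd_rfl _ x.2 y.2 _
    (zsmul_mem (D.mul.mem_cocyclesMod _ y.2 x.2) _)

theorem DAlg.mulMod_assoc {l m n : ℤ} (h : i + j = k) (h' : j + l = m) (hn : k + l = n)
    (hn' : i + m = n) (c : Hn (AInf.modBy a D.cx) i) (e : Hn (AInf.modBy a D.cx) j)
    (t : Hn (AInf.modBy a D.cx) l) :
    D.mulMod a k l n hn (D.mulMod a i j k h c e) t =
      D.mulMod a i m n hn' c (D.mulMod a j l m h' e t) := by
  subst h h'
  obtain ⟨x, rfl⟩ := classMod_surjective a D.cx i c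
  obtain ⟨y, rfl⟩ := classMod_surjective a D.cx j e
  obtain ⟨z, rfl⟩ := classMod_surjective a D.cx l t
  simp only [D.mulMod_classMod]
  exact classMod_eq_of_triHomotopic D.mul_assoc hn x.2 y.2 z.2 _ _

theorem bock_mulMod (ha : ∀ i, IsSMulRegular (D.cx.X i) a) {i' j' k' : ℤ} (h : i + j = k)
    (hi : i + 1 = i') (hj : j + 1 = j') (hk : k + 1 = k') (h₁ : i' + j = k') (h₂ : i + j' = k')
    (c : Hn (modBy a D.cx) i) (e : Hn (modBy a D.cx) j) :
    bock ha hk (D.mulMod a i j k h c e) =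
      D.mulMod a i' j k' h₁ (bock ha hi c) e + sgn i • D.mulMod a i j' k' h₂ c (bock ha hj e) := by
  obtain ⟨x, rfl⟩ := classMod_surjective a D.cx i c
  obtain ⟨y, rfl⟩ := classMod_surjective a D.cx j e
  rw [D.mulMod_classMod, bock_classMod, bock_classMod, bock_classMod, D.mulMod_classMod,
    D.mulMod_classMod, ← map_zsmul, ← map_add]
  refine congrArg _ (divD_eq ha hk ?_)
  rw [D.mul.leibniz i j k i' j' k' _ hk hi hj, ← smul_divD ha hi, ← smul_divD ha hj, map_smul,
    map_smul, LinearMap.smul_apply, smul_comm (sgn i) a, ← smul_add]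
  rfl

theorem SemiMap.IsAlgMap.H_modBy_mulMod {g : SemiMap σ D.cx D'.cx} (hg : g.IsAlgMap)
    (hσ : b ∣ σ a) (hgab : ∀ i x, ∃ y, b • y = g.toFun i (a • x)) (h : i + j = k)
    (c : Hn (AInf.modBy a D.cx) i) (e : Hn (AInf.modBy a D.cx) j) :
    (g.modBy a b hgab).H k (D.mulMod a i j k h c e) =
      D'.mulMod b i j k h ((g.modBy a b hgab).H i c) ((g.modBy a b hgab).H j e) := by
  obtain ⟨x, rfl⟩ := classMod_surjective a D.cx i c
  obtain ⟨y, rfl⟩ := classMod_surjective a D.cx j e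
  rw [D.mulMod_classMod, g.H_modBy_classMod, g.H_modBy_classMod, g.H_modBy_classMod,
    D'.mulMod_classMod]
  exact classMod_eq_of_biHomotopic hg.mul hσ _ x.2 y.2 _ _

theorem SemiMap.IsAlgMap.H_modBy_oneMod {g : SemiMap σ D.cx D'.cx} (hg : g.IsAlgMap)
    (hgab : ∀ i x, ∃ y, b • y = g.toFun i (a • x)) :
    (g.modBy a b hgab).H 0 (D.oneMod a) = D'.oneMod b := by
  rw [D.oneMod_eq_classMod, D'.oneMod_eq_classMod, g.H_modBy_classMod,
    classMod_eq_iff (sub_add_cancel (0 : ℤ) 1)]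
  obtain ⟨u, hu⟩ := (Cx.mem_coboundaries (sub_add_cancel (0 : ℤ) 1)).1 hg.one
  exact ⟨u, 0, by rw [smul_zero, add_zero, hu]⟩

theorem projMod_mulMod (hba : b ∣ a) (h : i + j = k) (c : Hn (modBy a D.cx) i)
    (e : Hn (modBy a D.cx) j) :
    projMod hba D.cx k (D.mulMod a i j k h c e) =
      D.mulMod b i j k h (projMod hba D.cx i c) (projMod hba D.cx j e) := by
  obtain ⟨x, rfl⟩ := classMod_surjective a D.cx i c
  obtain ⟨y, rfl⟩ := classMod_surjective a D.cx j e
  rw [D.mulMod_classMod, projMod_classMod, projMod_classMod, projMod_classMod, D.mulMod_classMod]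

theorem projMod_oneMod (hba : b ∣ a) : projMod hba D.cx 0 (D.oneMod a) = D.oneMod b := by
  rw [D.oneMod_eq_classMod, D.oneMod_eq_classMod, projMod_classMod]

theorem DAlg.isSMulRegular (D : DAlg R) (ha : a ∈ nonZeroDivisors R) (i : ℤ) :
    IsSMulRegular (D.cx.X i) a := by
  have : Module.Projective R (D.cx.X i) := D.projective i
  exact Module.Flat.isSMulRegular_of_nonZeroDivisors ha

end Algebra

/-! ### The operators on `H^*(D/ξ̃_r)` -/

section Pre

variable {p : ℕ} [Fact p.Prime] {A : Type u} [CommRing A] [Fact (¬ IsUnit (p : A))]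
  {Z : RootSystem p A} {D D' : FrobAlg p A} {r : ℕ} {i j k n : ℤ}

theorem RootSystem.phi_xiTilde_mul_xi (Z : RootSystem p A) (r : ℕ) :
    phi p A (Z.xiTilde r * Z.xi) = Z.xiTilde (r + 1) := by
  rw [← Z.phi_symm_xiTilde_succ, RingEquiv.apply_symm_apply]

theorem RootSystem.phi_symm_phiXi_succ (Z : RootSystem p A) (i : ℕ) :
    (phi p A).symm (Z.phiXi (i + 1)) = Z.phiXi i := by
  rw [phiXi, Function.iterate_succ_apply', RingEquiv.symm_apply_apply, phiXi]

theorem RootSystem.xiTilde_dvd_xiTilde_succ (Z : RootSystem p A) (r : ℕ) :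
    Z.xiTilde r ∣ Z.xiTilde (r + 1) :=
  Dvd.intro _ (Z.xiTilde_succ r).symm

/-- The bijection `H^n(D/ξ̃_rξ) → H^n(D/ξ̃_{r+1})` induced by `φ_D`. -/
def FrobAlg.frobMod (D : FrobAlg p A) (Z : RootSystem p A) (r : ℕ) (n : ℤ) :
    Hn (modBy (Z.xiTilde r * Z.xi) D.cx) n →ₛₗ[(phi p A : Ainf p A →+* Ainf p A)]
      D.Pre Z (r + 1) n :=
  (D.frob.modBy (Z.xiTilde r * Z.xi) (Z.xiTilde (r + 1)) fun i x => ⟨D.frob.toFun i x, by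
    rw [LinearMap.map_smulₛₗ, ← Z.phi_xiTilde_mul_xi]; rfl⟩).H n

theorem FrobAlg.frobMod_surjective : Function.Surjective (D.frobMod Z r n) := by
  intro c
  obtain ⟨x, rfl⟩ := classMod_surjective _ D.cx n c
  have h_inv (i : ℤ) (x : D.cx.X i) : ∃ y,
      (Z.xiTilde r * Z.xi) • y = D.frobInv.toFun i (Z.xiTilde (r + 1) • x) :=
    ⟨D.frobInv.toFun i x, by rw [LinearMap.map_smulₛₗ, ← Z.phi_symm_xiTilde_succ]; rfl⟩
  refine ⟨classMod _ D.cx n ⟨D.frobInv.toFun n x, D.frobInv.mem_cocyclesMod h_inv x.2⟩, ?_⟩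
  rw [frobMod, SemiMap.H_modBy_classMod]
  exact classMod_eq_of_homotopic D.frob_frobInv dvd_rfl x.2 _ x.2

theorem FrobAlg.preR_frobMod (c : Hn (modBy (Z.xiTilde r * Z.xi) D.cx) n) :
    D.preR Z r n (D.frobMod Z r n c) = projMod (dvd_mul_right _ _) D.cx n c := by
  obtain ⟨x, rfl⟩ := classMod_surjective _ D.cx n c
  rw [frobMod, SemiMap.H_modBy_classMod, preR, SemiMap.H_modBy_classMod, projMod_classMod]
  exact classMod_eq_of_homotopic D.frobInv_frob (dvd_mul_right _ _) x.2 _ _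

theorem FrobAlg.frobMod_mulMod (h : i + j = k) (c : Hn (modBy (Z.xiTilde r * Z.xi) D.cx) i)
    (e : Hn (modBy (Z.xiTilde r * Z.xi) D.cx) j) :
    D.frobMod Z r k (D.mulMod _ i j k h c e) =
      D.mulMod _ i j k h (D.frobMod Z r i c) (D.frobMod Z r j e) :=
  D.frob_isAlgMap.H_modBy_mulMod (dvd_of_eq (Z.phi_xiTilde_mul_xi r).symm) _ h c e

theorem FrobAlg.frobMod_oneMod : D.frobMod Z r 0 (D.oneMod _) = D.oneMod _ :=
  D.frob_isAlgMap.H_modBy_oneMod _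

theorem FrobAlg.preR_mulMod (h : i + j = k) (c : D.Pre Z (r + 1) i) (e : D.Pre Z (r + 1) j) :
    D.preR Z r k (D.mulMod _ i j k h c e) =
      D.mulMod _ i j k h (D.preR Z r i c) (D.preR Z r j e) := by
  obtain ⟨c, rfl⟩ := FrobAlg.frobMod_surjective c
  obtain ⟨e, rfl⟩ := FrobAlg.frobMod_surjective e
  rw [← frobMod_mulMod, preR_frobMod, preR_frobMod, preR_frobMod, projMod_mulMod]

theorem FrobAlg.preR_oneMod : D.preR Z r 0 (D.oneMod _) = D.oneMod _ := by
  rw [← frobMod_oneMod, preR_frobMod, projMod_oneMod]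

theorem FrobAlg.preF_eq_projMod :
    D.preF Z r n = projMod (Z.xiTilde_dvd_xiTilde_succ r) D.cx n := rfl

theorem FrobAlg.preF_mulMod (h : i + j = k) (c : D.Pre Z (r + 1) i) (e : D.Pre Z (r + 1) j) :
    D.preF Z r k (D.mulMod _ i j k h c e) =
      D.mulMod _ i j k h (D.preF Z r i c) (D.preF Z r j e) :=
  projMod_mulMod (Z.xiTilde_dvd_xiTilde_succ r) h c e

theorem FrobAlg.preF_oneMod : D.preF Z r 0 (D.oneMod _) = D.oneMod _ :=
  projMod_oneMod (Z.xiTilde_dvd_xiTilde_succ r)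

theorem FrobAlg.preV_mulMod (h : i + j = k) (c : D.Pre Z (r + 1) i) (e : D.Pre Z r j) :
    D.preV Z r k (D.mulMod _ i j k h (D.preF Z r i c) e) =
      D.mulMod _ i j k h c (D.preV Z r j e) := by
  obtain ⟨x, rfl⟩ := classMod_surjective _ D.cx i c
  obtain ⟨y, rfl⟩ := classMod_surjective _ D.cx j e
  rw [preF_eq_projMod, projMod_classMod, D.mulMod_classMod, preV, SemiMap.H_modBy_classMod,
    preV, SemiMap.H_modBy_classMod, D.mulMod_classMod]
  exact congrArg _ (Subtype.ext (map_smul _ _ _).symm)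

theorem FrobAlg.preR_preF (c : D.Pre Z (r + 2) n) :
    D.preR Z r n (D.preF Z (r + 1) n c) = D.preF Z r n (D.preR Z (r + 1) n c) := by
  obtain ⟨x, rfl⟩ := classMod_surjective _ D.cx n c
  rw [preF_eq_projMod, projMod_classMod, preR, SemiMap.H_modBy_classMod, preR,
    SemiMap.H_modBy_classMod, preF_eq_projMod, projMod_classMod]

theorem FrobAlg.preR_preV (c : D.Pre Z (r + 1) n) :
    D.preR Z (r + 1) n (D.preV Z (r + 1) n c) = D.preV Z r n (D.preR Z r n c) := by
  obtain ⟨x, rfl⟩ := classMod_surjective _ D.cx n c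
  rw [preV, SemiMap.H_modBy_classMod, preR, SemiMap.H_modBy_classMod, preR,
    SemiMap.H_modBy_classMod, preV, SemiMap.H_modBy_classMod]
  refine congrArg _ (Subtype.ext ((LinearMap.map_smulₛₗ _ _ _).trans ?_))
  exact congrArg (· • _) (Z.phi_symm_phiXi_succ (r + 1))

theorem FrobAlg.preF_preV_eq_phiXi_smul (c : D.Pre Z r n) :
    D.preF Z r n (D.preV Z r n c) = Z.phiXi (r + 1) • c := by
  obtain ⟨x, rfl⟩ := classMod_surjective _ D.cx n c
  rw [preV, SemiMap.H_modBy_classMod, preF_eq_projMod, projMod_classMod, ← map_smul]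
  rfl

theorem FrobAlg.preF_preV (c : D.Pre Z r n) : D.preF Z r n (D.preV Z r n c) = p • c := by
  obtain ⟨w, hw⟩ := Z.mu_mul_xiTilde_dvd_phiXi_sub r
  rw [preF_preV_eq_phiXi_smul, sub_eq_iff_eq_add.1 hw, add_smul, mul_comm Z.mu, mul_assoc, mul_smul,
    smul_Hn_modBy, zero_add, Nat.cast_smul_eq_nsmul]

section Functoriality

variable (f : FrobAlg.Hom D D')

theorem FrobAlg.Hom.pre_mulMod (h : i + j = k) (c : D.Pre Z r i) (e : D.Pre Z r j) :
    f.pre Z r k (D.mulMod _ i j k h c e) = D'.mulMod _ i j k h (f.pre Z r i c) (f.pre Z r j e) :=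
  f.isAlgMap.H_modBy_mulMod dvd_rfl _ h c e

theorem FrobAlg.Hom.pre_oneMod : f.pre Z r 0 (D.oneMod _) = D'.oneMod _ :=
  f.isAlgMap.H_modBy_oneMod _

theorem FrobAlg.Hom.pre_preF (c : D.Pre Z (r + 1) n) :
    f.pre Z r n (D.preF Z r n c) = D'.preF Z r n (f.pre Z (r + 1) n c) := by
  obtain ⟨x, rfl⟩ := classMod_surjective _ D.cx n c
  rw [preF_eq_projMod, projMod_classMod, pre, SemiMap.H_modBy_classMod, pre,
    SemiMap.H_modBy_classMod, preF_eq_projMod, projMod_classMod]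

theorem FrobAlg.Hom.pre_preV (c : D.Pre Z r n) :
    f.pre Z (r + 1) n (D.preV Z r n c) = D'.preV Z r n (f.pre Z r n c) := by
  obtain ⟨x, rfl⟩ := classMod_surjective _ D.cx n c
  rw [preV, SemiMap.H_modBy_classMod, pre, SemiMap.H_modBy_classMod, pre,
    SemiMap.H_modBy_classMod, preV, SemiMap.H_modBy_classMod]
  exact congrArg _ (Subtype.ext (map_smul _ _ _))

theorem FrobAlg.Hom.pre_preR (c : D.Pre Z (r + 1) n) :
    f.pre Z r n (D.preR Z r n c) = D'.preR Z r n (f.pre Z (r + 1) n c) := by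
  obtain ⟨c, rfl⟩ := FrobAlg.frobMod_surjective c
  obtain ⟨x, rfl⟩ := classMod_surjective _ D.cx n c
  have hfx : f.map.toFun n x ∈ cocyclesMod (Z.xiTilde r * Z.xi) D'.cx n :=
    f.map.mem_cocyclesMod (fun i y => ⟨f.map.toFun i y, (map_smul _ _ _).symm⟩) x.2
  have pre_frobMod : f.pre Z (r + 1) n (D.frobMod Z r n (classMod _ D.cx n x)) =
      D'.frobMod Z r n (classMod _ D'.cx n ⟨f.map.toFun n x, hfx⟩) := by
    rw [frobMod, SemiMap.H_modBy_classMod, pre, SemiMap.H_modBy_classMod, frobMod,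
      SemiMap.H_modBy_classMod]
    exact classMod_eq_of_homotopic f.frob_comm (dvd_of_eq (Z.phi_xiTilde_mul_xi r).symm) x.2 _ _
  rw [pre_frobMod, preR_frobMod, preR_frobMod, projMod_classMod, projMod_classMod, pre,
    SemiMap.H_modBy_classMod]

end Functoriality

section PreD

variable [IsAdicComplete (Ideal.span {(p : A)}) A] (hp : (p : A) ∈ nonZeroDivisors A) {m : ℤ}

/-- The Bockstein `H^n(D/ξ̃_r) → H^{n+1}(D/ξ̃_r)`. -/
abbrev FrobAlg.preD (D : FrobAlg p A) (Z : RootSystem p A) (r : ℕ) (h : n + 1 = m) :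
    D.Pre Z r n →ₗ[Ainf p A] D.Pre Z r m :=
  bock (D.isSMulRegular (Z.xiTilde_mem_nonZeroDivisors hp r)) h

theorem FrobAlg.preD_preR (h : n + 1 = m) (c : D.Pre Z (r + 1) n) :
    D.preD hp Z r h (D.preR Z r n c) = Z.xi • D.preR Z r m (D.preD hp Z (r + 1) h c) :=
  bock_H_modBy _ _ D.frobInv _ (Z.phi_symm_xiTilde_succ r) h c

theorem FrobAlg.preF_preD_preV (h : n + 1 = m) (c : D.Pre Z r n) :
    D.preF Z r m (D.preD hp Z (r + 1) h (D.preV Z r n c)) = D.preD hp Z r h c := by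
  have hreg (r : ℕ) := D.isSMulRegular (Z.xiTilde_mem_nonZeroDivisors hp r)
  obtain ⟨x, rfl⟩ := classMod_surjective _ D.cx n c
  rw [preV, SemiMap.H_modBy_classMod, bock_classMod, preF_eq_projMod, projMod_classMod,
    bock_classMod]
  refine congrArg _ (Subtype.ext (hreg (r + 1) m ?_))
  refine (smul_divD (hreg (r + 1)) h _).trans ((map_smul (D.cx.d n m h) _ x.1).trans ?_)
  rw [← smul_divD (hreg r), smul_smul, mul_comm, ← Z.xiTilde_succ]

theorem FrobAlg.preD_preF (h : n + 1 = m) (c : D.Pre Z (r + 1) n) :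
    D.preD hp Z r h (D.preF Z r n c) = p • D.preF Z r m (D.preD hp Z (r + 1) h c) := by
  rw [← preF_preV, preF_preV_eq_phiXi_smul]
  exact bock_H_modBy _ _ (SemiMap.scalar 1 D.cx) _ (Z.xiTilde_succ r) h c

theorem FrobAlg.Hom.pre_preD (f : FrobAlg.Hom D D') (h : n + 1 = m) (c : D.Pre Z r n) :
    f.pre Z r m (D.preD hp Z r h c) = D'.preD hp Z r h (f.pre Z r n c) :=
  ((bock_H_modBy _ _ f.map _ (mul_one _).symm h c).trans (one_smul _ _)).symm

end PreD

end Pre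

/-! ### The operators on `W_r^n(D)` -/

section WittOperators

variable {p : ℕ} [Fact p.Prime] {A : Type u} [CommRing A] [Fact (¬ IsUnit (p : A))]
  {Z : RootSystem p A} {D : FrobAlg p A}

theorem isSMulRegular_mu_witt (hD : D.Admissible Z) (r n : ℕ) :
    IsSMulRegular (D.Witt Z r n) Z.mu := by
  have hp : IsSMulRegular (D.Witt Z r n) (p : Ainf p A) :=
    .of_right_eq_zero_of_smul fun c hc =>
      hD.w2 r n c ((Nat.cast_smul_eq_nsmul (Ainf p A) p c).symm.trans hc)
  refine .of_right_eq_zero_of_smul fun c hc => (hp.pow r).right_eq_zero_of_smul ?_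
  obtain ⟨w, hw⟩ := Z.mu_dvd_xiTilde_sub r
  rw [← sub_sub_cancel (Z.xiTilde r) ((p : Ainf p A) ^ r), hw, sub_smul, smul_Hn_modBy, mul_comm,
    mul_smul, hc, smul_zero, sub_zero]

variable [IsAdicComplete (Ideal.span {(p : A)}) A] (hp : (p : A) ∈ nonZeroDivisors A)
  (hD : D.Admissible Z)

include hp in
theorem incl_injective (r n : ℕ) : Function.Injective (FrobAlg.incl Z hD r n) :=
  canMap_injective hD.w1 (D.isSMulRegular (Z.mu_mem_nonZeroDivisors hp))
    (D.isSMulRegular (Z.xiTilde_mem_nonZeroDivisors hp r)) (isSMulRegular_mu_witt hD r n)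

include hp in
theorem mem_range_incl_iff {r n : ℕ} {c : D.Pre Z r n} :
    c ∈ LinearMap.range (FrobAlg.incl Z hD r n) ↔
      ∃ y : cocyclesMod (Z.mu * Z.xiTilde r) D.cx n, c = Z.mu ^ n •
        classMod (Z.xiTilde r) D.cx n ⟨y, cocyclesMod_mono (dvd_mul_left _ _) n y.2⟩ :=
  mem_range_canMap_iff hD.w1 (D.isSMulRegular (Z.mu_mem_nonZeroDivisors hp))
    (D.isSMulRegular (Z.xiTilde_mem_nonZeroDivisors hp r)) n

/-- `ι` in degree `0`, with target in degree `0` rather than `((0 : ℕ) : ℤ)`. -/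
def incl₀ (r : ℕ) : D.Witt Z r 0 →ₗ[Ainf p A] D.Pre Z r 0 := FrobAlg.incl Z hD r 0

include hp in
theorem oneMod_mem_range_incl₀ (r : ℕ) : D.oneMod (Z.xiTilde r) ∈ LinearMap.range (incl₀ hD r) :=
  (mem_range_incl_iff hp hD (n := 0)).2
    ⟨⟨D.one.1, mem_cocyclesMod_of_d_eq_zero rfl ((Cx.mem_cocycles rfl).1 D.one.2)⟩,
      ((congrArg (· • _) (pow_zero Z.mu)).trans (one_smul _ _)).symm⟩

include hp in
theorem mulMod_incl_mem_range_incl {r i j k : ℕ} (h : i + j = k) (x : D.Witt Z r i)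
    (y : D.Witt Z r j) :
    D.mulMod (Z.xiTilde r) i j k (by omega) (FrobAlg.incl Z hD r i x) (FrobAlg.incl Z hD r j y) ∈
      LinearMap.range (FrobAlg.incl Z hD r k) := by
  obtain ⟨x, hx⟩ := (mem_range_incl_iff hp hD).1 ⟨x, rfl⟩
  obtain ⟨y, hy⟩ := (mem_range_incl_iff hp hD).1 ⟨y, rfl⟩
  rw [hx, hy, D.mulMod_smul_smul, D.mulMod_classMod, ← pow_add, h]
  exact (mem_range_incl_iff hp hD).2 ⟨⟨_, D.mul.mem_cocyclesMod (by omega) x.2 y.2⟩, rfl⟩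

include hp in
theorem xi_pow_smul_preR_incl_mem_range_incl (r n : ℕ) (x : D.Witt Z (r + 1) n) :
    Z.xi ^ n • D.preR Z r n (FrobAlg.incl Z hD (r + 1) n x) ∈
      LinearMap.range (FrobAlg.incl Z hD r n) := by
  obtain ⟨x, hx⟩ := (mem_range_incl_iff hp hD).1 ⟨x, rfl⟩
  have h_div (i : ℤ) (v : D.cx.X i) : ∃ y, (Z.mu * Z.xiTilde r) • y =
      D.frobInv.toFun i ((Z.mu * Z.xiTilde (r + 1)) • v) := by
    refine ⟨D.frobInv.toFun i v, (congrArg (· • _) ?_).trans (LinearMap.map_smulₛₗ _ _ _).symm⟩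
    calc Z.mu * Z.xiTilde r = Z.xi * (phi p A).symm Z.mu * Z.xiTilde r := by
          rw [Z.xi_mul_phi_symm_mu]
      _ = (phi p A).symm (Z.mu * Z.xiTilde (r + 1)) := by
          rw [map_mul, Z.phi_symm_xiTilde_succ]
          ring
  have xi_pow_mul : Z.xi ^ n * (phi p A).symm (Z.mu ^ n) = Z.mu ^ n := by
    rw [map_pow, ← mul_pow, Z.xi_mul_phi_symm_mu]
  refine (mem_range_incl_iff hp hD).2 ⟨⟨_, D.frobInv.mem_cocyclesMod h_div x.2⟩, ?_⟩
  rw [hx, LinearMap.map_smulₛₗ, smul_smul, FrobAlg.preR, SemiMap.H_modBy_classMod]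
  exact congrArg (· • _) xi_pow_mul

include hp in
theorem preF_incl_mem_range_incl (r n : ℕ) (x : D.Witt Z (r + 1) n) :
    D.preF Z r n (FrobAlg.incl Z hD (r + 1) n x) ∈ LinearMap.range (FrobAlg.incl Z hD r n) := by
  obtain ⟨x, hx⟩ := (mem_range_incl_iff hp hD).1 ⟨x, rfl⟩
  refine (mem_range_incl_iff hp hD).2
    ⟨⟨x, cocyclesMod_mono (mul_dvd_mul_left _ (Z.xiTilde_dvd_xiTilde_succ r)) n x.2⟩, ?_⟩
  rw [hx, map_smul, FrobAlg.preF_eq_projMod, projMod_classMod]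

include hp in
theorem preV_incl_mem_range_incl (r n : ℕ) (x : D.Witt Z r n) :
    D.preV Z r n (FrobAlg.incl Z hD r n x) ∈ LinearMap.range (FrobAlg.incl Z hD (r + 1) n) := by
  obtain ⟨x, hx⟩ := (mem_range_incl_iff hp hD).1 ⟨x, rfl⟩
  obtain ⟨v, hv⟩ := (mem_cocyclesMod rfl).1 x.2
  have phiXi_smul_mem :
      Z.phiXi (r + 1) • (x : D.cx.X n) ∈ cocyclesMod (Z.mu * Z.xiTilde (r + 1)) D.cx n :=
    (mem_cocyclesMod rfl).2 ⟨v, by rw [map_smul, hv, smul_smul, Z.xiTilde_succ]; ring_nf⟩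
  refine (mem_range_incl_iff hp hD).2 ⟨⟨_, phiXi_smul_mem⟩, ?_⟩
  rw [hx, map_smul, FrobAlg.preV, SemiMap.H_modBy_classMod]
  rfl

/-- The unit of `W_r^*(D)`. -/
def wittOne (r : ℕ) : D.Witt Z r 0 := (oneMod_mem_range_incl₀ hp hD r).choose

theorem incl₀_wittOne (r : ℕ) : incl₀ hD r (wittOne hp hD r) = D.oneMod (Z.xiTilde r) :=
  (oneMod_mem_range_incl₀ hp hD r).choose_spec

/-- The product of `W_r^*(D)`. -/
def wittMul (r i j k : ℕ) (h : i + j = k) :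
    D.Witt Z r i →ₗ[Ainf p A] D.Witt Z r j →ₗ[Ainf p A] D.Witt Z r k :=
  ((D.mulModHom (Z.xiTilde r) (by omega : (i : ℤ) + j = k)).compl₁₂ (FrobAlg.incl Z hD r i)
    (FrobAlg.incl Z hD r j)).codRestrict₂ (FrobAlg.incl Z hD r k) (incl_injective hp hD r k)
      (mulMod_incl_mem_range_incl hp hD h)

theorem incl_wittMul (r i j k : ℕ) (h : i + j = k) (x : D.Witt Z r i) (y : D.Witt Z r j) :
    FrobAlg.incl Z hD r k (wittMul hp hD r i j k h x y) =
      D.mulMod (Z.xiTilde r) i j k (by omega) (FrobAlg.incl Z hD r i x)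
        (FrobAlg.incl Z hD r j y) :=
  LinearMap.codRestrict₂_apply _ _ _ _ x y

/-- The operator `R` on `W_*^*(D)`. -/
def wittR (r n : ℕ) :
    D.Witt Z (r + 1) n →ₛₗ[((phi p A).symm : Ainf p A →+* Ainf p A)] D.Witt Z r n :=
  (LinearEquiv.ofInjective _ (incl_injective hp hD r n)).symm.toLinearMap.comp
    ((Z.xi ^ n • (D.preR Z r n).comp (FrobAlg.incl Z hD (r + 1) n)).codRestrict _
      (xi_pow_smul_preR_incl_mem_range_incl hp hD r n))

theorem incl_wittR (r n : ℕ) (x : D.Witt Z (r + 1) n) :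
    FrobAlg.incl Z hD r n (wittR hp hD r n x) =
      Z.xi ^ n • D.preR Z r n (FrobAlg.incl Z hD (r + 1) n x) :=
  congrArg Subtype.val ((LinearEquiv.ofInjective _ (incl_injective hp hD r n)).apply_symm_apply
    ⟨_, xi_pow_smul_preR_incl_mem_range_incl hp hD r n x⟩)

/-- The operator `F` on `W_*^*(D)`. -/
def wittF (r n : ℕ) : D.Witt Z (r + 1) n →ₗ[Ainf p A] D.Witt Z r n :=
  (D.preF Z r n ∘ₗ FrobAlg.incl Z hD (r + 1) n).codRestrictOfInjective (FrobAlg.incl Z hD r n)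
    (incl_injective hp hD r n) (preF_incl_mem_range_incl hp hD r n)

theorem incl_wittF (r n : ℕ) (x : D.Witt Z (r + 1) n) :
    FrobAlg.incl Z hD r n (wittF hp hD r n x) = D.preF Z r n (FrobAlg.incl Z hD (r + 1) n x) :=
  LinearMap.codRestrictOfInjective_comp_apply _ _ _ _ x

/-- The operator `V` on `W_*^*(D)`. -/
def wittV (r n : ℕ) : D.Witt Z r n →ₗ[Ainf p A] D.Witt Z (r + 1) n :=
  (D.preV Z r n ∘ₗ FrobAlg.incl Z hD r n).codRestrictOfInjective (FrobAlg.incl Z hD (r + 1) n)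
    (incl_injective hp hD (r + 1) n) (preV_incl_mem_range_incl hp hD r n)

theorem incl_wittV (r n : ℕ) (x : D.Witt Z r n) :
    FrobAlg.incl Z hD (r + 1) n (wittV hp hD r n x) = D.preV Z r n (FrobAlg.incl Z hD r n x) :=
  LinearMap.codRestrictOfInjective_comp_apply _ _ _ _ x

/-- The differential of `W_r^*(D)`: the Bockstein of `Lη_μ D`. -/
def wittD (D : FrobAlg p A) (Z : RootSystem p A) (r n : ℕ) :
    D.Witt Z r n →ₗ[Ainf p A] D.Witt Z r (n + 1) :=
  bock (eta_isSMulRegular (D.isSMulRegular (Z.xiTilde_mem_nonZeroDivisors hp r)))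
    (Nat.cast_succ n).symm

theorem incl_wittD (r n : ℕ) (x : D.Witt Z r n) :
    FrobAlg.incl Z hD r (n + 1) (wittD hp D Z r n x) =
      D.preD hp Z r (Nat.cast_succ n).symm (FrobAlg.incl Z hD r n x) :=
  canMap_bock hD.w1 _ (Nat.cast_succ n).symm x

section StructureMaps

variable {B : Type u} [CommRing B] [Algebra A B] (L : StructureMaps Z D B)

include hp in
theorem eq_of_mu_smul_incl₀_eq {r : ℕ} {x y : D.Witt Z r 0}
    (h : Z.mu • incl₀ hD r x = Z.mu • incl₀ hD r y) : x = y :=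
  isSMulRegular_mu_witt hD r 0 (incl_injective hp hD r 0 (by
    change incl₀ hD r (Z.mu • x) = incl₀ hD r (Z.mu • y)
    rw [map_smul, h, map_smul]))

omit [IsAdicComplete (Ideal.span {(p : A)}) A] in
theorem exists_mu_smul_incl₀_eq (r : ℕ) (c : D.Pre Z r 0) :
    ∃ x, Z.mu • incl₀ hD r x = Z.mu • c := by
  obtain rfl | hr := r.eq_zero_or_pos
  · have eq_zero (e : D.Pre Z 0 0) : e = 0 :=
      (one_smul (Ainf p A) e).symm.trans (smul_Hn_modBy (a := Z.xiTilde 0) e)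
    exact ⟨0, (eq_zero _).trans (eq_zero _).symm⟩
  · exact exists_smul_canMap_eq_smul hD.w1 (hD.w3 r hr 0).2 c

/-- The structure map `W_r(B) → W_r^0(D)`. -/
def wittLam (r : ℕ) : W p r B →+ D.Witt Z r 0 :=
  AddMonoidHom.mk' (fun b => (exists_mu_smul_incl₀_eq hD r (L.lam r b)).choose) fun b b' =>
    eq_of_mu_smul_incl₀_eq hp hD (by
      rw [(exists_mu_smul_incl₀_eq hD r _).choose_spec, map_add, map_add, smul_add, smul_add,
        (exists_mu_smul_incl₀_eq hD r _).choose_spec, (exists_mu_smul_incl₀_eq hD r _).choose_spec])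

theorem mu_smul_incl₀_wittLam (r : ℕ) (b : W p r B) :
    Z.mu • incl₀ hD r (wittLam hp hD L r b) = Z.mu • L.lam r b :=
  (exists_mu_smul_incl₀_eq hD r (L.lam r b)).choose_spec

theorem eq_wittLam {r : ℕ} {b : W p r B} {x : D.Witt Z r 0}
    (h : Z.mu • incl₀ hD r x = Z.mu • L.lam r b) : wittLam hp hD L r b = x :=
  eq_of_mu_smul_incl₀_eq hp hD ((mu_smul_incl₀_wittLam hp hD L r b).trans h.symm)

end StructureMaps

variable (hA : IsPerfectoid p A)

/-- The action of `W_r(A)` on `W_r^n(D)` through `θ̃_r`. -/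
def wittSmul (D : FrobAlg p A) (Z : RootSystem p A) (r n : ℕ) :
    W p r A →+* AddMonoid.End (D.Witt Z r n) :=
  RingHom.liftOfSurjective (thetaTilde p A r) (Z.thetaTilde_surjective hA hp r)
    ⟨Module.toAddMonoidEnd (Ainf p A) (D.Witt Z r n), fun w hw => by
      obtain ⟨v, rfl⟩ := Z.xiTilde_dvd_of_thetaTilde_eq_zero hA hp r hw
      ext c
      exact (mul_smul (Z.xiTilde r) v c).trans (smul_Hn_modBy _)⟩

theorem wittSmul_thetaTilde (r n : ℕ) (w : Ainf p A) (x : D.Witt Z r n) :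
    wittSmul hp hA D Z r n (thetaTilde p A r w) x = w • x :=
  congrArg (fun f : AddMonoid.End (D.Witt Z r n) => f x)
    (RingHom.liftOfSurjective_comp_apply _ _ _ w)

end WittOperators

/-! ### The Witt complex `W_*^*(D)` -/

theorem isUnit_two_Ainf {p : ℕ} [Fact p.Prime] {A : Type u} [CommRing A]
    [Fact (¬ IsUnit (p : A))] (hp : p ≠ 2) : IsUnit (2 : Ainf p A) := by
  obtain ⟨m, hm⟩ := (Fact.out : p.Prime).odd_of_ne_two hp
  have two_mul_neg : (2 : PreTilt A p) * (-m) = 1 := by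
    have cast_eq_zero : ((2 * m + 1 : ℕ) : PreTilt A p) = 0 := by
      rw [← hm]
      exact CharP.cast_eq_zero _ p
    push_cast at cast_eq_zero
    linear_combination -cast_eq_zero
  have coeff_two : (2 : Ainf p A).coeff 0 = (Units.mkOfMulEqOne _ _ two_mul_neg : PreTilt A p) :=
    map_ofNat (WittVector.constantCoeff (p := p) (R := PreTilt A p)) 2
  exact (WittVector.mkUnit coeff_two).isUnit

section WittComplex

variable {p : ℕ} [Fact p.Prime] {A : Type u} [CommRing A] [Fact (¬ IsUnit (p : A))]
  [IsAdicComplete (Ideal.span {(p : A)}) A] {Z : RootSystem p A} {D : FrobAlg p A}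
  (hp : (p : A) ∈ nonZeroDivisors A) (hD : D.Admissible Z) (r : ℕ) {i j k n : ℕ}

theorem wittOne_mul (x : D.Witt Z r n) :
    wittMul hp hD r 0 n n (zero_add n) (wittOne hp hD r) x = x :=
  incl_injective hp hD r n ((incl_wittMul hp hD r 0 n n (zero_add n) _ x).trans
    ((congrArg (fun t => D.mulMod (Z.xiTilde r) 0 n n (zero_add (n : ℤ)) t _)
      (incl₀_wittOne hp hD r)).trans (D.oneMod_mulMod _ _)))

theorem wittMul_comm (h : i + j = k) (h' : j + i = k) (x : D.Witt Z r i) (y : D.Witt Z r j) :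
    wittMul hp hD r i j k h x y = (-1 : ℤ) ^ (i * j) • wittMul hp hD r j i k h' y x := by
  apply incl_injective hp hD r k
  rw [incl_wittMul, map_zsmul, incl_wittMul, D.mulMod_comm _ (by omega), ← Nat.cast_mul,
    sgn_natCast]

theorem wittMul_self (h : i + i = k) (x : D.Witt Z r i) (hi : Odd i) :
    wittMul hp hD r i i k h x x = 0 := by
  have two_smul_eq_zero := wittMul_comm hp hD r h h x x
  rw [(hi.mul hi).neg_one_pow, neg_smul, one_smul, eq_neg_iff_add_eq_zero,
    ← two_smul (Ainf p A)] at two_smul_eq_zero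
  by_cases hp₂ : p = 2
  · subst hp₂
    exact hD.w2 r k _ ((Nat.cast_smul_eq_nsmul (Ainf 2 A) 2 _).symm.trans two_smul_eq_zero)
  · exact (isUnit_two_Ainf (A := A) hp₂).smul_eq_zero.1 two_smul_eq_zero

theorem wittMul_assoc {ij jk l : ℕ} (h : i + j = ij) (h' : j + k = jk) (hl : ij + k = l)
    (hl' : i + jk = l) (x : D.Witt Z r i) (y : D.Witt Z r j) (z : D.Witt Z r k) :
    wittMul hp hD r ij k l hl (wittMul hp hD r i j ij h x y) z =
      wittMul hp hD r i jk l hl' x (wittMul hp hD r j k jk h' y z) := by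
  apply incl_injective hp hD r l
  rw [incl_wittMul, incl_wittMul, incl_wittMul, incl_wittMul, D.mulMod_assoc]

theorem wittD_wittD (x : D.Witt Z r n) :
    wittD hp D Z r (n + 1) (wittD hp D Z r n x) = 0 :=
  bock_bock _ _ _ x

theorem wittD_mul (h : i + j = k) (h₁ : i + 1 + j = k + 1) (h₂ : i + (j + 1) = k + 1)
    (x : D.Witt Z r i) (y : D.Witt Z r j) :
    wittD hp D Z r k (wittMul hp hD r i j k h x y) =
      wittMul hp hD r (i + 1) j (k + 1) h₁ (wittD hp D Z r i x) y +
        (-1 : ℤ) ^ i • wittMul hp hD r i (j + 1) (k + 1) h₂ x (wittD hp D Z r j y) := by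
  apply incl_injective hp hD r (k + 1)
  rw [incl_wittD, incl_wittMul, map_add, map_zsmul, incl_wittMul, incl_wittMul, incl_wittD,
    incl_wittD, bock_mulMod _ _ (Nat.cast_succ i).symm (Nat.cast_succ j).symm _ (by omega)
      (by omega), sgn_natCast]

theorem wittR_one : wittR hp hD r 0 (wittOne hp hD (r + 1)) = wittOne hp hD r :=
  incl_injective hp hD r 0 ((incl_wittR hp hD r 0 _).trans
    (((congrArg (· • _) (pow_zero Z.xi)).trans (one_smul (Ainf p A) _)).trans
      ((congrArg (D.preR Z r 0) (incl₀_wittOne hp hD (r + 1))).trans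
        (FrobAlg.preR_oneMod.trans (incl₀_wittOne hp hD r).symm))))

theorem wittR_mul (h : i + j = k) (x : D.Witt Z (r + 1) i) (y : D.Witt Z (r + 1) j) :
    wittR hp hD r k (wittMul hp hD (r + 1) i j k h x y) =
      wittMul hp hD r i j k h (wittR hp hD r i x) (wittR hp hD r j y) := by
  apply incl_injective hp hD r k
  rw [incl_wittR, incl_wittMul, incl_wittMul, incl_wittR, incl_wittR, FrobAlg.preR_mulMod,
    D.mulMod_smul_smul, ← pow_add, h]

theorem wittR_wittD (x : D.Witt Z (r + 1) n) :
    wittR hp hD r (n + 1) (wittD hp D Z (r + 1) n x) = wittD hp D Z r n (wittR hp hD r n x) := by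
  apply incl_injective hp hD r (n + 1)
  rw [incl_wittR, incl_wittD, incl_wittD hp hD, incl_wittR, map_smul, FrobAlg.preD_preR,
    smul_smul, pow_succ]

theorem wittF_one : wittF hp hD r 0 (wittOne hp hD (r + 1)) = wittOne hp hD r :=
  incl_injective hp hD r 0 ((incl_wittF hp hD r 0 _).trans
    ((congrArg (D.preF Z r 0) (incl₀_wittOne hp hD (r + 1))).trans
      (FrobAlg.preF_oneMod.trans (incl₀_wittOne hp hD r).symm)))

theorem wittF_mul (h : i + j = k) (x : D.Witt Z (r + 1) i) (y : D.Witt Z (r + 1) j) :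
    wittF hp hD r k (wittMul hp hD (r + 1) i j k h x y) =
      wittMul hp hD r i j k h (wittF hp hD r i x) (wittF hp hD r j y) := by
  apply incl_injective hp hD r k
  rw [incl_wittF, incl_wittMul, incl_wittMul, incl_wittF, incl_wittF, FrobAlg.preF_mulMod]

theorem wittV_mul (h : i + j = k) (x : D.Witt Z (r + 1) i) (y : D.Witt Z r j) :
    wittV hp hD r k (wittMul hp hD r i j k h (wittF hp hD r i x) y) =
      wittMul hp hD (r + 1) i j k h x (wittV hp hD r j y) := by
  apply incl_injective hp hD (r + 1) k
  rw [incl_wittV, incl_wittMul, incl_wittMul, incl_wittF, incl_wittV, FrobAlg.preV_mulMod]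

theorem wittR_wittF (x : D.Witt Z (r + 1 + 1) n) :
    wittR hp hD r n (wittF hp hD (r + 1) n x) = wittF hp hD r n (wittR hp hD (r + 1) n x) := by
  apply incl_injective hp hD r n
  rw [incl_wittR, incl_wittF, incl_wittF, incl_wittR, map_smul, FrobAlg.preR_preF]

theorem wittR_wittV (x : D.Witt Z (r + 1) n) :
    wittR hp hD (r + 1) n (wittV hp hD (r + 1) n x) = wittV hp hD r n (wittR hp hD r n x) := by
  apply incl_injective hp hD (r + 1) n
  rw [incl_wittR, incl_wittV, incl_wittV, incl_wittR, map_smul, FrobAlg.preR_preV]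

theorem wittF_wittV (x : D.Witt Z r n) : wittF hp hD r n (wittV hp hD r n x) = p • x := by
  apply incl_injective hp hD r n
  rw [incl_wittF, incl_wittV, FrobAlg.preF_preV, map_nsmul]

theorem wittF_wittD_wittV (x : D.Witt Z r n) :
    wittF hp hD r (n + 1) (wittD hp D Z (r + 1) n (wittV hp hD r n x)) = wittD hp D Z r n x := by
  apply incl_injective hp hD r (n + 1)
  rw [incl_wittF, incl_wittD hp hD, incl_wittV, incl_wittD hp hD, FrobAlg.preF_preD_preV]

theorem wittD_wittF (x : D.Witt Z (r + 1) n) :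
    wittD hp D Z r n (wittF hp hD r n x) =
      p • wittF hp hD r (n + 1) (wittD hp D Z (r + 1) n x) := by
  apply incl_injective hp hD r (n + 1)
  rw [map_nsmul, incl_wittF, incl_wittD hp hD, incl_wittF, incl_wittD hp hD, FrobAlg.preD_preF]

section StructureMaps

variable {B : Type u} [CommRing B] [Algebra A B] (L : StructureMaps Z D B)

theorem wittLam_mul (b b' : W p r B) :
    wittLam hp hD L r (b * b') =
      wittMul hp hD r 0 0 0 rfl (wittLam hp hD L r b) (wittLam hp hD L r b') := by
  apply eq_wittLam
  have incl₀_mul (x y : D.Witt Z r 0) : incl₀ hD r (wittMul hp hD r 0 0 0 rfl x y) =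
    D.mulModHom (Z.xiTilde r) (add_zero 0) (incl₀ hD r x) (incl₀ hD r y) :=
      incl_wittMul hp hD r 0 0 0 rfl x y
  rw [incl₀_mul, ← LinearMap.map_smul₂, mu_smul_incl₀_wittLam, LinearMap.map_smul₂, ← map_smul,
    mu_smul_incl₀_wittLam, map_smul, L.lam_mul, D.mulModHom_apply]

theorem wittLam_algebraMap (w : Ainf p A) :
    wittLam hp hD L r (W.map r (algebraMap A B) (thetaTilde p A r w)) = w • wittOne hp hD r := by
  apply eq_wittLam
  rw [map_smul, incl₀_wittOne, L.lam_algebraMap]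

theorem wittLam_one : wittLam hp hD L r 1 = wittOne hp hD r := by
  have h := wittLam_algebraMap hp hD r L 1
  rwa [map_one, map_one, one_smul] at h

theorem wittLam_R (b : W p (r + 1) B) :
    wittLam hp hD L r (W.R r b) = wittR hp hD r 0 (wittLam hp hD L (r + 1) b) := by
  apply eq_wittLam
  have incl₀_wittR (x : D.Witt Z (r + 1) 0) :
      incl₀ hD r (wittR hp hD r 0 x) = D.preR Z r 0 (incl₀ hD (r + 1) x) :=
    (incl_wittR hp hD r 0 x).trans ((congrArg (· • _) (pow_zero Z.xi)).trans (one_smul _ _))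
  have mu_smul_preR (c : D.Pre Z (r + 1) 0) :
      Z.mu • D.preR Z r 0 c = Z.xi • D.preR Z r 0 (Z.mu • c) := by
    rw [LinearMap.map_smulₛₗ, smul_smul]
    exact congrArg (· • _) Z.xi_mul_phi_symm_mu.symm
  rw [incl₀_wittR, L.lam_R, mu_smul_preR, mu_smul_preR, mu_smul_incl₀_wittLam]

theorem wittLam_F (b : W p (r + 1) B) :
    wittLam hp hD L r (W.F r b) = wittF hp hD r 0 (wittLam hp hD L (r + 1) b) := by
  apply eq_wittLam
  have incl₀_wittF (x : D.Witt Z (r + 1) 0) :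
    incl₀ hD r (wittF hp hD r 0 x) = D.preF Z r 0 (incl₀ hD (r + 1) x) := incl_wittF hp hD r 0 x
  rw [incl₀_wittF, L.lam_F, ← map_smul, mu_smul_incl₀_wittLam, map_smul]

theorem wittLam_V (b : W p r B) :
    wittLam hp hD L (r + 1) (W.V r b) = wittV hp hD r 0 (wittLam hp hD L r b) := by
  apply eq_wittLam
  have incl₀_wittV (x : D.Witt Z r 0) :
    incl₀ hD (r + 1) (wittV hp hD r 0 x) = D.preV Z r 0 (incl₀ hD r x) := incl_wittV hp hD r 0 x
  rw [incl₀_wittV, L.lam_V, ← map_smul, mu_smul_incl₀_wittLam, map_smul]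

theorem wittD_wittLam_pow (m : ℕ) (t : W p r B) :
    wittD hp D Z r 0 (wittLam hp hD L r (t ^ (m + 1))) =
      (m + 1) • wittMul hp hD r 0 1 1 rfl (wittLam hp hD L r (t ^ m))
        (wittD hp D Z r 0 (wittLam hp hD L r t)) := by
  induction m with
  | zero =>
    rw [pow_zero, wittLam_one, pow_succ, pow_zero, one_mul]
    exact ((one_smul ℕ _).trans (wittOne_mul hp hD r _)).symm
  | succ m ih =>
    rw [pow_succ', wittLam_mul, wittD_mul hp hD r (i := 0) (j := 0) (k := 0) rfl rfl rfl, ih,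
      pow_zero, one_smul, wittMul_comm hp hD r (i := 1) (j := 0) rfl rfl, mul_zero, pow_zero,
      one_smul, map_nsmul, ← wittMul_assoc hp hD r (i := 0) (j := 0) (k := 1) (ij := 0) (jk := 1)
        (l := 1) rfl rfl rfl rfl, ← wittLam_mul, ← pow_succ',
      succ_nsmul' _ (m + 1)]

theorem wittF_wittD_teich (b : B) :
    wittF hp hD r 1 (wittD hp D Z (r + 1) 0 (wittLam hp hD L (r + 1) (W.teich (r + 1) b))) =
      wittMul hp hD r 0 1 1 rfl (wittLam hp hD L r (W.teich r b ^ (p - 1)))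
        (wittD hp D Z r 0 (wittLam hp hD L r (W.teich r b))) := by
  -- Both sides become `d[b]^p = dF[b]` after multiplication by `p`.
  refine sub_eq_zero.1 (hD.w2 r (1 : ℕ) _ ?_)
  have h := wittD_wittLam_pow hp hD r L (p - 1) (W.teich r b)
  rw [Nat.sub_add_cancel (Fact.out : p.Prime).one_le, ← W.F_teich, wittLam_F, wittD_wittF] at h
  exact (smul_sub _ _ _).trans (sub_eq_zero.2 h)

end StructureMaps

end WittComplex

section WittStr

variable {p : ℕ} [Fact p.Prime] {A : Type u} [CommRing A] [Fact (¬ IsUnit (p : A))]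
  [IsAdicComplete (Ideal.span {(p : A)}) A] {Z : RootSystem p A} {D : FrobAlg p A}
  (hA : IsPerfectoid p A) (hp : (p : A) ∈ nonZeroDivisors A) (hD : D.Admissible Z)
  {r i j k n : ℕ}

theorem wittSmul_mul (h : i + j = k) (a : W p r A) (x : D.Witt Z r i) (y : D.Witt Z r j) :
    wittMul hp hD r i j k h (wittSmul hp hA D Z r i a x) y =
      wittSmul hp hA D Z r k a (wittMul hp hD r i j k h x y) := by
  obtain ⟨w, rfl⟩ := Z.thetaTilde_surjective hA hp r a
  rw [wittSmul_thetaTilde, wittSmul_thetaTilde, LinearMap.map_smul₂]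

theorem wittD_wittSmul (a : W p r A) (x : D.Witt Z r n) :
    wittD hp D Z r n (wittSmul hp hA D Z r n a x) =
      wittSmul hp hA D Z r (n + 1) a (wittD hp D Z r n x) := by
  obtain ⟨w, rfl⟩ := Z.thetaTilde_surjective hA hp r a
  rw [wittSmul_thetaTilde, wittSmul_thetaTilde, map_smul]

theorem wittR_wittSmul (a : W p (r + 1) A) (x : D.Witt Z (r + 1) n) :
    wittR hp hD r n (wittSmul hp hA D Z (r + 1) n a x) =
      wittSmul hp hA D Z r n (W.R r a) (wittR hp hD r n x) := by
  obtain ⟨w, rfl⟩ := Z.thetaTilde_surjective hA hp (r + 1) a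
  rw [wittSmul_thetaTilde, R_thetaTilde, wittSmul_thetaTilde, LinearMap.map_smulₛₗ]
  rfl

theorem wittF_wittSmul (a : W p (r + 1) A) (x : D.Witt Z (r + 1) n) :
    wittF hp hD r n (wittSmul hp hA D Z (r + 1) n a x) =
      wittSmul hp hA D Z r n (W.F r a) (wittF hp hD r n x) := by
  obtain ⟨w, rfl⟩ := Z.thetaTilde_surjective hA hp (r + 1) a
  rw [wittSmul_thetaTilde, F_thetaTilde, wittSmul_thetaTilde, map_smul]

theorem wittV_wittSmul (a : W p (r + 1) A) (x : D.Witt Z r n) :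
    wittV hp hD r n (wittSmul hp hA D Z r n (W.F r a) x) =
      wittSmul hp hA D Z (r + 1) n a (wittV hp hD r n x) := by
  obtain ⟨w, rfl⟩ := Z.thetaTilde_surjective hA hp (r + 1) a
  rw [wittSmul_thetaTilde, F_thetaTilde, wittSmul_thetaTilde, map_smul]

variable {B : Type u} [CommRing B] [Algebra A B] (L : StructureMaps Z D B)

theorem wittLam_map_algebraMap (a : W p r A) :
    wittLam hp hD L r (W.map r (algebraMap A B) a) =
      wittSmul hp hA D Z r 0 a (wittOne hp hD r) := by
  obtain ⟨w, rfl⟩ := Z.thetaTilde_surjective hA hp r a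
  rw [wittSmul_thetaTilde, wittLam_algebraMap]

/-- The Witt complex `W_*^*(D)` attached to `D` and the maps `λ_r`. -/
def wittStr : WittStr p A B (D.Witt Z) where
  smul := wittSmul hp hA D Z
  one := wittOne hp hD
  mul r i j k h := LinearMap.toAddMonoidHom'.comp (wittMul hp hD r i j k h).toAddMonoidHom
  d r n := (wittD hp D Z r n).toAddMonoidHom
  R r n := (wittR hp hD r n).toAddMonoidHom
  F r n := (wittF hp hD r n).toAddMonoidHom
  V r n := (wittV hp hD r n).toAddMonoidHom
  lam := wittLam hp hD L
  one_mul r _ := wittOne_mul hp hD r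
  mul_comm r _ _ _ h := wittMul_comm hp hD r h (by omega)
  mul_self r _ _ h := wittMul_self hp hD r h
  mul_assoc r _ _ _ _ _ _ h h' hl := wittMul_assoc hp hD r h h' hl (by omega)
  smul_mul _ _ _ _ h := wittSmul_mul hA hp hD h
  d_d r _ := wittD_wittD hp r
  leibniz r _ _ _ h := wittD_mul hp hD r h (by omega) (by omega)
  d_smul _ _ := wittD_wittSmul hA hp
  R_one := wittR_one hp hD
  R_mul r _ _ _ h := wittR_mul hp hD r h
  R_smul _ _ := wittR_wittSmul hA hp hD
  R_d r _ := wittR_wittD hp hD r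
  F_one := wittF_one hp hD
  F_mul r _ _ _ h := wittF_mul hp hD r h
  F_smul _ _ := wittF_wittSmul hA hp hD
  V_smul _ _ := wittV_wittSmul hA hp hD
  V_mul r _ _ _ h := wittV_mul hp hD r h
  R_F r _ := wittR_wittF hp hD r
  R_V r _ := wittR_wittV hp hD r
  F_V r _ := wittF_wittV hp hD r
  F_d_V r _ := wittF_wittD_wittV hp hD r
  lam_mul r := wittLam_mul hp hD r L
  lam_algebraMap _ := wittLam_map_algebraMap hA hp hD L
  lam_R r := wittLam_R hp hD r L
  lam_F r := wittLam_F hp hD r L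
  lam_V r := wittLam_V hp hD r L
  teich r := wittF_wittD_teich hp hD r L

theorem wittStr_isCanonical : IsCanonical Z hD L (wittStr hA hp hD L) where
  smul := wittSmul_thetaTilde hp hA
  one := incl₀_wittOne hp hD
  mul := incl_wittMul hp hD
  d _ _ := isBockstein_bock _ _
  R := incl_wittR hp hD
  F := incl_wittF hp hD
  V := incl_wittV hp hD
  lam r b := (smul_sub _ _ _).trans (sub_eq_zero.2 (mu_smul_incl₀_wittLam hp hD L r b))

end WittStr

/-! ### Uniqueness and functoriality -/

section Canonical

variable {p : ℕ} [Fact p.Prime] {A : Type u} [CommRing A] [Fact (¬ IsUnit (p : A))]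
  [IsAdicComplete (Ideal.span {(p : A)}) A] {Z : RootSystem p A} {D D' : FrobAlg p A}
  (hA : IsPerfectoid p A) (hp : (p : A) ∈ nonZeroDivisors A) {hD : D.Admissible Z}
  {hD' : D'.Admissible Z} {B B' : Type u} [CommRing B] [Algebra A B] [CommRing B'] [Algebra A B']
  {L : StructureMaps Z D B} {L' : StructureMaps Z D' B'} {S T : WittStr p A B (D.Witt Z)}
  {S' : WittStr p A B' (D'.Witt Z)} {r i j k n : ℕ}

theorem IsCanonical.d_eq_wittD (hS : IsCanonical Z hD L S) (x : D.Witt Z r n) :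
    S.d r n x = wittD hp D Z r n x :=
  (hS.d r n).eq_bock _ _ x

theorem IsCanonical.incl_d (hS : IsCanonical Z hD L S) (x : D.Witt Z r n) :
    FrobAlg.incl Z hD r (n + 1) (S.d r n x) =
      D.preD hp Z r (Nat.cast_succ n).symm (FrobAlg.incl Z hD r n x) := by
  rw [hS.d_eq_wittD hp, incl_wittD hp hD]

theorem IsCanonical.mu_smul_incl₀_lam (hS : IsCanonical Z hD L S) (b : W p r B) :
    Z.mu • incl₀ hD r (S.lam r b) = Z.mu • L.lam r b :=
  sub_eq_zero.1 ((smul_sub _ _ _).symm.trans (hS.lam r b))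

attribute [local ext] WittStr

include hA hp in
theorem IsCanonical.unique (hS : IsCanonical Z hD L S) (hT : IsCanonical Z hD L T) : S = T := by
  ext r
  next n a x =>
    obtain ⟨w, rfl⟩ := Z.thetaTilde_surjective hA hp r a
    exact (hS.smul r n w x).trans (hT.smul r n w x).symm
  · exact incl_injective hp hD r 0 ((hS.one r).trans (hT.one r).symm)
  · exact incl_injective hp hD r _ ((hS.mul r _ _ _ _ _ _).trans (hT.mul r _ _ _ _ _ _).symm)
  · exact (hS.d_eq_wittD hp _).trans (hT.d_eq_wittD hp _).symm
  · exact incl_injective hp hD r _ ((hS.R r _ _).trans (hT.R r _ _).symm)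
  · exact incl_injective hp hD r _ ((hS.F r _ _).trans (hT.F r _ _).symm)
  · exact incl_injective hp hD (r + 1) _ ((hS.V r _ _).trans (hT.V r _ _).symm)
  · exact eq_of_mu_smul_incl₀_eq hp hD
      ((hS.mu_smul_incl₀_lam _).trans (hT.mu_smul_incl₀_lam _).symm)

omit [IsAdicComplete (Ideal.span {(p : A)}) A] in
theorem FrobAlg.Hom.pre_incl (f : FrobAlg.Hom D D') (hD : D.Admissible Z) (hD' : D'.Admissible Z)
    (x : D.Witt Z r n) :
    f.pre Z r n (FrobAlg.incl Z hD r n x) = FrobAlg.incl Z hD' r n (f.witt Z r n x) := by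
  obtain ⟨w, rfl⟩ := classMod_surjective _ _ _ x
  exact map_smul (f.pre Z r n) (Z.mu ^ n) (classMod (Z.xiTilde r) D.cx n
    ⟨etaFst Z.mu D.cx n w, cocyclesMod_mono (dvd_mul_left _ _) n (etaFst_mem_cocyclesMod w.2)⟩)

section WittHom

variable (f : FrobAlg.Hom D D') (hS : IsCanonical Z hD L S) (hS' : IsCanonical Z hD' L' S')

include hS hS'

include hA hp in
theorem IsCanonical.witt_smul (a : W p r A) (x : D.Witt Z r n) :
    f.witt Z r n (S.smul r n a x) = S'.smul r n a (f.witt Z r n x) := by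
  obtain ⟨w, rfl⟩ := Z.thetaTilde_surjective hA hp r a
  rw [hS.smul, hS'.smul, map_smul]

include hp

theorem IsCanonical.witt_one : f.witt Z r 0 (S.one r) = S'.one r :=
  incl_injective hp hD' r 0 ((f.pre_incl hD hD' _).symm.trans
    ((congrArg (f.pre Z r 0) (hS.one r)).trans (f.pre_oneMod.trans (hS'.one r).symm)))

theorem IsCanonical.witt_mul (h : i + j = k) (x : D.Witt Z r i) (y : D.Witt Z r j) :
    f.witt Z r k (S.mul r i j k h x y) =
      S'.mul r i j k h (f.witt Z r i x) (f.witt Z r j y) := by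
  apply incl_injective hp hD' r k
  rw [hS'.mul, ← f.pre_incl hD hD', ← f.pre_incl hD hD', ← f.pre_incl hD hD', hS.mul,
    f.pre_mulMod]

theorem IsCanonical.witt_d (x : D.Witt Z r n) :
    f.witt Z r (n + 1) (S.d r n x) = S'.d r n (f.witt Z r n x) := by
  apply incl_injective hp hD' r (n + 1)
  rw [hS'.incl_d hp, ← f.pre_incl hD hD', ← f.pre_incl hD hD', hS.incl_d hp, f.pre_preD]

theorem IsCanonical.witt_R (x : D.Witt Z (r + 1) n) :
    f.witt Z r n (S.R r n x) = S'.R r n (f.witt Z (r + 1) n x) := by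
  apply incl_injective hp hD' r n
  rw [hS'.R, ← f.pre_incl hD hD', ← f.pre_incl hD hD', hS.R, map_smul, f.pre_preR]

theorem IsCanonical.witt_F (x : D.Witt Z (r + 1) n) :
    f.witt Z r n (S.F r n x) = S'.F r n (f.witt Z (r + 1) n x) := by
  apply incl_injective hp hD' r n
  rw [hS'.F, ← f.pre_incl hD hD', ← f.pre_incl hD hD', hS.F, f.pre_preF]

theorem IsCanonical.witt_V (x : D.Witt Z r n) :
    f.witt Z (r + 1) n (S.V r n x) = S'.V r n (f.witt Z r n x) := by
  apply incl_injective hp hD' (r + 1) n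
  rw [hS'.V, ← f.pre_incl hD hD', ← f.pre_incl hD hD', hS.V, f.pre_preV]

theorem IsCanonical.witt_lam {g : B →ₐ[A] B'}
    (hfg : ∀ r b, f.pre Z r 0 (L.lam r b) = L'.lam r (W.map r (g : B →+* B') b)) (b : W p r B) :
    f.witt Z r 0 (S.lam r b) = S'.lam r (W.map r (g : B →+* B') b) := by
  have pre_incl₀ (x : D.Witt Z r 0) :
    f.pre Z r 0 (incl₀ hD r x) = incl₀ hD' r (f.witt Z r 0 x) := f.pre_incl hD hD' x
  apply eq_of_mu_smul_incl₀_eq hp hD'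
  rw [hS'.mu_smul_incl₀_lam, ← hfg, ← pre_incl₀, ← map_smul, hS.mu_smul_incl₀_lam, map_smul]

end WittHom

/-- The morphism of Witt complexes `W_*^*(D) → W_*^*(D')` over `B → B'` induced by `D → D'`. -/
def wittHom (f : FrobAlg.Hom D D') (g : B →ₐ[A] B')
    (hfg : ∀ r b, f.pre Z r 0 (L.lam r b) = L'.lam r (W.map r (g : B →+* B') b))
    (hS : IsCanonical Z hD L S) (hS' : IsCanonical Z hD' L' S') : WittStr.Hom g S S' where
  toFun r n := (f.witt Z r n).toAddMonoidHom
  map_smul _ _ := hS.witt_smul hA hp f hS'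
  map_one _ := hS.witt_one hp f hS'
  map_mul _ _ _ _ := hS.witt_mul hp f hS'
  map_d _ _ := hS.witt_d hp f hS'
  map_R _ _ := hS.witt_R hp f hS'
  map_F _ _ := hS.witt_F hp f hS'
  map_V _ _ := hS.witt_V hp f hS'
  map_lam _ := hS.witt_lam hp f hS' hfg

end Canonical

section Comp

variable {p : ℕ} [Fact p.Prime] {A B B' B'' : Type u} [CommRing A] [CommRing B] [Algebra A B]
  [CommRing B'] [Algebra A B'] [CommRing B''] [Algebra A B''] {X Y U : ℕ → ℕ → Type u}
  [∀ r n, AddCommGroup (X r n)] [∀ r n, AddCommGroup (Y r n)] [∀ r n, AddCommGroup (U r n)]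
  {S : WittStr p A B X} {S' : WittStr p A B' Y} {S'' : WittStr p A B'' U}

/-- The composite of two morphisms of Witt complexes. -/
def WittStr.Hom.comp {g' : B' →ₐ[A] B''} {g : B →ₐ[A] B'} (v : WittStr.Hom g' S' S'')
    (u : WittStr.Hom g S S') : WittStr.Hom (g'.comp g) S S'' where
  toFun r n := (v.toFun r n).comp (u.toFun r n)
  map_smul r n a x := (congrArg _ (u.map_smul r n a x)).trans (v.map_smul r n a _)
  map_one r := (congrArg _ (u.map_one r)).trans (v.map_one r)
  map_mul r i j k h x y := (congrArg _ (u.map_mul r i j k h x y)).trans (v.map_mul r i j k h _ _)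
  map_d r n x := (congrArg _ (u.map_d r n x)).trans (v.map_d r n _)
  map_R r n x := (congrArg _ (u.map_R r n x)).trans (v.map_R r n _)
  map_F r n x := (congrArg _ (u.map_F r n x)).trans (v.map_F r n _)
  map_V r n x := (congrArg _ (u.map_V r n x)).trans (v.map_V r n _)
  map_lam r b := ((congrArg _ (u.map_lam r b)).trans (v.map_lam r _)).trans
    (congrArg _ (W.map_map r _ _ b))

theorem WittStr.Hom.comp_eq_comp_map {g : B →ₐ[A] B'} (v : WittStr.Hom g S S')
    (u : WittStr.Hom (AlgHom.id A B) (deRhamWitt.str p A B) S)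
    (u' : WittStr.Hom (AlgHom.id A B') (deRhamWitt.str p A B') S') :
    v.comp u = u'.comp (deRhamWitt.map g) :=
  (deRhamWitt.hom_unique g S' (v.comp u)).trans
    (deRhamWitt.hom_unique g S' (u'.comp (deRhamWitt.map g))).symm

end Comp

end AInf

end

theorem mainTheorem7 {p : ℕ} [Fact p.Prime] {A : Type u} [CommRing A] [Fact (¬ IsUnit (p : A))]
    [IsAdicComplete (Ideal.span {(p : A)}) A] (hA : AInf.IsPerfectoid p A)
    (hpA : ∀ a : A, (p : A) * a = 0 → a = 0) (Z : AInf.RootSystem p A) :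
    -- the Witt complex and its universal map
    (∀ (D : AInf.FrobAlg p A) (hD : D.Admissible Z) (B : Type u) [CommRing B] [Algebra A B]
      (L : AInf.StructureMaps Z D B),
      (∃! S : AInf.WittStr p A B (D.Witt Z), AInf.IsCanonical Z hD L S) ∧
      (∀ S : AInf.WittStr p A B (D.Witt Z), AInf.IsCanonical Z hD L S →
        ∃ u : AInf.WittStr.Hom (AlgHom.id A B) (AInf.deRhamWitt.str p A B) S, ∀ u', u' = u)) ∧
    -- functoriality
    (∀ (D D' : AInf.FrobAlg p A) (hD : D.Admissible Z) (hD' : D'.Admissible Z)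
      (B B' : Type u) [CommRing B] [Algebra A B] [CommRing B'] [Algebra A B']
      (L : AInf.StructureMaps Z D B) (L' : AInf.StructureMaps Z D' B')
      (f : AInf.FrobAlg.Hom D D') (g : B →ₐ[A] B'),
      (∀ r b, f.pre Z r 0 (L.lam r b) = L'.lam r (AInf.W.map r (g : B →+* B') b)) →
      ∀ (S : AInf.WittStr p A B (D.Witt Z)) (S' : AInf.WittStr p A B' (D'.Witt Z)),
        AInf.IsCanonical Z hD L S → AInf.IsCanonical Z hD' L' S' →
        (∃ h : AInf.WittStr.Hom g S S', ∀ r n x, h.toFun r n x = f.witt Z r n x) ∧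
        ∀ (u : AInf.WittStr.Hom (AlgHom.id A B) (AInf.deRhamWitt.str p A B) S)
          (u' : AInf.WittStr.Hom (AlgHom.id A B') (AInf.deRhamWitt.str p A B') S')
          (r n : ℕ) (x : AInf.deRhamWitt.Omega p A B r n),
          f.witt Z r n (u.toFun r n x) = u'.toFun r n ((AInf.deRhamWitt.map g).toFun r n x)) := by
  have hp : (p : A) ∈ nonZeroDivisors A := mem_nonZeroDivisors_iff_right.2 fun a ha =>
    hpA a ((mul_comm _ _).trans ha)
  refine ⟨fun D hD B _ _ L => ⟨?_, fun S _ => ?_⟩,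
    fun D D' hD hD' B B' _ _ _ _ L L' f g hfg S S' hS hS' => ⟨?_, fun u u' r n x => ?_⟩⟩
  · have hS₀ := AInf.wittStr_isCanonical hA hp hD L
    exact ⟨_, hS₀, fun S hS => hS.unique hA hp hS₀⟩
  · exact ⟨AInf.deRhamWitt.lift _ S, AInf.deRhamWitt.hom_unique _ S⟩
  · exact ⟨AInf.wittHom hA hp f g hfg hS hS', fun _ _ _ => rfl⟩
  · exact congrArg (fun v : AInf.WittStr.Hom g (AInf.deRhamWitt.str p A B) S' => v.toFun r n x)
      ((AInf.wittHom hA hp f g hfg hS hS').comp_eq_comp_map u u')
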